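/- **Setting.** Let $d\ge 2$; for $i\in\{1,\dots,2d\}$ let $\bar i\in\{1,\dots,2d\}$, $\bar i\equiv i+d \pmod{2d}$. Let $D_1,\dots,D_{2d}\subset\mathbf C$ be open discs centered on $\mathbf R$ with pairwise disjoint closures, and let $\gamma_1,\dots,\gamma_{2d}\in \mathrm{SL}_2(\mathbf R)$ satisfy $\gamma_{\bar i}=\gamma_i^{-1}$ and $\gamma_i(\hat{\mathbf C}\setminus D_{\bar i})=\overline{D_i}$. Let $\Lambda=\langle\gamma_1,\dots,\gamma_{2d}\rangle$ and let $\delta$ be the Hausdorff dimension of its limit set (the set of accumulation points in $\partial\mathbb H$ of a $\Lambda$-orbit in $\mathbb H$). Put $\mathbf D=\bigcup_i D_i$, let $\mathcal H(\mathbf D)$ be the Hilbert space of square integrable holomorphic functions on $\mathbf D$, and for $s\in\mathbf C$ define $$A_i(s)f(x)=\mathbf 1\{x\notin D_i\}\,e^{-s\tau(\gamma_{\bar i}(x))}f(\gamma_{\bar i}(x)),\qquad x\in\mathbf D,$$ where $\tau$ is the holomorphic extension to $\bigcup_{i}\bigcup_{j\ne\bar i}\gamma_i(D_j)$ of $x\mapsto\log|T'(x)|$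 from the real points, $T|_{D_i}=\gamma_i^{-1}$. For a word $w=(i_1,\dots,i_\ell)$ put $A(s)_w=A_{i_1}(s)\cdots A_{i_\ell}(s)$. **Paths.** Let $n,\ell,m\ge1$ and $[n]=\{1,\dots,n\}$. A path $p=((x_1,i_1),\dots,(x_{\ell+1},i_{\ell+1}))$ is a sequence of half-edges in $[n]\times\{1,\dots,2d\}$. Its colored graph has vertices $x_1,\dots,x_{\ell+1}$ and colored edges $[x_t,i_t,x_{t+1}]$, $1\le t\le\ell$, where $[x,i,y]=[y,\bar i,x]$. The path is non-backtracking if $i_t\ne\overline{i_{t+1}}$ for all $t\leq \ell$, and tangle-free if its graph contains at most one cycle (loops and pairs of parallel edges are cycles). Put $\hat{\mathbf i}(p)=(i_2,\dots,i_{\ell+1})$. Let $W_{\ell,m}$ be the set of $\gamma=(\gamma_1,\dots,\gamma_{2m})$ consisting of non-backtracking tangle-free paths with $\ell+1$ half-edges such that, for $j=1,\dots,m$, the paths $\gamma_{2j}$ and $\gamma_{2j+1}$ have the same first half-edge and the paths $\gamma_{2j-1}$ and $\gamma_{2j}$ have the same last half-edge ($\gamma_{2m+1}=\gamma_1$). Let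 $G_\gamma$ be the union of the colored graphs of the $\gamma_j$, and let $W_{\ell,m}(v,e)$ be the set of $\gamma\in W_{\ell,m}$ for which $G_\gamma$ has $v$ vertices and $e$ edges. An edge has multiplicity one if $\gamma$ traverses it exactly once (counting both directions). Two elements of $W_{\ell,m}$ are isomorphic if one arises from the other by relabeling the vertices of $G_\gamma$ in $[n]$ and changing the colors of the edges of $G_\gamma$ (bijectively on vertices and on edges, and compatibly with $[x,i,y]=[y,\bar i,x]$); the last colors $i_{j,\ell+1}$, which belong to no edge, may change arbitrarily within $W_{\ell,m}$. **Proposition.** For every compact $\mathcal K\subset\{s:\mathrm{Re}(s)>\delta/2\}$ there are $\rho\in(0,1)$ and $C>0$, depending only on $\mathcal K$ and the Schottky data, such that for all $s\in\mathcal K$, all $n,\ell,m\ge1$, all $v,e$ and all $\gamma^0\in W_{\ell,m}(v,e)$, the operators below are trace class and $$\sum_{\gamma\text{ isomorphic to }\gamma^0}\left|\mathrm{tr}\left[A(s)_{\hat{\mathbf i}(\gamma_1)}A(s)^*_{\hat{\mathbf i}(\gamma_2)}\cdots A(s)_{\hat{\mathbf i}(\gamma_{2m-1})}A(s)^*_{\hat{\mathbf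 i}(\gamma_{2m})}\right]\right|\le C^{\,m+\mathrm{rank}+e_1}\,n^v\,\rho^{2\ell m},$$ where $e_1$ is the number of edges of $G_{\gamma^0}$ of multiplicity one and $\mathrm{rank}=e-v+1$. -/

import Mathlib

namespace SchottkyTrace

open MeasureTheory Metric Set Filter Topology TopologicalSpace
open scoped ENNReal InnerProductSpace Real MatrixGroups UpperHalfPlane

/-! ## A mean value bound on discs -/


theorem circle_bound {g : ℂ → ℂ} {z : ℂ} {t : ℝ} (ht : 0 < t)
    (hg : DifferentiableOn ℂ g (closedBall z t)) :
    ENNReal.ofReal (2 * π) * ‖g z‖ₑ ≤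
      ∫⁻ θ in Ioo (-π) π, ‖g (z + t * (Real.cos θ + Real.sin θ * Complex.I))‖ₑ := by
  have h1 : Real.circleAverage g z t = g z := by
    apply DiffContOnCl.circleAverage
    rw [abs_of_pos ht]
    exact (hg.mono closure_ball_subset_closedBall).diffContOnCl
  rw [Real.circleAverage_eq_integral_add (-π)] at h1
  have h2 : ∫ θ in (0:ℝ)..2 * π, g (circleMap z t (θ + -π)) = ∫ θ in (-π)..π, g (circleMap z t θ) := by
    rw [intervalIntegral.integral_comp_add_right (fun θ => g (circleMap z t θ)) (-π)]
    congr 1 <;> ring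
  rw [h2] at h1
  have h3 : (2 * π) • g z = ∫ θ in (-π)..π, g (circleMap z t θ) := by
    rw [← h1, smul_smul, mul_inv_cancel₀ (by positivity), one_smul]
  have h4 : ENNReal.ofReal (2 * π) * ‖g z‖ₑ = ‖(2 * π) • g z‖ₑ := by
    rw [enorm_smul, Real.enorm_of_nonneg (by positivity)]
  rw [h4, h3, intervalIntegral.integral_of_le (by linarith [Real.pi_pos]),
    integral_Ioc_eq_integral_Ioo]
  refine (enorm_integral_le_lintegral_enorm _).trans (le_of_eq ?_)
  refine lintegral_congr fun θ => ?_
  simp [circleMap, Complex.exp_mul_I]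

theorem disc_bound {g : ℂ → ℂ} {z : ℂ} {r : ℝ} (hr : 0 < r)
    (hg : DifferentiableOn ℂ g (ball z r)) :
    ENNReal.ofReal (2 * π) * ‖g z‖ₑ * ENNReal.ofReal (r / 2) * ENNReal.ofReal (r / 2) ≤
      ∫⁻ w in ball z r, ‖g w‖ₑ := by
  set F : ℂ → ℝ≥0∞ := (ball z r).indicator (fun w => ‖g w‖ₑ) with hF
  classical
  have hFm : Measurable F := by
    have h1 : F = fun w => ‖(ball z r).piecewise g (fun _ => 0) w‖ₑ := by
      ext w
      by_cases hw : w ∈ ball z r <;> simp [hF, hw]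
    rw [h1]
    exact (hg.continuousOn.measurable_piecewise continuousOn_const
      measurableSet_ball).enorm
  rw [← lintegral_indicator measurableSet_ball, ← hF, ← lintegral_add_left_eq_self F z,
    ← Complex.lintegral_comp_polarCoord_symm, polarCoord_target]
  have hsub : Ioo (r / 2) r ×ˢ Ioo (-π) π ⊆ Ioi (0 : ℝ) ×ˢ Ioo (-π) π :=
    Set.prod_mono (fun t ht => lt_trans (by positivity) ht.1) subset_rfl
  refine le_trans ?_ (lintegral_mono_set hsub)
  rw [Measure.volume_eq_prod, setLIntegral_prod]
  · calc _ = ∫⁻ t in Ioo (r / 2) r,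
          ENNReal.ofReal (r / 2) * (ENNReal.ofReal (2 * π) * ‖g z‖ₑ) := by
          rw [setLIntegral_const, Real.volume_Ioo, show r - r / 2 = r / 2 by ring]
          ring
      _ ≤ _ := by
        refine setLIntegral_mono' measurableSet_Ioo fun t ht => ?_
        have ht0 : 0 < t := lt_trans (by positivity) ht.1
        simp only [smul_eq_mul, Complex.polarCoord_symm_apply]
        rw [lintegral_const_mul' _ _ ENNReal.ofReal_ne_top]
        refine mul_le_mul' (ENNReal.ofReal_le_ofReal ht.1.le) ?_
        refine (circle_bound ht0 (hg.mono (closedBall_subset_ball ht.2))).trans ?_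
        refine lintegral_mono fun θ => ?_
        have hmem : z + t * (Real.cos θ + Real.sin θ * Complex.I) ∈ ball z r := by
          have : ‖(Real.cos θ + Real.sin θ * Complex.I : ℂ)‖ = 1 := by
            simp
          rw [mem_ball, dist_eq_norm, add_sub_cancel_left, norm_mul, this, mul_one,
            Complex.norm_real, Real.norm_of_nonneg ht0.le]
          exact ht.2
        rw [hF, Set.indicator_of_mem hmem]
  · refine Measurable.aemeasurable ?_
    simp only [smul_eq_mul, Complex.polarCoord_symm_apply]
    exact (by fun_prop : Measurable fun p : ℝ × ℝ => ENNReal.ofReal p.1).mul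
      (hFm.comp (by fun_prop))


/-- The square integrable functions on `U` (up to almost everywhere equality) that are almost
everywhere equal to a holomorphic function on `U`. -/
noncomputable def bergmanSubmodule (U : Opens ℂ) :
    Submodule ℂ (Lp ℂ 2 (volume.restrict (U : Set ℂ))) where
  carrier := {f | ∃ g : ℂ → ℂ, DifferentiableOn ℂ g U ∧ f =ᵐ[volume.restrict (U : Set ℂ)] g}
  zero_mem' := ⟨0, differentiableOn_const 0, Lp.coeFn_zero ℂ 2 _⟩
  add_mem' := by
    rintro f₁ f₂ ⟨g₁, h₁, e₁⟩ ⟨g₂, h₂, e₂⟩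
    exact ⟨g₁ + g₂, h₁.add h₂, (Lp.coeFn_add f₁ f₂).trans (e₁.add e₂)⟩
  smul_mem' := by
    rintro a f ⟨g, h, e⟩
    exact ⟨a • g, h.const_smul a, (Lp.coeFn_smul a f).trans (e.const_smul a)⟩

/-- The Bergman space of `U`, with the inner product of `L²(U)`. -/
abbrev BergmanSpace (U : Opens ℂ) : Type := bergmanSubmodule U

namespace BergmanSpace

variable {U : Opens ℂ}

/-- The holomorphic representative (unique on `U`). -/
noncomputable def toFun (f : BergmanSpace U) : ℂ → ℂ := f.2.choose

theorem differentiableOn_toFun (f : BergmanSpace U) : DifferentiableOn ℂ f.toFun U :=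
  f.2.choose_spec.1

theorem coe_ae_eq_toFun (f : BergmanSpace U) :
    (f : Lp ℂ 2 (volume.restrict (U : Set ℂ))) =ᵐ[volume.restrict (U : Set ℂ)] f.toFun :=
  f.2.choose_spec.2

theorem toFun_eqOn (f : BergmanSpace U) {g : ℂ → ℂ} (hg : DifferentiableOn ℂ g U)
    (h : (f : Lp ℂ 2 (volume.restrict (U : Set ℂ))) =ᵐ[volume.restrict (U : Set ℂ)] g) :
    EqOn f.toFun g U :=
  Measure.eqOn_open_of_ae_eq (f.coe_ae_eq_toFun.symm.trans h) U.isOpen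
    f.differentiableOn_toFun.continuousOn hg.continuousOn

theorem toFun_add (f₁ f₂ : BergmanSpace U) : EqOn (f₁ + f₂).toFun (f₁.toFun + f₂.toFun) U :=
  toFun_eqOn _ (f₁.differentiableOn_toFun.add f₂.differentiableOn_toFun)
    ((Lp.coeFn_add _ _).trans (f₁.coe_ae_eq_toFun.add f₂.coe_ae_eq_toFun))

theorem toFun_smul (a : ℂ) (f : BergmanSpace U) : EqOn (a • f).toFun (a • f.toFun) U :=
  toFun_eqOn _ (f.differentiableOn_toFun.const_smul a)
    ((Lp.coeFn_smul _ _).trans (f.coe_ae_eq_toFun.const_smul a))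

theorem lintegral_toFun (f : BergmanSpace U) :
    ∫⁻ w in (U : Set ℂ), ‖f.toFun w‖ₑ ^ 2 = ‖f‖ₑ ^ 2 := by
  have h1 : ‖f‖ₑ = eLpNorm (f : Lp ℂ 2 (volume.restrict (U : Set ℂ))) 2
      (volume.restrict (U : Set ℂ)) := Lp.enorm_def _
  have h2 := eLpNorm_nnreal_pow_eq_lintegral (p := 2) (μ := volume.restrict (U : Set ℂ))
    (f := (f : Lp ℂ 2 (volume.restrict (U : Set ℂ)))) (by norm_num)
  rw [h1]
  simp only [NNReal.coe_ofNat, ENNReal.rpow_ofNat, ENNReal.coe_ofNat] at h2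
  rw [h2]
  refine lintegral_congr_ae ?_
  filter_upwards [f.coe_ae_eq_toFun] with w hw
  rw [hw]

theorem norm_toFun_le_of_ball {r : ℝ} (hr : 0 < r) :
    ∃ C : ℝ, 0 ≤ C ∧ ∀ (f : BergmanSpace U) (z : ℂ), ball z r ⊆ U → ‖f.toFun z‖ ≤ C * ‖f‖ := by
  set a : ℝ := 2 * π * (r / 2) * (r / 2) with ha
  have ha0 : 0 < a := by positivity
  refine ⟨Real.sqrt a⁻¹, Real.sqrt_nonneg _, fun f z hz => ?_⟩
  have h1 := disc_bound hr ((f.differentiableOn_toFun.mono hz).pow 2)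
  have h2 : ENNReal.ofReal a * ‖f.toFun z‖ₑ ^ 2 ≤ ‖f‖ₑ ^ 2 := by
    rw [← lintegral_toFun]
    refine le_trans ?_ (lintegral_mono_set hz)
    simp only [Pi.pow_apply, enorm_pow] at h1
    refine le_trans (le_of_eq ?_) h1
    rw [ha, ENNReal.ofReal_mul (by positivity), ENNReal.ofReal_mul (by positivity)]
    ring
  have h3 : a * ‖f.toFun z‖ ^ 2 ≤ ‖f‖ ^ 2 := by
    rw [← ofReal_norm, ← ofReal_norm, ← ENNReal.ofReal_pow (norm_nonneg _),
      ← ENNReal.ofReal_pow (norm_nonneg _), ← ENNReal.ofReal_mul ha0.le] at h2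
    exact (ENNReal.ofReal_le_ofReal_iff (by positivity)).1 h2
  rw [← Real.sqrt_sq (norm_nonneg f), ← Real.sqrt_mul (by positivity)]
  refine Real.le_sqrt_of_sq_le ?_
  rw [inv_mul_eq_div, le_div_iff₀ ha0]
  linarith

theorem norm_toFun_le {K : Set ℂ} (hK : IsCompact K) (hKU : K ⊆ U) :
    ∃ C : ℝ, 0 ≤ C ∧ ∀ (f : BergmanSpace U), ∀ z ∈ K, ‖f.toFun z‖ ≤ C * ‖f‖ := by
  obtain ⟨r, hr, h⟩ := hK.exists_thickening_subset_open U.isOpen hKU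
  obtain ⟨C, hC, h'⟩ := norm_toFun_le_of_ball (U := U) hr
  exact ⟨C, hC, fun f z hz => h' f z ((ball_subset_thickening hz r).trans h)⟩

theorem isClosed_bergmanSubmodule (U : Opens ℂ) :
    IsClosed (bergmanSubmodule U : Set (Lp ℂ 2 (volume.restrict (U : Set ℂ)))) := by
  refine isClosed_of_closure_subset fun f hf => ?_
  obtain ⟨u, hu, hlim⟩ := mem_closure_iff_seq_limit.1 hf
  let v : ℕ → BergmanSpace U := fun k => ⟨u k, hu k⟩
  have hv : CauchySeq v := by
    have : CauchySeq u := hlim.cauchySeq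
    rw [Metric.cauchySeq_iff] at this ⊢
    exact this
  have hsub : ∀ k l, EqOn (v k - v l).toFun ((v k).toFun - (v l).toFun) U := fun k l =>
    toFun_eqOn _ ((v k).differentiableOn_toFun.sub (v l).differentiableOn_toFun)
      ((Lp.coeFn_sub _ _).trans ((v k).coe_ae_eq_toFun.sub (v l).coe_ae_eq_toFun))
  have hunif : ∀ K : Set ℂ, IsCompact K → K ⊆ U →
      UniformCauchySeqOn (fun k => (v k).toFun) atTop K := by
    intro K hK hKU
    obtain ⟨C, hC, hb⟩ := norm_toFun_le hK hKU
    rw [Metric.uniformCauchySeqOn_iff]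
    intro ε hε
    obtain ⟨N, hN⟩ := Metric.cauchySeq_iff.1 hv (ε / (C + 1)) (by positivity)
    refine ⟨N, fun k hk l hl x hx => ?_⟩
    have h1 := hb (v k - v l) x hx
    rw [hsub k l (hKU hx)] at h1
    rw [dist_eq_norm]
    have h2 := hN k hk l hl
    rw [dist_eq_norm, lt_div_iff₀ (by positivity)] at h2
    have h3 : (v k).toFun x - (v l).toFun x = ((v k).toFun - (v l).toFun) x := rfl
    rw [h3]
    nlinarith [norm_nonneg (v k - v l)]
  have hpt : ∀ x ∈ (U : Set ℂ), ∃ y, Tendsto (fun k => (v k).toFun x) atTop (𝓝 y) := fun x hx =>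
    cauchySeq_tendsto_of_complete
      ((hunif {x} isCompact_singleton (by simpa using hx)).cauchySeq (mem_singleton x))
  choose! g hg using hpt
  have hloc : TendstoLocallyUniformlyOn (fun k => (v k).toFun) g atTop U := by
    rw [tendstoLocallyUniformlyOn_iff_forall_isCompact U.isOpen]
    intro K hKU hK
    exact (hunif K hK hKU).tendstoUniformlyOn_of_tendsto fun x hx => hg x (hKU hx)
  refine ⟨g, hloc.differentiableOn (Eventually.of_forall fun k => (v k).differentiableOn_toFun)
    U.isOpen, ?_⟩
  have hmeas : TendstoInMeasure (volume.restrict (U : Set ℂ)) (fun k => u k) atTop f :=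
    tendstoInMeasure_of_tendsto_Lp hlim
  obtain ⟨ns, hns, hae⟩ := hmeas.exists_seq_tendsto_ae
  have hall : ∀ᵐ x ∂(volume.restrict (U : Set ℂ)), ∀ k, u k x = (v k).toFun x :=
    ae_all_iff.2 fun k => (v k).coe_ae_eq_toFun
  filter_upwards [hae, hall, ae_restrict_mem U.isOpen.measurableSet] with x h1 h2 h3
  refine tendsto_nhds_unique h1 ?_
  simp_rw [h2]
  exact (hg x h3).comp hns.tendsto_atTop

instance : CompleteSpace (BergmanSpace U) :=
  (isClosed_bergmanSubmodule U).completeSpace_coe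

end BergmanSpace

/-! ## Weighted composition operators on Bergman spaces -/

namespace BergmanSpace

variable {U : Opens ℂ}

/-- Conditions under which `f ↦ 1_E · w · (f ∘ φ)` is a bounded operator on the Bergman space. -/
structure IsCompData (U : Opens ℂ) (E : Set ℂ) (w φ : ℂ → ℂ) : Prop where
  finite : volume (U : Set ℂ) < ∞
  differentiableOn : ∀ g : ℂ → ℂ, DifferentiableOn ℂ g U →
    DifferentiableOn ℂ (E.indicator fun z => w z * g (φ z)) U
  maps : ∃ K : Set ℂ, IsCompact K ∧ K ⊆ U ∧ ∀ z ∈ (U : Set ℂ), z ∈ E → φ z ∈ K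
  bounded : ∃ C : ℝ, 0 ≤ C ∧ ∀ z ∈ (U : Set ℂ), z ∈ E → ‖w z‖ ≤ C

theorem IsCompData.exists_bound {E : Set ℂ} {w φ : ℂ → ℂ} (h : IsCompData U E w φ) :
    ∃ C : ℝ, 0 ≤ C ∧ ∀ f : BergmanSpace U, ∀ z ∈ (U : Set ℂ),
      ‖E.indicator (fun z => w z * f.toFun (φ z)) z‖ ≤ C * ‖f‖ := by
  obtain ⟨K, hK, hKU, hφ⟩ := h.maps
  obtain ⟨C₁, hC₁, hb⟩ := norm_toFun_le hK hKU
  obtain ⟨C₂, hC₂, hw⟩ := h.bounded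
  refine ⟨C₂ * C₁, by positivity, fun f z hz => ?_⟩
  by_cases hE : z ∈ E
  · rw [Set.indicator_of_mem hE, norm_mul, mul_assoc]
    exact mul_le_mul (hw z hz hE) (hb f _ (hφ z hz hE)) (norm_nonneg _) hC₂
  · rw [Set.indicator_of_notMem hE, norm_zero]
    positivity

theorem IsCompData.memLp {E : Set ℂ} {w φ : ℂ → ℂ} (h : IsCompData U E w φ)
    (f : BergmanSpace U) :
    MemLp (E.indicator fun z => w z * f.toFun (φ z)) 2 (volume.restrict (U : Set ℂ)) := by
  have : IsFiniteMeasure (volume.restrict (U : Set ℂ)) := ⟨by simpa using h.finite⟩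
  obtain ⟨C, hC, hb⟩ := h.exists_bound
  exact MemLp.of_bound ((h.differentiableOn _ f.differentiableOn_toFun).continuousOn.aestronglyMeasurable
    U.isOpen.measurableSet) (C * ‖f‖)
    ((ae_restrict_iff' U.isOpen.measurableSet).2 (Eventually.of_forall (hb f)))

/-- The function `1_E · w · (f ∘ φ)` as an element of the Bergman space. -/
noncomputable def IsCompData.map {E : Set ℂ} {w φ : ℂ → ℂ} (h : IsCompData U E w φ)
    (f : BergmanSpace U) : BergmanSpace U :=
  ⟨(h.memLp f).toLp _, _, h.differentiableOn _ f.differentiableOn_toFun, (h.memLp f).coeFn_toLp⟩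

theorem IsCompData.map_toFun {E : Set ℂ} {w φ : ℂ → ℂ} (h : IsCompData U E w φ)
    (f : BergmanSpace U) :
    EqOn (h.map f).toFun (E.indicator fun z => w z * f.toFun (φ z)) U :=
  toFun_eqOn _ (h.differentiableOn _ f.differentiableOn_toFun) (h.memLp f).coeFn_toLp

theorem ext_toFun {f g : BergmanSpace U} (h : EqOn f.toFun g.toFun U) : f = g := by
  refine Subtype.ext (Lp.ext ?_)
  refine f.coe_ae_eq_toFun.trans (EventuallyEq.trans ?_ g.coe_ae_eq_toFun.symm)
  exact (ae_restrict_iff' U.isOpen.measurableSet).2 (Eventually.of_forall h)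

/-- The bounded operator `f ↦ 1_E · w · (f ∘ φ)` on the Bergman space. -/
noncomputable def IsCompData.op {E : Set ℂ} {w φ : ℂ → ℂ} (h : IsCompData U E w φ) :
    BergmanSpace U →L[ℂ] BergmanSpace U :=
  LinearMap.mkContinuousOfExistsBound
    { toFun := h.map
      map_add' := by
        intro f g
        refine ext_toFun fun z hz => ?_
        rw [h.map_toFun _ hz, toFun_add _ _ hz, Pi.add_apply, h.map_toFun _ hz, h.map_toFun _ hz]
        by_cases hE : z ∈ E
        · obtain ⟨K, -, hKU, hφ⟩ := h.maps
          simp only [Set.indicator_of_mem hE]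
          rw [toFun_add _ _ (hKU (hφ z hz hE)), Pi.add_apply, mul_add]
        · simp only [Set.indicator_of_notMem hE, add_zero]
      map_smul' := by
        intro a f
        refine ext_toFun fun z hz => ?_
        rw [h.map_toFun _ hz, RingHom.id_apply, toFun_smul _ _ hz, Pi.smul_apply,
          h.map_toFun _ hz]
        by_cases hE : z ∈ E
        · obtain ⟨K, -, hKU, hφ⟩ := h.maps
          simp only [Set.indicator_of_mem hE]
          rw [toFun_smul _ _ (hKU (hφ z hz hE)), Pi.smul_apply, smul_eq_mul, smul_eq_mul,
            mul_left_comm]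
        · simp only [Set.indicator_of_notMem hE, smul_zero] }
    (by
      have : IsFiniteMeasure (volume.restrict (U : Set ℂ)) := ⟨by simpa using h.finite⟩
      obtain ⟨C, hC, hb⟩ := h.exists_bound
      refine ⟨(measureUnivNNReal (volume.restrict (U : Set ℂ)) : ℝ) ^ (2 : ℝ≥0∞).toReal⁻¹ * C,
        fun f => ?_⟩
      rw [mul_assoc]
      refine Lp.norm_le_of_ae_bound (by positivity) ?_
      filter_upwards [(h.memLp f).coeFn_toLp, ae_restrict_mem U.isOpen.measurableSet] with z h1 h2
      refine le_trans (le_of_eq ?_) (hb f z h2)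
      exact congrArg norm h1)

theorem IsCompData.op_toFun {E : Set ℂ} {w φ : ℂ → ℂ} (h : IsCompData U E w φ)
    (f : BergmanSpace U) :
    EqOn (h.op f).toFun (E.indicator fun z => w z * f.toFun (φ z)) U :=
  h.map_toFun f

end BergmanSpace

/-! ## Trace class operators and the trace -/

section Trace

variable {H : Type*} [NormedAddCommGroup H] [InnerProductSpace ℂ H] [CompleteSpace H]

/-- `T` is trace class (nuclear): `T x = ∑ ⟨a k, x⟩ b k` with `∑ ‖a k‖ ‖b k‖ < ∞`. -/
def IsTraceClass (T : H →L[ℂ] H) : Prop :=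
  ∃ a b : ℕ → H, Summable (fun k => ‖a k‖ * ‖b k‖) ∧
    ∀ x : H, HasSum (fun k => ⟪a k, x⟫_ℂ • b k) (T x)

/-- The trace `∑ ⟨e i, T (e i)⟩` over an orthonormal (Hilbert) basis; for a trace class operator
the series converges absolutely and does not depend on the basis. -/
noncomputable def opTrace (T : H →L[ℂ] H) : ℂ :=
  let b := (exists_hilbertBasis ℂ H).choose_spec.choose
  ∑' i, ⟪b i, T (b i)⟫_ℂ

end Trace

/-! ## Schottky data -/

/-- The involution `i ↦ i + d mod 2d` on the alphabet of `2d` letters. -/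
def bar {d : ℕ} (i : Fin (2 * d)) : Fin (2 * d) :=
  ⟨(i.1 + d) % (2 * d), Nat.mod_lt _ (by have := i.2; omega)⟩

theorem bar_bar {d : ℕ} (i : Fin (2 * d)) : bar (bar i) = i := by
  have hi := i.2
  apply Fin.ext
  simp only [bar]
  rcases lt_or_ge (i.1 + d) (2 * d) with h | h
  · rw [Nat.mod_eq_of_lt h, show i.1 + d + d = i.1 + 2 * d by ring, Nat.add_mod_right,
      Nat.mod_eq_of_lt hi]
  · rw [Nat.mod_eq_sub_mod h, Nat.mod_eq_of_lt (a := i.1 + d - 2 * d) (by omega),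
      Nat.mod_eq_of_lt (by omega)]
    omega

/-- A real matrix of determinant one, as an element of `GL₂(ℂ)`, which acts on the Riemann sphere
`OnePoint ℂ` by Möbius transformations. -/
noncomputable def toGLC (g : SL(2, ℝ)) : GL (Fin 2) ℂ :=
  (Matrix.SpecialLinearGroup.map (algebraMap ℝ ℂ) g : SL(2, ℂ))

/-- The Möbius transformation of `g` at finite points. -/
noncomputable def mob (g : SL(2, ℝ)) (z : ℂ) : ℂ :=
  ((g 0 0 : ℂ) * z + (g 0 1 : ℂ)) / ((g 1 0 : ℂ) * z + (g 1 1 : ℂ))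

theorem toGLC_smul_coe (g : SL(2, ℝ)) (z : ℂ) :
    toGLC g • (z : OnePoint ℂ) =
      if (g 1 0 : ℂ) * z + (g 1 1 : ℂ) = 0 then OnePoint.infty else ((mob g z : ℂ) : OnePoint ℂ) := by
  rw [OnePoint.smul_some_eq_ite]
  simp [toGLC, mob]

/-- Schottky data with `2d` open discs centered on the real line, with pairwise disjoint closures,
and matrices `gen i` in `SL₂(ℝ)` mapping the complement (in the Riemann sphere) of the disc with
index `bar i` onto the closure of the disc with index `i`. -/
structure SchottkyData (d : ℕ) where
  center : Fin (2 * d) → ℝ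
  radius : Fin (2 * d) → ℝ
  radius_pos : ∀ i, 0 < radius i
  disjoint_closedBall : ∀ i j, i ≠ j →
    Disjoint (closedBall (center i : ℂ) (radius i)) (closedBall (center j : ℂ) (radius j))
  gen : Fin (2 * d) → SL(2, ℝ)
  gen_bar : ∀ i, gen (bar i) = (gen i)⁻¹
  image_compl : ∀ i,
    (fun z : OnePoint ℂ => toGLC (gen i) • z) ''
        (((↑) : ℂ → OnePoint ℂ) '' ball (center (bar i) : ℂ) (radius (bar i)))ᶜ =
      ((↑) : ℂ → OnePoint ℂ) '' closedBall (center i : ℂ) (radius i)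

namespace SchottkyData

variable {d : ℕ} (S : SchottkyData d)

/-- The open disc `D i`. -/
def disc (i : Fin (2 * d)) : Set ℂ := ball (S.center i : ℂ) (S.radius i)

/-- The closed disc with the same center and radius. -/
def cdisc (i : Fin (2 * d)) : Set ℂ := closedBall (S.center i : ℂ) (S.radius i)

/-- The union of the open discs. -/
def discs : Opens ℂ := ⟨⋃ i, S.disc i, isOpen_iUnion fun _ => isOpen_ball⟩

/-- The Schottky group. -/
def group : Subgroup SL(2, ℝ) := Subgroup.closure (Set.range S.gen)

/-- The limit set: the accumulation points on the real line of an orbit in the upper half plane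
(it does not depend on the orbit, and `∞` is never an accumulation point). -/
def limitSet : Set ℝ :=
  {x | AccPt (x : ℂ) (𝓟 {w : ℂ | ∃ g ∈ S.group, w = ((g • UpperHalfPlane.I : ℍ) : ℂ)})}

/-- The Hausdorff dimension of the limit set. -/
noncomputable def delta : ℝ := (dimH S.limitSet).toReal

/-- The function `τ = log T'` on the disc `D k`, where the Bowen-Series map `T` is given on `D k` by
the Möbius transformation of `gen (bar k)`, of derivative `1 / (c z + d)²`. The principal
logarithm is real on the real line and holomorphic on all discs `gen k (D j)`, `j ≠ bar k`. -/
noncomputable def tau (k : Fin (2 * d)) (z : ℂ) : ℂ :=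
  Complex.log (1 / ((S.gen (bar k) 1 0 : ℂ) * z + (S.gen (bar k) 1 1 : ℂ)) ^ 2)

/-- The weight `e^{-s τ(γ (x))}` with `γ = gen (bar i)`, which maps into `D (bar i)`. -/
noncomputable def weight (s : ℂ) (i : Fin (2 * d)) (x : ℂ) : ℂ :=
  Complex.exp (-s * S.tau (bar i) (mob (S.gen (bar i)) x))

variable {S}

theorem denom_and_mem_cdisc {i : Fin (2 * d)} {z : ℂ} (hz : z ∉ S.disc i) :
    (S.gen (bar i) 1 0 : ℂ) * z + (S.gen (bar i) 1 1 : ℂ) ≠ 0 ∧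
      mob (S.gen (bar i)) z ∈ S.cdisc (bar i) := by
  have h := S.image_compl (bar i)
  rw [bar_bar] at h
  have h1 : toGLC (S.gen (bar i)) • (z : OnePoint ℂ) ∈
      ((↑) : ℂ → OnePoint ℂ) '' closedBall (S.center (bar i) : ℂ) (S.radius (bar i)) := by
    rw [← h]
    refine ⟨z, ?_, rfl⟩
    rintro ⟨w, hw, hwz⟩
    exact hz (OnePoint.coe_injective hwz ▸ hw)
  obtain ⟨w, hw, hwz⟩ := h1
  rw [toGLC_smul_coe] at hwz
  split_ifs at hwz with h0
  · exact absurd hwz (OnePoint.coe_ne_infty w)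
  · exact ⟨h0, OnePoint.coe_injective hwz ▸ hw⟩

theorem mob_mem_disc {i : Fin (2 * d)} {z : ℂ} (hz : z ∉ S.cdisc i) :
    mob (S.gen (bar i)) z ∈ S.disc (bar i) := by
  have hz' : z ∉ S.disc i := fun h => hz (ball_subset_closedBall h)
  obtain ⟨h0, -⟩ := denom_and_mem_cdisc hz'
  by_contra hn
  apply hz
  have hsm : toGLC (S.gen (bar i)) • (z : OnePoint ℂ) = (mob (S.gen (bar i)) z : ℂ) := by
    rw [toGLC_smul_coe, if_neg h0]
  have hback : toGLC (S.gen i) • ((mob (S.gen (bar i)) z : ℂ) : OnePoint ℂ) = (z : OnePoint ℂ) := by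
    rw [← hsm, ← mul_smul, S.gen_bar]
    simp [toGLC]
  have h := S.image_compl i
  have h1 : (z : OnePoint ℂ) ∈
      ((↑) : ℂ → OnePoint ℂ) '' closedBall (S.center i : ℂ) (S.radius i) := by
    rw [← h]
    refine ⟨_, ?_, hback⟩
    rintro ⟨w, hw, hwz⟩
    exact hn (OnePoint.coe_injective hwz ▸ hw)
  obtain ⟨w, hw, hwz⟩ := h1
  exact OnePoint.coe_injective hwz ▸ hw

theorem notMem_cdisc {i j : Fin (2 * d)} (hij : j ≠ i) {z : ℂ} (hz : z ∈ S.cdisc j) :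
    z ∉ S.cdisc i :=
  Set.disjoint_left.1 (S.disjoint_closedBall j i hij) hz

theorem disc_subset_cdisc (i : Fin (2 * d)) : S.disc i ⊆ S.cdisc i := ball_subset_closedBall

theorem weight_eq (s : ℂ) {i : Fin (2 * d)} {z : ℂ} (hz : z ∉ S.disc i) :
    S.weight s i z = Complex.exp
      (-s * Complex.log (((S.gen (bar i) 1 0 : ℂ) * z + (S.gen (bar i) 1 1 : ℂ)) ^ 2)) := by
  obtain ⟨h0, -⟩ := denom_and_mem_cdisc hz
  have hdet : (S.gen (bar i) 0 0 : ℂ) * (S.gen (bar i) 1 1 : ℂ)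
      - (S.gen (bar i) 0 1 : ℂ) * (S.gen (bar i) 1 0 : ℂ) = 1 := by
    have := (S.gen (bar i)).det_coe
    rw [Matrix.det_fin_two] at this
    exact_mod_cast this
  have hgen : S.gen i = (S.gen (bar i))⁻¹ := by rw [S.gen_bar, inv_inv]
  have h10 : S.gen i 1 0 = - S.gen (bar i) 1 0 := by
    rw [hgen, Matrix.SpecialLinearGroup.SL2_inv_expl]; simp
  have h11 : S.gen i 1 1 = S.gen (bar i) 0 0 := by
    rw [hgen, Matrix.SpecialLinearGroup.SL2_inv_expl]; simp
  unfold weight tau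
  rw [bar_bar, h10, h11]
  congr 3
  have hc : ((-S.gen (bar i) 1 0 : ℝ) : ℂ) * mob (S.gen (bar i)) z + (S.gen (bar i) 0 0 : ℂ) =
      1 / ((S.gen (bar i) 1 0 : ℂ) * z + (S.gen (bar i) 1 1 : ℂ)) := by
    unfold mob
    rw [Complex.ofReal_neg]
    field_simp
    linear_combination hdet
  rw [hc]
  simp

theorem sq_mem_slitPlane {i j : Fin (2 * d)} (hij : j ≠ i) {z : ℂ} (hz : z ∈ S.cdisc j) :
    ((S.gen (bar i) 1 0 : ℂ) * z + (S.gen (bar i) 1 1 : ℂ)) ^ 2 ∈ Complex.slitPlane := by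
  have hre : ((z.re : ℝ) : ℂ) ∈ S.cdisc j := by
    simp only [cdisc, mem_closedBall, dist_eq_norm] at hz ⊢
    refine le_trans ?_ hz
    rw [← Complex.ofReal_sub, Complex.norm_real]
    simpa using Complex.abs_re_le_norm (z - S.center j)
  obtain ⟨h0, -⟩ := denom_and_mem_cdisc (S := S) (i := i)
    (fun h => notMem_cdisc hij hre (disc_subset_cdisc i h))
  have h0' : S.gen (bar i) 1 0 * z.re + S.gen (bar i) 1 1 ≠ 0 := by exact_mod_cast h0
  rw [Complex.mem_slitPlane_iff]
  by_cases him : S.gen (bar i) 1 0 * z.im = 0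
  · left
    simp [pow_two, him]
    exact h0'
  · right
    have him2 : (((S.gen (bar i) 1 0 : ℂ) * z + (S.gen (bar i) 1 1 : ℂ)) ^ 2).im =
        2 * ((S.gen (bar i) 1 0 * z.re + S.gen (bar i) 1 1) * (S.gen (bar i) 1 0 * z.im)) := by
      simp [pow_two]
      ring
    rw [him2]
    exact mul_ne_zero two_ne_zero (mul_ne_zero h0' him)

variable (S)

theorem isCompData (s : ℂ) (i : Fin (2 * d)) :
    BergmanSpace.IsCompData S.discs (S.disc i)ᶜ (S.weight s i) (mob (S.gen (bar i))) := by
  have hcpt : IsCompact (⋃ j ∈ {j : Fin (2 * d) | j ≠ i}, S.cdisc j) :=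
    (Set.toFinite _).isCompact_biUnion fun j _ => isCompact_closedBall _ _
  have hmem : ∀ z ∈ (S.discs : Set ℂ), z ∈ (S.disc i)ᶜ →
      z ∈ ⋃ j ∈ {j : Fin (2 * d) | j ≠ i}, S.cdisc j := by
    intro z hz hE
    obtain ⟨j, hj⟩ := Set.mem_iUnion.1 hz
    refine Set.mem_biUnion (x := j) ?_ (disc_subset_cdisc j hj)
    rintro rfl
    exact hE hj
  have hmob : ∀ j ≠ i, ∀ z ∈ S.cdisc j, DifferentiableAt ℂ (mob (S.gen (bar i))) z := by
    intro j hj z hz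
    obtain ⟨h0, -⟩ := denom_and_mem_cdisc (S := S) (i := i)
      (fun h => notMem_cdisc hj hz (disc_subset_cdisc i h))
    unfold mob
    exact DifferentiableAt.div (by fun_prop) (by fun_prop) h0
  have hexp : ∀ j ≠ i, ∀ z ∈ S.cdisc j, DifferentiableAt ℂ (fun z => Complex.exp
      (-s * Complex.log (((S.gen (bar i) 1 0 : ℂ) * z + (S.gen (bar i) 1 1 : ℂ)) ^ 2))) z := by
    intro j hj z hz
    have h1 : DifferentiableAt ℂ (fun z : ℂ =>
        ((S.gen (bar i) 1 0 : ℂ) * z + (S.gen (bar i) 1 1 : ℂ)) ^ 2) z := by fun_prop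
    exact ((h1.clog (sq_mem_slitPlane hj hz)).const_mul (-s)).cexp
  refine ⟨?_, ?_, ?_, ?_⟩
  · refine lt_of_le_of_lt (measure_iUnion_le _) ?_
    rw [tsum_fintype]
    exact ENNReal.sum_lt_top.2 fun j _ => measure_ball_lt_top
  · intro g hg z hz
    obtain ⟨j, hj⟩ := Set.mem_iUnion.1 hz
    have hopen : S.disc j ∈ 𝓝 z := isOpen_ball.mem_nhds hj
    refine DifferentiableAt.differentiableWithinAt ?_
    by_cases hji : j = i
    · subst hji
      refine (differentiableAt_const (0 : ℂ)).congr_of_eventuallyEq ?_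
      filter_upwards [hopen] with w hw
      exact Set.indicator_of_notMem (Set.notMem_compl_iff.2 hw) _
    · have h1 : DifferentiableAt ℂ (fun z => Complex.exp
          (-s * Complex.log (((S.gen (bar i) 1 0 : ℂ) * z + (S.gen (bar i) 1 1 : ℂ)) ^ 2))
            * g (mob (S.gen (bar i)) z)) z := by
        refine (hexp j hji z (disc_subset_cdisc j hj)).mul ?_
        have h2 : mob (S.gen (bar i)) z ∈ (S.discs : Set ℂ) :=
          Set.mem_iUnion.2 ⟨_, mob_mem_disc (notMem_cdisc hji (disc_subset_cdisc j hj))⟩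
        exact ((hg _ h2).differentiableAt (S.discs.isOpen.mem_nhds h2)).comp z
          (hmob j hji z (disc_subset_cdisc j hj))
      refine h1.congr_of_eventuallyEq ?_
      filter_upwards [hopen] with w hw
      have hwi : w ∉ S.disc i := fun h =>
        notMem_cdisc hji (disc_subset_cdisc j hw) (disc_subset_cdisc i h)
      rw [Set.indicator_of_mem (show w ∈ (S.disc i)ᶜ from hwi), weight_eq s hwi]
  · refine ⟨_, hcpt.image_of_continuousOn (f := mob (S.gen (bar i))) ?_, ?_,
      fun z hz hE => Set.mem_image_of_mem _ (hmem z hz hE)⟩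
    · intro z hz
      obtain ⟨j, hj, hzj⟩ := Set.mem_iUnion₂.1 hz
      exact (hmob j hj z hzj).continuousAt.continuousWithinAt
    · rintro _ ⟨z, hz, rfl⟩
      obtain ⟨j, hj, hzj⟩ := Set.mem_iUnion₂.1 hz
      exact Set.mem_iUnion.2 ⟨_, mob_mem_disc (notMem_cdisc hj hzj)⟩
  · obtain ⟨C, hC⟩ := hcpt.exists_bound_of_continuousOn (f := fun z => Complex.exp
      (-s * Complex.log (((S.gen (bar i) 1 0 : ℂ) * z + (S.gen (bar i) 1 1 : ℂ)) ^ 2))) (by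
        intro z hz
        obtain ⟨j, hj, hzj⟩ := Set.mem_iUnion₂.1 hz
        exact (hexp j hj z hzj).continuousAt.continuousWithinAt)
    refine ⟨max C 0, le_max_right _ _, fun z hz hE => ?_⟩
    rw [weight_eq s hE]
    exact (hC z (hmem z hz hE)).trans (le_max_left _ _)

/-- The Bergman space of square integrable holomorphic functions on the union of the discs. -/
abbrev Bergman : Type := BergmanSpace S.discs

/-- The operator `A i (s)`. -/
noncomputable def A (s : ℂ) (i : Fin (2 * d)) : S.Bergman →L[ℂ] S.Bergman :=
  (S.isCompData s i).op

open Classical in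
/-- The defining formula of `A i (s)`. -/
theorem A_apply (s : ℂ) (i : Fin (2 * d)) (f : S.Bergman) {x : ℂ} (hx : x ∈ S.discs) :
    (S.A s i f).toFun x = if x ∈ S.disc i then 0 else
      Complex.exp (-s * S.tau (bar i) (mob (S.gen (bar i)) x)) *
        f.toFun (mob (S.gen (bar i)) x) := by
  have h := (S.isCompData s i).op_toFun f hx
  rw [A, h]
  by_cases hi : x ∈ S.disc i
  · rw [if_pos hi, Set.indicator_of_notMem (Set.notMem_compl_iff.2 hi)]
  · rw [if_neg hi, Set.indicator_of_mem (show x ∈ (S.disc i)ᶜ from hi), weight]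

/-- The composition `A i₁ (s) ⋯ A iₗ (s)` along a word. -/
noncomputable def Aword (s : ℂ) (w : List (Fin (2 * d))) : S.Bergman →L[ℂ] S.Bergman :=
  (w.map (S.A s)).prod

end SchottkyData

/-! ## Colored graphs, paths and tuples of paths -/

/-- Orientation reversal `(x, i, y) ↦ (y, bar i, x)` of oriented colored edges. -/
def revEdge {n d : ℕ} (a : Fin n × Fin (2 * d) × Fin n) : Fin n × Fin (2 * d) × Fin n :=
  (a.2.2, bar a.2.1, a.1)

theorem revEdge_revEdge {n d : ℕ} (a : Fin n × Fin (2 * d) × Fin n) :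
    revEdge (revEdge a) = a := by
  simp [revEdge, bar_bar]

/-- The relation `(x, i, y) ∼ (y, bar i, x)`. -/
def edgeSetoid (n d : ℕ) : Setoid (Fin n × Fin (2 * d) × Fin n) where
  r a b := b = a ∨ b = revEdge a
  iseqv :=
    { refl := fun _ => Or.inl rfl
      symm := by
        rintro a b (rfl | rfl)
        · exact Or.inl rfl
        · exact Or.inr (revEdge_revEdge a).symm
      trans := by
        rintro a b c (rfl | rfl) (rfl | rfl)
        · exact Or.inl rfl
        · exact Or.inr rfl
        · exact Or.inr rfl
        · exact Or.inl (revEdge_revEdge a) }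

/-- Colored edges. -/
def ColoredEdge (n d : ℕ) : Type := Quotient (edgeSetoid n d)

/-- The colored edge `[x, i, y]`. -/
def ColoredEdge.mk {n d : ℕ} (x : Fin n) (i : Fin (2 * d)) (y : Fin n) : ColoredEdge n d :=
  Quotient.mk (edgeSetoid n d) (x, i, y)

/-- A colored graph: a set of vertices in `[n]` and a set of colored edges. -/
structure ColoredGraph (n d : ℕ) where
  verts : Set (Fin n)
  edges : Set (ColoredEdge n d)

/-- `c` is the set of edges of a cycle of `G`: a closed walk of length `k + 1 ≥ 1` with pairwise
distinct vertices and pairwise distinct edges (indices in `Fin (k + 1)` are cyclic). Loops and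
pairs of parallel edges are cycles. -/
def ColoredGraph.IsCycle {n d : ℕ} (G : ColoredGraph n d) (c : Set (ColoredEdge n d)) : Prop :=
  ∃ (k : ℕ) (x : Fin (k + 1) → Fin n) (i : Fin (k + 1) → Fin (2 * d)),
    Function.Injective x ∧
    Function.Injective (fun t => ColoredEdge.mk (x t) (i t) (x (t + 1))) ∧
    Set.range x ⊆ G.verts ∧
    Set.range (fun t => ColoredEdge.mk (x t) (i t) (x (t + 1))) = c ∧ c ⊆ G.edges

/-- A colored graph is tangle-free if it contains at most one cycle. -/
def ColoredGraph.IsTangleFree {n d : ℕ} (G : ColoredGraph n d) : Prop :=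
  ∀ c c' : Set (ColoredEdge n d), G.IsCycle c → G.IsCycle c' → c = c'

/-- Paths of length `k`: sequences of `k` half-edges `(x, i)`. -/
abbrev HPath (n d k : ℕ) : Type := Fin k → Fin n × Fin (2 * d)

namespace HPath

variable {n d ℓ : ℕ}

/-- The `t`-th colored edge `[x_t, i_t, x_{t+1}]` followed by a path with `ℓ + 1` half-edges. -/
def edge (p : HPath n d (ℓ + 1)) (t : Fin ℓ) : ColoredEdge n d :=
  ColoredEdge.mk (p t.castSucc).1 (p t.castSucc).2 (p t.succ).1

/-- The colored graph of a path. -/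
def graph (p : HPath n d (ℓ + 1)) : ColoredGraph n d where
  verts := Set.range fun t => (p t).1
  edges := Set.range p.edge

/-- Non-backtracking paths. -/
def NonBacktracking (p : HPath n d (ℓ + 1)) : Prop :=
  ∀ t : Fin ℓ, (p t.castSucc).2 ≠ bar (p t.succ).2

/-- The color sequence `(i_2, …, i_{ℓ+1})` with the first color removed. -/
def tailWord (p : HPath n d (ℓ + 1)) : List (Fin (2 * d)) :=
  List.ofFn fun t : Fin ℓ => (p t.succ).2

end HPath

/-- The tangle-free non-backtracking paths with `ℓ + 1` half-edges. -/
def tangleFreePaths (n d ℓ : ℕ) : Set (HPath n d (ℓ + 1)) :=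
  {p | p.NonBacktracking ∧ p.graph.IsTangleFree}

/-- Tuples of `2m` paths with `ℓ + 1` half-edges each. The path `γ_{j+1}` has index `j`. -/
abbrev PathTuple (n d ℓ m : ℕ) : Type := Fin (2 * m) → HPath n d (ℓ + 1)

namespace PathTuple

variable {n d ℓ m : ℕ}

/-- The index of `γ_{2k+1}`, for `k = 0, …, m - 1`. -/
def oddIdx (k : Fin m) : Fin (2 * m) := ⟨2 * k.1, by omega⟩

/-- The index of `γ_{2k+2}`, for `k = 0, …, m - 1`. -/
def evenIdx (k : Fin m) : Fin (2 * m) := ⟨2 * k.1 + 1, by omega⟩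

/-- The index of `γ_{2k+3}`, for `k = 0, …, m - 1`, where `γ_{2m+1} = γ_1`. -/
def nextIdx (k : Fin m) : Fin (2 * m) := ⟨(2 * k.1 + 2) % (2 * m), Nat.mod_lt _ (by have := k.2; omega)⟩

/-- The colored graph of a tuple: the union of the graphs of its paths. -/
def graph (γ : PathTuple n d ℓ m) : ColoredGraph n d where
  verts := ⋃ j, (γ j).graph.verts
  edges := ⋃ j, (γ j).graph.edges

/-- The number of times that the colored edge `a` is traversed (in either direction). -/
noncomputable def multiplicity (γ : PathTuple n d ℓ m) (a : ColoredEdge n d) : ℕ :=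
  {p : Fin (2 * m) × Fin ℓ | (γ p.1).edge p.2 = a}.ncard

/-- The number of edges of multiplicity one. -/
noncomputable def multOne (γ : PathTuple n d ℓ m) : ℕ :=
  {a ∈ γ.graph.edges | γ.multiplicity a = 1}.ncard

end PathTuple

/-- The set `W_{ℓ,m}`. -/
def W (n d ℓ m : ℕ) : Set (PathTuple n d ℓ m) :=
  {γ | (∀ j, γ j ∈ tangleFreePaths n d ℓ) ∧
    (∀ k : Fin m, γ (PathTuple.evenIdx k) 0 = γ (PathTuple.nextIdx k) 0) ∧
    (∀ k : Fin m, γ (PathTuple.oddIdx k) (Fin.last ℓ) = γ (PathTuple.evenIdx k) (Fin.last ℓ))}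

/-- The set `W_{ℓ,m}(v,e)`. -/
def Wve (n d ℓ m v e : ℕ) : Set (PathTuple n d ℓ m) :=
  {γ ∈ W n d ℓ m | γ.graph.verts.ncard = v ∧ γ.graph.edges.ncard = e}

/-- `γ'` is obtained from `γ` by relabeling the vertices (by `σ`) and by changing the colors of
the edges: an edge `[x, i, y]` becomes `[σ x, κ x y i, σ y]`. Here `κ x y` is injective, so that
distinct edges remain distinct, and the recoloring is compatible with reversal of edges. The last
colors `i_{j,ℓ+1}` do not belong to edges of the graph and are not constrained. -/
def PathTuple.Iso {n d ℓ m : ℕ} (γ γ' : PathTuple n d ℓ m) : Prop :=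
  ∃ (σ : Equiv.Perm (Fin n)) (κ : Fin n → Fin n → Equiv.Perm (Fin (2 * d))),
    (∀ x y i, κ y x (bar i) = bar (κ x y i)) ∧
    (∀ j t, (γ' j t).1 = σ (γ j t).1) ∧
    (∀ j (t : Fin ℓ), (γ' j t.castSucc).2 =
      κ (γ j t.castSucc).1 (γ j t.succ).1 (γ j t.castSucc).2)

open Classical in
/-- The finite set of all elements of `W_{ℓ,m}` isomorphic to `γ`. -/
noncomputable def isoClass {n d ℓ m : ℕ} (γ : PathTuple n d ℓ m) :
    Finset (PathTuple n d ℓ m) :=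
  Finset.univ.filter fun γ' => γ' ∈ W n d ℓ m ∧ γ.Iso γ'

/-- The operator `A(γ_1) A(γ_2)^* ⋯ A(γ_{2m-1}) A(γ_{2m})^*`, where `A(γ_j)` is the composition
along the color sequence of `γ_j` with the first color removed. -/
noncomputable def SchottkyData.tupleOp {n d ℓ m : ℕ} (S : SchottkyData d) (s : ℂ)
    (γ : PathTuple n d ℓ m) : S.Bergman →L[ℂ] S.Bergman :=
  (List.ofFn fun k : Fin m =>
    S.Aword s (γ (PathTuple.oddIdx k)).tailWord *
      ContinuousLinearMap.adjoint (S.Aword s (γ (PathTuple.evenIdx k)).tailWord)).prod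

end SchottkyTrace

/-!
The trace of a product of operators `A(s)_w` is bounded by a product of nuclear norms, and the
nuclear norm of one `A(s)_w` is of the order of the contraction rate of the word `w` to the power
`Re s`. The sum of these products over an isomorphism class is then a sum over the words that can
be written along the segments of a fixed graph, and it is controlled by the pressure above the
dimension of the limit set.

*Contraction rates.* The discs carry their hyperbolic metrics. Each generator contracts them by a
uniform factor (`exists_step_le`), so the supremum `con u` of the hyperbolic derivative along a
word `u` is submultiplicative without any constant and decays exponentially in the length of `u`.
By bounded distortion it is comparable to the Euclidean derivative (`exists_con_compare`).

*Summation.* If `σ > δ`, then the `σ`-dimensional Hausdorff measure of the limit set vanishes.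
A cover that is small for this measure can be replaced by cylinders, and by compactness of the
space of infinite words finitely many of these are enough. Hence each long reduced word has one of finitely
many suffixes `w`, with `∑ con w ^ σ ≤ 1 / 2`, and iteration gives the exponential decay of
`∑ con u ^ σ` over the words of length `L` (`exists_sum_con_le`). The maximum `scon` of the rates of
a word and its inverse word has the same properties.

*Operators.* The operator along a word is a weighted composition operator with image far from the
boundary of a disc. Taylor expansion at the center of this disc gives a nuclear representation
with norm at most `C * con u ^ Re s` (`exists_hasNuclearBound_Aword`). The holomorphic weight has
this size also off the real line, since the imaginary parts along an orbit decay exponentially.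

*Combinatorics.* The walks of a tuple of paths are cut at their endpoints and at the vertices of
degree at least three. Between two cuts a non-backtracking walk has no choice, so that the pieces
are traversals of segments, each in one of two directions, and the number of segments is
`O(m + rank)` (`Walks.card_branch_darts_add_le`). An isomorphic tuple is determined by its vertex
labels, its last colors, and one word for each segment. A segment that is traversed `k` times
contributes the sum of `scon w ^ (k * σ)` over its words `w`. With `σ > δ / 2` this sum decays at the
right rate if `k ≥ 2`; if `k = 1`, then the number of words is paid for by the edges of the
segment, which all have multiplicity one (`Walks.sum_len_le`). Here only a submultiplicative
quantity can be cut without a loss at each vertex, and only one that is invariant under inversion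
does not depend on the direction of a traversal; this is the reason for the use of `scon`.
-/

namespace SchottkyTrace

open MeasureTheory Metric Set Filter Topology TopologicalSpace
open scoped ENNReal InnerProductSpace Real MatrixGroups UpperHalfPlane

/-! ### Reduced words -/

/-- A word is reduced if no letter is followed by its inverse letter. -/
def Reduced {d : ℕ} (u : List (Fin (2 * d))) : Prop := u.IsChain fun i j => j ≠ bar i

theorem Reduced.tail {d : ℕ} {i : Fin (2 * d)} {u : List (Fin (2 * d))} (h : Reduced (i :: u)) :
    Reduced u := List.IsChain.tail h

theorem Reduced.head {d : ℕ} {i : Fin (2 * d)} {u : List (Fin (2 * d))} (h : Reduced (i :: u)) :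
    ∀ j ∈ u.head?, j ≠ bar i := by
  cases u with
  | nil => simp
  | cons k u =>
    have := (List.isChain_cons_cons.1 h).1
    simpa using this

theorem reduced_cons {d : ℕ} {i : Fin (2 * d)} {u : List (Fin (2 * d))} (hu : Reduced u)
    (h : ∀ j ∈ u.head?, j ≠ bar i) : Reduced (i :: u) :=
  List.isChain_cons.2 ⟨h, hu⟩

theorem bar_injective {d : ℕ} : Function.Injective (bar : Fin (2 * d) → Fin (2 * d)) :=
  Function.LeftInverse.injective bar_bar

theorem bar_ne {d : ℕ} (i : Fin (2 * d)) : bar i ≠ i := by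
  intro h
  have hi := i.2
  have h1 := congrArg Fin.val h
  simp only [bar] at h1
  rcases lt_or_ge (i.1 + d) (2 * d) with h2 | h2
  · rw [Nat.mod_eq_of_lt h2] at h1; omega
  · rw [Nat.mod_eq_sub_mod h2, Nat.mod_eq_of_lt (by omega)] at h1; omega

theorem exists_ne_ne {d : ℕ} (hd : 2 ≤ d) (i j : Fin (2 * d)) : ∃ k, k ≠ i ∧ k ≠ j := by
  have : ((Finset.univ : Finset (Fin (2 * d))) \ {i, j}).Nonempty := by
    rw [← Finset.card_pos]
    have h1 := Finset.le_card_sdiff ({i, j} : Finset (Fin (2 * d))) Finset.univ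
    have h2 : ({i, j} : Finset (Fin (2 * d))).card ≤ 2 := Finset.card_le_two
    rw [Finset.card_univ, Fintype.card_fin] at h1
    omega
  obtain ⟨k, hk⟩ := this
  simp at hk
  exact ⟨k, hk.1, hk.2⟩

theorem exists_pos_le_of_finite {ι : Type*} [Finite ι] (f : ι → ℝ) (hf : ∀ i, 0 < f i) :
    ∃ c : ℝ, 0 < c ∧ ∀ i, c ≤ f i := by
  rcases isEmpty_or_nonempty ι with h | h
  · exact ⟨1, one_pos, fun i => (IsEmpty.false i).elim⟩
  · obtain ⟨i, hi⟩ := Finite.exists_min f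
    exact ⟨f i, hf i, hi⟩

theorem exists_ge_of_finite {ι : Type*} [Finite ι] (f : ι → ℝ) :
    ∃ C : ℝ, 0 < C ∧ ∀ i, f i ≤ C := by
  obtain ⟨M, hM⟩ := (Set.finite_range f).bddAbove
  exact ⟨max M 1, lt_max_of_lt_right one_pos,
    fun i => (hM (Set.mem_range_self i)).trans (le_max_left _ _)⟩

namespace SchottkyData

variable {d : ℕ} (S : SchottkyData d)

/-! ### Separation of the discs -/

theorem exists_gap : ∃ g : ℝ, 0 < g ∧ ∀ i j, i ≠ j →
    S.radius i + S.radius j + g ≤ dist (S.center i : ℂ) (S.center j) := by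
  obtain ⟨g, hg, h⟩ := exists_pos_le_of_finite
    (fun p : {p : Fin (2 * d) × Fin (2 * d) // p.1 ≠ p.2} =>
      dist (S.center p.1.1 : ℂ) (S.center p.1.2) - (S.radius p.1.1 + S.radius p.1.2)) (by
    rintro ⟨⟨i, j⟩, hij⟩
    have := (disjoint_closedBall_closedBall_iff (S.radius_pos i).le (S.radius_pos j).le).1
      (S.disjoint_closedBall i j hij)
    exact sub_pos.2 this)
  exact ⟨g, hg, fun i j hij => by have := h ⟨(i, j), hij⟩; linarith⟩

theorem exists_gap_dist : ∃ g : ℝ, 0 < g ∧ ∀ i j, i ≠ j → ∀ x ∈ S.cdisc i, ∀ y ∈ S.cdisc j,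
    g ≤ dist x y := by
  obtain ⟨g, hg, h⟩ := S.exists_gap
  refine ⟨g, hg, fun i j hij x hx y hy => ?_⟩
  have h1 := h i j hij
  have h2 := dist_triangle4 (S.center i : ℂ) x y (S.center j)
  rw [dist_comm _ x] at h2
  have h3 : dist x (S.center i) ≤ S.radius i := hx
  have h4 : dist y (S.center j) ≤ S.radius j := hy
  linarith

/-- A common bound for the points of all discs, all radii and all matrix entries. -/
theorem exists_bounds : ∃ R : ℝ, 1 ≤ R ∧ (∀ i, S.radius i ≤ R) ∧ (∀ i, R⁻¹ ≤ S.radius i) ∧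
    (∀ i, ∀ x ∈ S.cdisc i, ‖x‖ ≤ R) ∧
    (∀ i, ∀ j, ∀ x ∈ S.cdisc j, ‖(S.gen i 1 0 : ℂ) * x + (S.gen i 1 1 : ℂ)‖ ≤ R) := by
  obtain ⟨R₁, h₁, h₁'⟩ := exists_ge_of_finite S.radius
  obtain ⟨R₂, h₂, h₂'⟩ := exists_ge_of_finite fun i => (S.radius i)⁻¹
  obtain ⟨R₃, h₃, h₃'⟩ := exists_ge_of_finite fun i => |S.center i|
  obtain ⟨R₄, h₄, h₄'⟩ := exists_ge_of_finite fun i => |S.gen i 1 0|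
  obtain ⟨R₅, h₅, h₅'⟩ := exists_ge_of_finite fun i => |S.gen i 1 1|
  have hx : ∀ i, ∀ x ∈ S.cdisc i, ‖x‖ ≤ R₁ + R₃ := fun i x hx => by
    have h3 : ‖x - S.center i‖ ≤ S.radius i := by simpa [dist_eq_norm] using mem_closedBall.1 hx
    have h4 : ‖x‖ ≤ ‖x - S.center i‖ + ‖(S.center i : ℂ)‖ := by
      simpa using norm_add_le (x - S.center i) (S.center i : ℂ)
    rw [Complex.norm_real, Real.norm_eq_abs] at h4
    linarith [h₁' i, h₃' i]
  have hpos : 0 ≤ R₄ * (R₁ + R₃) := by positivity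
  refine ⟨1 + R₁ + R₂ + R₃ + R₄ * (R₁ + R₃) + R₅, by linarith, fun i => by linarith [h₁' i],
    fun i => ?_, fun i x h => by linarith [hx i x h], fun i j x h => ?_⟩
  · refine inv_le_of_inv_le₀ (S.radius_pos i) ?_
    linarith [h₂' i]
  · refine (norm_add_le _ _).trans ?_
    rw [norm_mul, Complex.norm_real, Complex.norm_real, Real.norm_eq_abs, Real.norm_eq_abs]
    have := mul_le_mul (h₄' i) (hx j x h) (norm_nonneg _) h₄.le
    linarith [h₅' i]

/-! ### The generators as Möbius transformations -/

/-- The denominator of the Möbius transformation of `gen (bar i)`. -/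
noncomputable def dn (i : Fin (2 * d)) (x : ℂ) : ℂ :=
  (S.gen (bar i) 1 0 : ℂ) * x + (S.gen (bar i) 1 1 : ℂ)

/-- The Möbius transformation of `gen (bar i)`, which maps the complement of `disc i` into
`cdisc (bar i)`. -/
noncomputable def mv (i : Fin (2 * d)) (x : ℂ) : ℂ := mob (S.gen (bar i)) x

variable {S}

theorem det_gen (i : Fin (2 * d)) :
    S.gen i 0 0 * S.gen i 1 1 - S.gen i 0 1 * S.gen i 1 0 = 1 := by
  have := (S.gen i).det_coe
  rwa [Matrix.det_fin_two] at this

theorem dn_ne_zero {i : Fin (2 * d)} {x : ℂ} (hx : x ∉ S.disc i) : S.dn i x ≠ 0 :=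
  (denom_and_mem_cdisc hx).1

theorem mv_mem_cdisc {i : Fin (2 * d)} {x : ℂ} (hx : x ∉ S.disc i) :
    S.mv i x ∈ S.cdisc (bar i) := (denom_and_mem_cdisc hx).2

theorem mv_mul_dn {i : Fin (2 * d)} {x : ℂ} (hx : x ∉ S.disc i) :
    S.mv i x * S.dn i x = (S.gen (bar i) 0 0 : ℂ) * x + (S.gen (bar i) 0 1 : ℂ) :=
  div_mul_cancel₀ _ (dn_ne_zero hx)

theorem mv_sub_mv {i : Fin (2 * d)} {x y : ℂ} (hx : x ∉ S.disc i) (hy : y ∉ S.disc i) :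
    S.mv i x - S.mv i y = (x - y) / (S.dn i x * S.dn i y) := by
  have h1 := dn_ne_zero hx
  have h2 := dn_ne_zero hy
  have h3 := mv_mul_dn hx
  have h4 := mv_mul_dn hy
  have hdet : (S.gen (bar i) 0 0 : ℂ) * (S.gen (bar i) 1 1 : ℂ)
      - (S.gen (bar i) 0 1 : ℂ) * (S.gen (bar i) 1 0 : ℂ) = 1 := by
    exact_mod_cast det_gen (S := S) (bar i)
  rw [eq_div_iff (mul_ne_zero h1 h2)]
  have e1 : S.dn i x = (S.gen (bar i) 1 0 : ℂ) * x + (S.gen (bar i) 1 1 : ℂ) := rfl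
  have e2 : S.dn i y = (S.gen (bar i) 1 0 : ℂ) * y + (S.gen (bar i) 1 1 : ℂ) := rfl
  calc (S.mv i x - S.mv i y) * (S.dn i x * S.dn i y)
      = (S.mv i x * S.dn i x) * S.dn i y - (S.mv i y * S.dn i y) * S.dn i x := by ring
    _ = x - y := by
      rw [h3, h4, e1, e2]
      linear_combination (x - y) * hdet

/-- The boundary circle of `disc i` is mapped outside the open disc `disc (bar i)`. -/
theorem mv_notMem_disc {i : Fin (2 * d)} {z : ℂ} (hz : z ∉ S.disc i) (hz' : z ∈ S.cdisc i) :
    S.mv i z ∉ S.disc (bar i) := by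
  intro hm
  have h1 : (z : OnePoint ℂ) ∈ ((↑) : ℂ → OnePoint ℂ) ''
      closedBall (S.center i : ℂ) (S.radius i) := ⟨z, hz', rfl⟩
  rw [← S.image_compl i] at h1
  obtain ⟨w, hw, hwz⟩ := h1
  apply hw
  refine ⟨S.mv i z, hm, ?_⟩
  have hsm : toGLC (S.gen (bar i)) • (z : OnePoint ℂ) = (S.mv i z : ℂ) :=
    (toGLC_smul_coe _ _).trans (if_neg (dn_ne_zero hz))
  rw [← hsm, ← hwz]
  dsimp only
  rw [← mul_smul, S.gen_bar]
  simp [toGLC]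

theorem normSq_real_affine (a b : ℝ) (x : ℂ) :
    ‖(a : ℂ) * x + b‖ ^ 2 = (a * x.re + b) ^ 2 + (a * x.im) ^ 2 := by
  rw [Complex.sq_norm, Complex.normSq_apply]
  simp
  ring

theorem normSq_sub_real (c : ℝ) (x : ℂ) : ‖x - c‖ ^ 2 = (x.re - c) ^ 2 + x.im ^ 2 := by
  rw [Complex.sq_norm, Complex.normSq_apply]
  simp
  ring

/-- The Möbius transformation of `gen (bar i)` sends the circle `∂ (disc i)` to the circle
`∂ (disc (bar i))`. Hence it pulls back the Hermitian form of the second circle to a positive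
multiple of the form of the first one, and the factor is found from the determinants. -/
theorem circle_form_mv {i : Fin (2 * d)} {x : ℂ} (hx : x ∉ S.disc i) :
    (S.radius (bar i) ^ 2 - ‖S.mv i x - S.center (bar i)‖ ^ 2) * ‖S.dn i x‖ ^ 2 =
      S.radius (bar i) / S.radius i * (‖x - S.center i‖ ^ 2 - S.radius i ^ 2) := by
  set a := S.gen (bar i) 0 0
  set b := S.gen (bar i) 0 1
  set c := S.gen (bar i) 1 0
  set e := S.gen (bar i) 1 1
  set k := S.center (bar i)
  set r := S.radius (bar i)
  set k' := S.center i
  set r' := S.radius i with hr'_def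
  have hr : 0 < r := S.radius_pos _
  have hr' : 0 < r' := S.radius_pos _
  have hdet : a * e - b * c = 1 := det_gen (S := S) (bar i)
  -- the pulled back form, as a polynomial in the real and imaginary parts
  have key : ∀ z : ℂ, z ∉ S.disc i → (r ^ 2 - ‖S.mv i z - k‖ ^ 2) * ‖S.dn i z‖ ^ 2 =
      r ^ 2 * ((c * z.re + e) ^ 2 + (c * z.im) ^ 2) -
        (((a - k * c) * z.re + (b - k * e)) ^ 2 + ((a - k * c) * z.im) ^ 2) := by
    intro z hz
    have h1 : (S.mv i z - k) * S.dn i z =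
        ((a - k * c : ℝ) : ℂ) * z + ((b - k * e : ℝ) : ℂ) := by
      rw [sub_mul, mv_mul_dn hz]
      simp only [dn]
      push_cast
      ring
    have h2 := congrArg (fun w => ‖w‖ ^ 2) h1
    simp only [norm_mul, mul_pow] at h2
    rw [normSq_real_affine] at h2
    have h3 : ‖S.dn i z‖ ^ 2 = (c * z.re + e) ^ 2 + (c * z.im) ^ 2 := normSq_real_affine _ _ _
    rw [sub_mul, h2, h3]
  have hbd : ∀ t : ℝ, |t - k'| = r' → r ^ 2 * (c * t + e) ^ 2 -
      ((a - k * c) * t + (b - k * e)) ^ 2 = 0 := by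
    intro t ht
    have hn : ‖(t : ℂ) - k'‖ = r' := by
      rw [← Complex.ofReal_sub, Complex.norm_real, Real.norm_eq_abs, ht]
    have h1 : (t : ℂ) ∉ S.disc i := by
      simp only [disc, mem_ball, dist_eq_norm, not_lt]
      exact hn.ge
    have h2 : (t : ℂ) ∈ S.cdisc i := by
      simp only [cdisc, mem_closedBall, dist_eq_norm]
      exact hn.le
    have h3 := mv_mem_cdisc h1
    have h4 := mv_notMem_disc h1 h2
    simp only [disc, cdisc, mem_ball, mem_closedBall, dist_eq_norm, not_lt] at h3 h4
    have h5 := key t h1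
    rw [le_antisymm h3 h4] at h5
    simp only [Complex.ofReal_re, Complex.ofReal_im] at h5
    have h6 : (r ^ 2 - S.radius (bar i) ^ 2) = 0 := sub_self _
    rw [h6] at h5
    linarith
  have hp := hbd (k' + r') (by rw [add_sub_cancel_left, abs_of_pos hr'])
  have hm := hbd (k' - r') (by rw [sub_sub_cancel_left, abs_neg, abs_of_pos hr'])
  obtain ⟨α, hα⟩ : ∃ α, α = r ^ 2 * c ^ 2 - (a - k * c) ^ 2 := ⟨_, rfl⟩
  obtain ⟨β, hβ⟩ : ∃ β, β = 2 * (r ^ 2 * c * e - (a - k * c) * (b - k * e)) := ⟨_, rfl⟩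
  obtain ⟨γ, hγ⟩ : ∃ γ, γ = r ^ 2 * e ^ 2 - (b - k * e) ^ 2 := ⟨_, rfl⟩
  have hβ' : β = -2 * α * k' := by
    have : r' * (β + 2 * α * k') = 0 := by
      rw [hα, hβ]; linear_combination (1 / 2) * hp - (1 / 2) * hm
    rcases mul_eq_zero.1 this with h | h
    · exact absurd h hr'.ne'
    · linarith
  have hγ' : γ = α * (k' ^ 2 - r' ^ 2) := by
    have : γ + α * (k' ^ 2 + r' ^ 2) + β * k' = 0 := by
      rw [hα, hβ, hγ]; linear_combination (1 / 2) * hp + (1 / 2) * hm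
    rw [hβ'] at this
    linarith
  have hform : ∀ z : ℂ, z ∉ S.disc i → (r ^ 2 - ‖S.mv i z - k‖ ^ 2) * ‖S.dn i z‖ ^ 2 =
      α * (‖z - k'‖ ^ 2 - r' ^ 2) := by
    intro z hz
    rw [key z hz, normSq_sub_real]
    have : r ^ 2 * ((c * z.re + e) ^ 2 + (c * z.im) ^ 2) -
        (((a - k * c) * z.re + (b - k * e)) ^ 2 + ((a - k * c) * z.im) ^ 2) =
        α * (z.re ^ 2 + z.im ^ 2) + β * z.re + γ := by rw [hα, hβ, hγ]; ring
    rw [this, hβ', hγ']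
    ring
  have hαsq : α ^ 2 * r' ^ 2 = r ^ 2 := by
    have h1 : β ^ 2 - 4 * α * γ = 4 * r ^ 2 * (a * e - b * c) ^ 2 := by
      rw [hα, hβ, hγ]; ring
    rw [hdet, hβ', hγ'] at h1
    linarith
  have hα0 : 0 ≤ α := by
    have hn : ‖((k' + 2 * r' : ℝ) : ℂ) - k'‖ = 2 * r' := by
      rw [← Complex.ofReal_sub, Complex.norm_real, Real.norm_eq_abs, add_sub_cancel_left,
        abs_of_pos (by positivity)]
    have h1 : ((k' + 2 * r' : ℝ) : ℂ) ∉ S.disc i := by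
      simp only [disc, mem_ball, dist_eq_norm, not_lt]
      refine le_trans ?_ hn.ge
      rw [← hr'_def]; linarith
    have h2 := hform _ h1
    have h3 := mv_mem_cdisc h1
    simp only [cdisc, mem_closedBall, dist_eq_norm] at h3
    rw [hn] at h2
    have h4 : 0 ≤ (r ^ 2 - ‖S.mv i ((k' + 2 * r' : ℝ) : ℂ) - k‖ ^ 2) *
        ‖S.dn i ((k' + 2 * r' : ℝ) : ℂ)‖ ^ 2 :=
      mul_nonneg (sub_nonneg.2 (pow_le_pow_left₀ (norm_nonneg _) h3 2)) (by positivity)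
    rw [h2] at h4
    have h5 : 0 < (2 * r') ^ 2 - r' ^ 2 := by nlinarith
    exact nonneg_of_mul_nonneg_left h4 h5
  have hα1 : α = r / r' := by
    rw [eq_div_iff hr'.ne']
    have h1 : (α * r') ^ 2 = r ^ 2 := by rw [mul_pow, hαsq]
    exact (pow_left_inj₀ (by positivity) hr.le two_ne_zero).1 h1
  rw [hform x hx, hα1]

end SchottkyData

namespace SchottkyData

variable {d : ℕ} (S : SchottkyData d)

/-! ### Compositions along words -/

/-- The composition of Möbius transformations along a word, whose first letter acts first. -/
noncomputable def orb : List (Fin (2 * d)) → ℂ → ℂ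
  | [], x => x
  | i :: u, x => orb u (S.mv i x)

/-- The denominator of `orb u`; its inverse square is the derivative of `orb u`. -/
noncomputable def den : List (Fin (2 * d)) → ℂ → ℂ
  | [], _ => 1
  | i :: u, x => S.dn i x * den u (S.mv i x)

/-- The complement of the disc of the first letter. -/
def dom (u : List (Fin (2 * d))) : Set ℂ := {x | ∀ i ∈ u.head?, x ∉ S.disc i}

/-- The union of the closed discs other than the disc of the first letter. -/
def adm (u : List (Fin (2 * d))) : Set ℂ := {x | ∃ j, x ∈ S.cdisc j ∧ ∀ i ∈ u.head?, j ≠ i}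

variable {S}

theorem mem_dom_cons {i : Fin (2 * d)} {u : List (Fin (2 * d))} {x : ℂ} :
    x ∈ S.dom (i :: u) ↔ x ∉ S.disc i := by simp [dom]

theorem adm_subset_dom (u : List (Fin (2 * d))) : S.adm u ⊆ S.dom u := by
  rintro x ⟨j, hj, h⟩ i hi hx
  exact notMem_cdisc (h i hi) hj (disc_subset_cdisc i hx)

theorem mem_adm_of_mem_cdisc {u : List (Fin (2 * d))} {j : Fin (2 * d)} {x : ℂ}
    (hx : x ∈ S.cdisc j) (h : ∀ i ∈ u.head?, i ≠ j) : x ∈ S.adm u :=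
  ⟨j, hx, fun i hi => (h i hi).symm⟩

theorem mv_mem_adm {i : Fin (2 * d)} {u : List (Fin (2 * d))} (hu : Reduced (i :: u)) {x : ℂ}
    (hx : x ∈ S.dom (i :: u)) : S.mv i x ∈ S.adm u :=
  mem_adm_of_mem_cdisc (mv_mem_cdisc (mem_dom_cons.1 hx)) hu.head

theorem den_ne_zero {u : List (Fin (2 * d))} (hu : Reduced u) {x : ℂ} (hx : x ∈ S.dom u) :
    S.den u x ≠ 0 := by
  induction u generalizing x with
  | nil => simp [den]
  | cons i u ih =>
    exact mul_ne_zero (dn_ne_zero (mem_dom_cons.1 hx))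
      (ih hu.tail (adm_subset_dom _ (mv_mem_adm hu hx)))

theorem orb_sub_orb {u : List (Fin (2 * d))} (hu : Reduced u) {x y : ℂ} (hx : x ∈ S.dom u)
    (hy : y ∈ S.dom u) : S.orb u x - S.orb u y = (x - y) / (S.den u x * S.den u y) := by
  induction u generalizing x y with
  | nil => simp [den, orb]
  | cons i u ih =>
    simp only [orb, den]
    rw [ih hu.tail (adm_subset_dom _ (mv_mem_adm hu hx)) (adm_subset_dom _ (mv_mem_adm hu hy)),
      mv_sub_mv (mem_dom_cons.1 hx) (mem_dom_cons.1 hy), div_div]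
    congr 1
    ring

theorem exists_orb_mem_cdisc {i : Fin (2 * d)} {u : List (Fin (2 * d))} (hu : Reduced (i :: u)) :
    ∃ k, ∀ x ∈ S.dom (i :: u), S.orb (i :: u) x ∈ S.cdisc k := by
  induction u generalizing i with
  | nil => exact ⟨bar i, fun x hx => mv_mem_cdisc (mem_dom_cons.1 hx)⟩
  | cons j u ih =>
    obtain ⟨k, hk⟩ := ih hu.tail
    exact ⟨k, fun x hx => hk _ (adm_subset_dom _ (mv_mem_adm hu hx))⟩

theorem den_eq_affine {u : List (Fin (2 * d))} (hu : Reduced u) :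
    ∃ a b : ℂ, ∀ x ∈ S.dom u, S.den u x = a * x + b := by
  induction u with
  | nil => exact ⟨0, 1, fun x _ => by simp [den]⟩
  | cons i u ih =>
    obtain ⟨a, b, h⟩ := ih hu.tail
    refine ⟨a * S.gen (bar i) 0 0 + b * S.gen (bar i) 1 0,
      a * S.gen (bar i) 0 1 + b * S.gen (bar i) 1 1, fun x hx => ?_⟩
    simp only [den]
    rw [h _ (adm_subset_dom _ (mv_mem_adm hu hx)), mul_add, mul_left_comm,
      mul_comm (S.dn i x) (S.mv i x), mv_mul_dn (mem_dom_cons.1 hx)]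
    simp only [dn]
    ring

variable (S)

/-- Bounded distortion. The denominator of a reduced word is an affine function that does not
vanish outside the disc of the first letter, so that its zero has a positive distance to all
other discs. -/
theorem exists_distortion : ∃ C : ℝ, 1 ≤ C ∧ ∀ u, Reduced u → ∀ x ∈ S.adm u, ∀ y ∈ S.adm u,
    ‖S.den u x‖ ≤ C * ‖S.den u y‖ := by
  obtain ⟨g, hg, hgap⟩ := S.exists_gap_dist
  obtain ⟨R, hR, -, -, hb, -⟩ := S.exists_bounds
  refine ⟨max 1 (2 * R / g), le_max_left _ _, fun u hu x hx y hy => ?_⟩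
  obtain ⟨a, b, h⟩ := den_eq_affine (S := S) hu
  have hx' := h x (adm_subset_dom u hx)
  have hy' := h y (adm_subset_dom u hy)
  by_cases ha : a = 0
  · rw [hx', hy', ha, zero_mul, zero_mul]
    exact le_mul_of_one_le_left (norm_nonneg _) (le_max_left _ _)
  · have hp : -b / a ∉ S.dom u := fun hp => den_ne_zero hu hp (by rw [h _ hp]; field_simp; ring)
    simp only [dom, Set.mem_ofPred_eq, not_forall, not_not] at hp
    obtain ⟨i, hi, hp⟩ := hp
    have e : ∀ z : ℂ, ‖a * z + b‖ = ‖a‖ * ‖z - -b / a‖ := fun z => by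
      rw [← norm_mul]; congr 1; field_simp; ring
    obtain ⟨j, hj, hji⟩ := hy
    obtain ⟨k, hk, -⟩ := hx
    have h1 : g ≤ ‖y - -b / a‖ := by
      rw [← dist_eq_norm]
      exact hgap j i (hji i hi) y hj _ (disc_subset_cdisc i hp)
    have h2 : ‖x - -b / a‖ ≤ 2 * R := by
      refine (norm_sub_le _ _).trans ?_
      linarith [hb k x hk, hb i _ (disc_subset_cdisc i hp)]
    rw [hx', hy', e, e, mul_left_comm]
    refine mul_le_mul_of_nonneg_left ?_ (norm_nonneg _)
    refine h2.trans ?_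
    calc 2 * R = 2 * R / g * g := by field_simp
      _ ≤ max 1 (2 * R / g) * ‖y - -b / a‖ :=
        mul_le_mul (le_max_right _ _) h1 hg.le (by positivity)

/-! ### The hyperbolic derivative -/

/-- Half of the inverse density of the hyperbolic metrics of the discs. -/
noncomputable def Q (x : ℂ) : ℝ :=
  ∑ j, max 0 ((S.radius j ^ 2 - ‖x - S.center j‖ ^ 2) / S.radius j)

open Classical in
/-- The derivative of `mv i` at a point of the discs, with respect to the hyperbolic metrics of the
discs; it is set to zero on `disc i`. -/
noncomputable def step (i : Fin (2 * d)) (x : ℂ) : ℝ :=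
  if x ∈ S.disc i then 0 else S.Q x / (S.Q (S.mv i x) * ‖S.dn i x‖ ^ 2)

/-- The derivative of `orb u` with respect to the hyperbolic metrics of the discs; it vanishes if
the word is not reduced. -/
noncomputable def wt : List (Fin (2 * d)) → ℂ → ℝ
  | [], _ => 1
  | i :: u, x => S.step i x * wt u (S.mv i x)

/-- The supremum of the hyperbolic derivative of `orb u`. It is submultiplicative, without any
constant, and each letter contracts strictly. -/
noncomputable def con (u : List (Fin (2 * d))) : ℝ := ⨆ x : S.discs, S.wt u x

variable {S}

theorem Q_eq {j : Fin (2 * d)} {x : ℂ} (hx : x ∈ S.cdisc j) :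
    S.Q x = (S.radius j ^ 2 - ‖x - S.center j‖ ^ 2) / S.radius j := by
  rw [Q, Finset.sum_eq_single j]
  · refine max_eq_right (div_nonneg (sub_nonneg.2 ?_) (S.radius_pos j).le)
    rw [cdisc, mem_closedBall, dist_eq_norm] at hx
    exact pow_le_pow_left₀ (norm_nonneg _) hx 2
  · intro k _ hk
    have := notMem_cdisc hk.symm hx
    rw [cdisc, mem_closedBall, dist_eq_norm, not_le] at this
    refine max_eq_left (div_nonpos_of_nonpos_of_nonneg (sub_nonpos.2 ?_) (S.radius_pos k).le)
    exact pow_le_pow_left₀ (S.radius_pos k).le this.le 2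
  · simp

theorem Q_nonneg (x : ℂ) : 0 ≤ S.Q x := Finset.sum_nonneg fun _ _ => le_max_left _ _

theorem Q_le {R : ℝ} (hR : ∀ i, S.radius i ≤ R) {j : Fin (2 * d)} {x : ℂ} (hx : x ∈ S.cdisc j) :
    S.Q x ≤ R := by
  rw [Q_eq hx, div_le_iff₀ (S.radius_pos j)]
  nlinarith [hR j, S.radius_pos j, sq_nonneg ‖x - S.center j‖]

theorem Q_mv_mul {i : Fin (2 * d)} {x : ℂ} (hx : x ∉ S.disc i) :
    S.Q (S.mv i x) * ‖S.dn i x‖ ^ 2 =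
      (‖x - S.center i‖ ^ 2 - S.radius i ^ 2) / S.radius i := by
  have h := circle_form_mv hx
  have h1 := S.radius_pos i
  have h2 := S.radius_pos (bar i)
  rw [Q_eq (mv_mem_cdisc hx), div_mul_eq_mul_div, h]
  field_simp

theorem mv_mem_disc_of_ne {i j : Fin (2 * d)} (hij : j ≠ i) {x : ℂ} (hx : x ∈ S.cdisc j) :
    S.mv i x ∈ S.disc (bar i) := mob_mem_disc (notMem_cdisc hij hx)

theorem Q_pos {j : Fin (2 * d)} {x : ℂ} (hx : x ∈ S.disc j) : 0 < S.Q x := by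
  rw [Q_eq (disc_subset_cdisc j hx)]
  refine div_pos (sub_pos.2 ?_) (S.radius_pos j)
  rw [disc, mem_ball, dist_eq_norm] at hx
  exact pow_lt_pow_left₀ hx (norm_nonneg _) two_ne_zero

theorem step_of_mem {i : Fin (2 * d)} {x : ℂ} (hx : x ∈ S.disc i) : S.step i x = 0 := if_pos hx

theorem step_nonneg (i : Fin (2 * d)) (x : ℂ) : 0 ≤ S.step i x := by
  unfold step
  split_ifs
  · exact le_rfl
  · exact div_nonneg (Q_nonneg _) (mul_nonneg (Q_nonneg _) (by positivity))

theorem wt_nonneg (u : List (Fin (2 * d))) (x : ℂ) : 0 ≤ S.wt u x := by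
  induction u generalizing x with
  | nil => exact zero_le_one
  | cons i u ih => exact mul_nonneg (step_nonneg i x) (ih _)

variable (S)

/-- Each generator contracts the hyperbolic metrics of the discs. -/
theorem exists_step_le : ∃ θ : ℝ, 0 < θ ∧ θ < 1 ∧ ∀ i, ∀ x ∈ S.discs, S.step i x ≤ θ := by
  obtain ⟨g, hg, hgap⟩ := S.exists_gap
  obtain ⟨R, hR, hrad, -, -, -⟩ := S.exists_bounds
  refine ⟨R / (R + g), by positivity, (div_lt_one (by positivity)).2 (by linarith),
    fun i x hx => ?_⟩
  obtain ⟨j, hj⟩ := Set.mem_iUnion.1 hx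
  unfold step
  split_ifs with hi
  · positivity
  · have hij : j ≠ i := fun h => hi (h ▸ hj)
    rw [Q_mv_mul hi, Q_eq (disc_subset_cdisc j hj)]
    have h1 := hgap i j hij.symm
    rw [disc, mem_ball, dist_eq_norm] at hj
    have h2 : dist (S.center i : ℂ) (S.center j) ≤ ‖x - S.center i‖ + ‖x - S.center j‖ := by
      have := dist_triangle_left (S.center i : ℂ) (S.center j) x
      rwa [dist_eq_norm x, dist_eq_norm x] at this
    have ri := S.radius_pos i
    have rj := S.radius_pos j
    obtain ⟨t, ht⟩ : ∃ t, t = S.radius j - ‖x - S.center j‖ := ⟨_, rfl⟩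
    have ht0 : 0 < t := by linarith
    have hA : S.radius i + t + g ≤ ‖x - S.center i‖ := by linarith
    have h3 : 2 * S.radius i * (t + g) ≤ ‖x - S.center i‖ ^ 2 - S.radius i ^ 2 := by nlinarith
    have h4 : S.radius j ^ 2 - ‖x - S.center j‖ ^ 2 ≤ t * (2 * S.radius j) := by
      have : ‖x - S.center j‖ = S.radius j - t := by linarith
      rw [this]; nlinarith
    have htR : t ≤ R := by linarith [norm_nonneg (x - S.center j), hrad j]
    have h5 : (S.radius j ^ 2 - ‖x - S.center j‖ ^ 2) / S.radius j ≤ 2 * t := by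
      rw [div_le_iff₀ rj]; linarith
    have h6 : 2 * (t + g) ≤ (‖x - S.center i‖ ^ 2 - S.radius i ^ 2) / S.radius i := by
      rw [le_div_iff₀ ri]; linarith
    calc _ ≤ 2 * t / (2 * (t + g)) := div_le_div₀ (by positivity) h5 (by positivity) h6
      _ ≤ R / (R + g) := by
        rw [div_le_div_iff₀ (by positivity) (by positivity)]
        nlinarith

variable {S}

theorem mv_mem_discs {i : Fin (2 * d)} {x : ℂ} (hx : x ∈ S.discs) (hi : x ∉ S.disc i) :
    S.mv i x ∈ S.discs := by
  obtain ⟨j, hj⟩ := Set.mem_iUnion.1 hx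
  exact Set.mem_iUnion.2 ⟨_, mv_mem_disc_of_ne (by rintro rfl; exact hi hj) (disc_subset_cdisc j hj)⟩

theorem wt_le_pow {θ : ℝ} (hθ : 0 ≤ θ) (h : ∀ i, ∀ x ∈ S.discs, S.step i x ≤ θ)
    (u : List (Fin (2 * d))) {x : ℂ} (hx : x ∈ S.discs) : S.wt u x ≤ θ ^ u.length := by
  induction u generalizing x with
  | nil => simp [wt]
  | cons i u ih =>
    simp only [wt, List.length_cons, pow_succ']
    by_cases hi : x ∈ S.disc i
    · rw [step_of_mem hi, zero_mul]
      positivity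
    · exact mul_le_mul (h i x hx) (ih (mv_mem_discs hx hi)) (wt_nonneg _ _) hθ

theorem bddAbove_wt (u : List (Fin (2 * d))) : BddAbove (Set.range fun x : S.discs => S.wt u x) := by
  obtain ⟨θ, h0, h1, h⟩ := S.exists_step_le
  refine ⟨θ ^ u.length, ?_⟩
  rintro _ ⟨x, rfl⟩
  exact wt_le_pow h0.le h u x.2

theorem wt_le_con (u : List (Fin (2 * d))) {x : ℂ} (hx : x ∈ S.discs) : S.wt u x ≤ S.con u :=
  le_ciSup (bddAbove_wt u) ⟨x, hx⟩

theorem con_nonneg (u : List (Fin (2 * d))) : 0 ≤ S.con u :=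
  Real.iSup_nonneg fun _ => wt_nonneg _ _

theorem con_le {u : List (Fin (2 * d))} {M : ℝ} (hM : 0 ≤ M) (h : ∀ x ∈ S.discs, S.wt u x ≤ M) :
    S.con u ≤ M := Real.iSup_le (fun x => h x x.2) hM

theorem center_mem (j : Fin (2 * d)) : (S.center j : ℂ) ∈ S.disc j := mem_ball_self (S.radius_pos j)

theorem disc_le_discs {j : Fin (2 * d)} {x : ℂ} (hx : x ∈ S.disc j) : x ∈ S.discs :=
  Set.mem_iUnion.2 ⟨j, hx⟩

theorem con_nil_le : S.con [] ≤ 1 := con_le zero_le_one fun _ _ => le_rfl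

theorem wt_append (u v : List (Fin (2 * d))) (x : ℂ) :
    S.wt (u ++ v) x = S.wt u x * S.wt v (S.orb u x) := by
  induction u generalizing x with
  | nil => simp [wt, orb]
  | cons i u ih => simp only [List.cons_append, wt, orb]; rw [ih, mul_assoc]

theorem orb_mem_discs_or_wt_eq_zero (u : List (Fin (2 * d))) {x : ℂ} (hx : x ∈ S.discs) :
    S.orb u x ∈ S.discs ∨ S.wt u x = 0 := by
  induction u generalizing x with
  | nil => exact Or.inl hx
  | cons i u ih =>
    by_cases hi : x ∈ S.disc i
    · exact Or.inr (by rw [wt, step_of_mem hi, zero_mul])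
    · rcases ih (mv_mem_discs hx hi) with h | h
      · exact Or.inl h
      · exact Or.inr (by rw [wt, h, mul_zero])

theorem con_append_le (u v : List (Fin (2 * d))) : S.con (u ++ v) ≤ S.con u * S.con v := by
  refine con_le (mul_nonneg (con_nonneg _) (con_nonneg _)) fun x hx => ?_
  rw [wt_append]
  rcases orb_mem_discs_or_wt_eq_zero u hx with h | h
  · exact mul_le_mul (wt_le_con u hx) (wt_le_con v h) (wt_nonneg _ _) (con_nonneg _)
  · rw [h, zero_mul]; exact mul_nonneg (con_nonneg _) (con_nonneg _)

theorem con_eq_zero {u : List (Fin (2 * d))} (hu : ¬ Reduced u) : S.con u = 0 := by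
  refine le_antisymm (con_le le_rfl fun x hx => le_of_eq ?_) (con_nonneg _)
  induction u generalizing x with
  | nil => exact absurd List.isChain_nil hu
  | cons i u ih =>
    by_cases hi : x ∈ S.disc i
    · rw [wt, step_of_mem hi, zero_mul]
    · rw [wt]
      by_cases hu' : Reduced u
      · have : ∃ j ∈ u.head?, j = bar i := by
          by_contra! hc
          exact hu (reduced_cons hu' hc)
        obtain ⟨j, hj, rfl⟩ := this
        obtain ⟨v, rfl⟩ : ∃ v, u = bar i :: v := by
          cases u with
          | nil => simp at hj
          | cons k v => simp at hj; exact ⟨v, by rw [hj]⟩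
        obtain ⟨k, hk⟩ := Set.mem_iUnion.1 hx
        have : S.mv i x ∈ S.disc (bar i) :=
          mv_mem_disc_of_ne (by rintro rfl; exact hi hk) (disc_subset_cdisc k hk)
        rw [wt, step_of_mem this, zero_mul, mul_zero]
      · rw [ih hu' _ (mv_mem_discs hx hi), mul_zero]

/-- The relation between the hyperbolic and the Euclidean derivatives. -/
theorem wt_mul_Q {u : List (Fin (2 * d))} (hu : Reduced u) {x : ℂ} (hx : x ∈ S.discs)
    (hx' : x ∈ S.dom u) : S.wt u x * (S.Q (S.orb u x) * ‖S.den u x‖ ^ 2) = S.Q x := by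
  induction u generalizing x with
  | nil => simp [wt, orb, den]
  | cons i u ih =>
    have hi := mem_dom_cons.1 hx'
    have h1 := mv_mem_discs hx hi
    have h2 := ih hu.tail h1 (adm_subset_dom _ (mv_mem_adm hu hx'))
    obtain ⟨j, hj⟩ := Set.mem_iUnion.1 h1
    have h3 := (Q_pos hj).ne'
    have h4 := norm_ne_zero_iff.2 (dn_ne_zero hi)
    simp only [wt, orb, den, norm_mul, mul_pow]
    calc _ = S.step i x * (S.wt u (S.mv i x) * (S.Q (S.orb u (S.mv i x)) *
          ‖S.den u (S.mv i x)‖ ^ 2)) * ‖S.dn i x‖ ^ 2 := by ring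
      _ = S.Q x := by
        rw [h2, step, if_neg hi]
        field_simp

theorem Q_mv_ge {g R : ℝ} (hg : 0 < g)
    (hgap : ∀ i j, i ≠ j → S.radius i + S.radius j + g ≤ dist (S.center i : ℂ) (S.center j))
    (hR : 0 < R) (hrad : ∀ i, S.radius i ≤ R)
    (hdn : ∀ i, ∀ j, ∀ x ∈ S.cdisc j, ‖(S.gen i 1 0 : ℂ) * x + (S.gen i 1 1 : ℂ)‖ ≤ R)
    {i j : Fin (2 * d)} (hij : j ≠ i) {x : ℂ} (hx : x ∈ S.cdisc j) :
    g ^ 2 / R ^ 3 ≤ S.Q (S.mv i x) := by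
  have hi : x ∉ S.disc i := fun h => notMem_cdisc hij hx (disc_subset_cdisc i h)
  have h := Q_mv_mul hi
  have h0 := norm_pos_iff.2 (dn_ne_zero hi)
  have h1 : ‖S.dn i x‖ ≤ R := hdn (bar i) j x hx
  have h2 : S.radius i + g ≤ ‖x - S.center i‖ := by
    have h3 := hgap i j hij.symm
    have h4 := dist_triangle_left (S.center i : ℂ) (S.center j) x
    rw [dist_eq_norm x, dist_eq_norm x] at h4
    rw [cdisc, mem_closedBall, dist_eq_norm] at hx
    linarith
  have ri := S.radius_pos i
  have h5 : g ^ 2 / R ≤ (‖x - S.center i‖ ^ 2 - S.radius i ^ 2) / S.radius i :=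
    div_le_div₀ (by nlinarith) (by nlinarith) ri (hrad i)
  rw [← h] at h5
  have h6 : S.Q (S.mv i x) * ‖S.dn i x‖ ^ 2 ≤ S.Q (S.mv i x) * R ^ 2 :=
    mul_le_mul_of_nonneg_left (pow_le_pow_left₀ h0.le h1 2) (Q_nonneg _)
  rw [div_le_iff₀ (by positivity)] at h5 ⊢
  calc g ^ 2 ≤ S.Q (S.mv i x) * ‖S.dn i x‖ ^ 2 * R := h5
    _ ≤ S.Q (S.mv i x) * R ^ 2 * R := mul_le_mul_of_nonneg_right h6 hR.le
    _ = _ := by ring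

variable (S)

/-- The images of the discs under nonempty reduced words stay away from the boundary circles. -/
theorem exists_Q_orb_ge : ∃ c : ℝ, 0 < c ∧ ∀ i u, Reduced (i :: u) → ∀ x ∈ S.adm (i :: u),
    c ≤ S.Q (S.orb (i :: u) x) := by
  obtain ⟨g, hg, hgap⟩ := S.exists_gap
  obtain ⟨R, hR, hrad, -, -, hdn⟩ := S.exists_bounds
  have hR0 : 0 < R := by linarith
  refine ⟨g ^ 2 / R ^ 3, by positivity, fun i u hu => ?_⟩
  induction u generalizing i with
  | nil =>
    rintro x ⟨j, hj, hji⟩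
    exact Q_mv_ge hg hgap hR0 hrad hdn (hji i (by simp)) hj
  | cons k u ih =>
    intro x hx
    exact ih k hu.tail _ (mv_mem_adm hu (adm_subset_dom _ hx))

/-- Comparison of the contraction rate with the Euclidean derivative. -/
theorem exists_con_compare (hd : 2 ≤ d) : ∃ C : ℝ, 1 ≤ C ∧ ∀ u, Reduced u → ∀ x ∈ S.adm u,
    (‖S.den u x‖ ^ 2)⁻¹ ≤ C * S.con u ∧ S.con u ≤ C * (‖S.den u x‖ ^ 2)⁻¹ := by
  obtain ⟨c, hc, hQ⟩ := S.exists_Q_orb_ge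
  obtain ⟨K, hK, hdist⟩ := S.exists_distortion
  obtain ⟨R, hR, hrad, hrad', -, -⟩ := S.exists_bounds
  have hR0 : 0 < R := by linarith
  have hsq : ∀ u, Reduced u → ∀ x ∈ S.adm u, ∀ y ∈ S.adm u,
      (‖S.den u x‖ ^ 2)⁻¹ ≤ K ^ 2 * (‖S.den u y‖ ^ 2)⁻¹ := by
    intro u hu x hx y hy
    have h1 := hdist u hu y hy x hx
    have h2 := norm_pos_iff.2 (den_ne_zero hu (adm_subset_dom _ hx))
    have h3 := norm_pos_iff.2 (den_ne_zero hu (adm_subset_dom _ hy))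
    rw [← div_eq_mul_inv, le_div_iff₀ (by positivity), inv_mul_le_iff₀ (by positivity),
      mul_comm, ← mul_pow]
    exact pow_le_pow_left₀ h3.le h1 2
  have hpt : ∀ u, Reduced u → ∃ y ∈ S.adm u, y ∈ S.discs ∧ R⁻¹ ≤ S.Q y := by
    intro u hu
    obtain ⟨j, hj⟩ : ∃ j : Fin (2 * d), ∀ i ∈ u.head?, i ≠ j := by
      cases u with
      | nil => exact ⟨⟨0, by omega⟩, by simp⟩
      | cons k u => exact ⟨bar k, by simpa using (bar_ne k).symm⟩
    refine ⟨S.center j, mem_adm_of_mem_cdisc (disc_subset_cdisc j (center_mem j)) hj,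
      disc_le_discs (center_mem j), ?_⟩
    rw [Q_eq (disc_subset_cdisc j (center_mem j)), sub_self, norm_zero, zero_pow two_ne_zero,
      sub_zero, pow_two, mul_div_assoc, div_self (S.radius_pos j).ne', mul_one]
    exact hrad' j
  have hC1 : 1 ≤ K ^ 2 * R ^ 2 := by nlinarith [one_le_pow₀ hK (n := 2), one_le_pow₀ hR (n := 2)]
  have hC2 : 0 ≤ K ^ 2 * (R / c) := by positivity
  refine ⟨K ^ 2 * R ^ 2 + K ^ 2 * (R / c), by linarith, fun u hu x hx => ⟨?_, ?_⟩⟩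
  · obtain ⟨y, hy, hyd, hyQ⟩ := hpt u hu
    have h1 := wt_mul_Q hu hyd (adm_subset_dom _ hy)
    have h2 := norm_pos_iff.2 (den_ne_zero hu (adm_subset_dom _ hy))
    have h3 : S.Q (S.orb u y) ≤ R := by
      cases u with
      | nil =>
        obtain ⟨j, hj, -⟩ := hy
        exact Q_le hrad hj
      | cons i u =>
        obtain ⟨k, hk⟩ := exists_orb_mem_cdisc (S := S) hu
        exact Q_le hrad (hk y (adm_subset_dom _ hy))
    have h4 : (‖S.den u y‖ ^ 2)⁻¹ ≤ R ^ 2 * S.con u := by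
      have h5 : S.Q y * (‖S.den u y‖ ^ 2)⁻¹ = S.wt u y * S.Q (S.orb u y) := by
        rw [← h1]; field_simp
      have h6 : R⁻¹ * (‖S.den u y‖ ^ 2)⁻¹ ≤ S.con u * R := by
        calc R⁻¹ * (‖S.den u y‖ ^ 2)⁻¹ ≤ S.Q y * (‖S.den u y‖ ^ 2)⁻¹ :=
              mul_le_mul_of_nonneg_right hyQ (by positivity)
          _ = _ := h5
          _ ≤ _ := mul_le_mul (wt_le_con u hyd) h3 (Q_nonneg _) (con_nonneg _)
      rw [inv_mul_le_iff₀ hR0] at h6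
      linarith
    calc _ ≤ K ^ 2 * (‖S.den u y‖ ^ 2)⁻¹ := hsq u hu x hx y hy
      _ ≤ K ^ 2 * (R ^ 2 * S.con u) := mul_le_mul_of_nonneg_left h4 (by positivity)
      _ ≤ _ := by nlinarith [mul_nonneg hC2 (con_nonneg (S := S) u)]
  · have hx2 := norm_pos_iff.2 (den_ne_zero hu (adm_subset_dom _ hx))
    have hpos : 0 < (‖S.den u x‖ ^ 2)⁻¹ := by positivity
    refine con_le (by positivity) fun y hy => ?_
    cases u with
    | nil => simp only [wt, den]; simp; linarith
    | cons i u =>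
      by_cases hi : y ∈ S.disc i
      · rw [wt, step_of_mem hi, zero_mul]
        positivity
      · obtain ⟨j, hj⟩ := Set.mem_iUnion.1 hy
        have hya : y ∈ S.adm (i :: u) := mem_adm_of_mem_cdisc (disc_subset_cdisc j hj) (by
          simp; rintro rfl; exact hi hj)
        have h1 := wt_mul_Q hu hy (adm_subset_dom _ hya)
        have h2 := hQ i u hu y hya
        have h3 := norm_pos_iff.2 (den_ne_zero hu (adm_subset_dom _ hya))
        have h4 : S.Q y ≤ R := Q_le hrad (disc_subset_cdisc j hj)
        have h5 : S.wt (i :: u) y * c ≤ R * (‖S.den (i :: u) y‖ ^ 2)⁻¹ := by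
          rw [← div_eq_mul_inv, le_div_iff₀ (by positivity)]
          calc _ = S.wt (i :: u) y * (c * ‖S.den (i :: u) y‖ ^ 2) := by ring
            _ ≤ S.wt (i :: u) y * (S.Q (S.orb (i :: u) y) * ‖S.den (i :: u) y‖ ^ 2) :=
              mul_le_mul_of_nonneg_left (mul_le_mul_of_nonneg_right h2 (by positivity))
                (wt_nonneg _ _)
            _ ≤ R := h1.le.trans h4
        have h6 := hsq _ hu y hya x hx
        rw [← le_div_iff₀ hc] at h5
        calc _ ≤ _ := h5
          _ ≤ R * (K ^ 2 * (‖S.den (i :: u) x‖ ^ 2)⁻¹) / c := by gcongr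
          _ = K ^ 2 * (R / c) * (‖S.den (i :: u) x‖ ^ 2)⁻¹ := by ring
          _ ≤ _ := by
            refine mul_le_mul_of_nonneg_right ?_ hpos.le
            linarith

/-- Removing a first letter changes the contraction rate by a bounded factor only. -/
theorem exists_con_le_con_cons (hd : 2 ≤ d) : ∃ C : ℝ, 1 ≤ C ∧ ∀ i u, Reduced (i :: u) →
    S.con u ≤ C * S.con (i :: u) := by
  obtain ⟨C, hC, h⟩ := S.exists_con_compare hd
  obtain ⟨R, hR, -, -, -, hdn⟩ := S.exists_bounds
  refine ⟨C ^ 2 * R ^ 2, ?_, fun i u hu => ?_⟩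
  · nlinarith [one_le_pow₀ hC (n := 2), one_le_pow₀ hR (n := 2)]
  have hx : (S.center (bar i) : ℂ) ∈ S.adm (i :: u) :=
    mem_adm_of_mem_cdisc (disc_subset_cdisc _ (center_mem _)) (by simpa using (bar_ne i).symm)
  have h1 := (h _ hu.tail _ (mv_mem_adm hu (adm_subset_dom _ hx))).2
  have h2 := (h _ hu _ hx).1
  have h3 : ‖S.dn i (S.center (bar i))‖ ≤ R := hdn _ _ _ (disc_subset_cdisc _ (center_mem _))
  have h4 := norm_pos_iff.2 (dn_ne_zero (mem_dom_cons.1 (adm_subset_dom _ hx)))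
  simp only [den, norm_mul, mul_pow, mul_inv] at h2
  rw [inv_mul_le_iff₀ (by positivity)] at h2
  have h5 : ‖S.dn i (S.center (bar i))‖ ^ 2 ≤ R ^ 2 := pow_le_pow_left₀ h4.le h3 2
  have h6 : 0 ≤ C * S.con (i :: u) := mul_nonneg (by linarith) (con_nonneg _)
  calc _ ≤ _ := h1
    _ ≤ C * (‖S.dn i (S.center (bar i))‖ ^ 2 * (C * S.con (i :: u))) :=
      mul_le_mul_of_nonneg_left h2 (by linarith)
    _ ≤ C * (R ^ 2 * (C * S.con (i :: u))) := by gcongr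
    _ = _ := by ring

end SchottkyData

/-! ### Infinite words and limit points -/

/-- The word formed by the first `k` letters of an infinite word, in reversed order. -/
def pre {α : Type*} (ξ : ℕ → α) : ℕ → List α
  | 0 => []
  | k + 1 => ξ k :: pre ξ k

theorem length_pre {α : Type*} (ξ : ℕ → α) (k : ℕ) : (pre ξ k).length = k := by
  induction k with
  | zero => rfl
  | succ k ih => simp [pre, ih]

theorem pre_congr {α : Type*} {ξ ξ' : ℕ → α} {k : ℕ} (h : ∀ m < k, ξ m = ξ' m) :
    pre ξ k = pre ξ' k := by
  induction k with
  | zero => rfl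
  | succ k ih => rw [pre, pre, h k (Nat.lt_succ_self k), ih fun m hm => h m (by omega)]

theorem pre_suffix {α : Type*} (ξ : ℕ → α) {k l : ℕ} (h : k ≤ l) : pre ξ k <:+ pre ξ l := by
  induction l, h using Nat.le_induction with
  | base => exact List.suffix_rfl
  | succ l _ ih => exact ih.trans (List.suffix_cons _ _)

/-- An infinite word is reduced if all its finite subwords are. -/
def ReducedSeq {d : ℕ} (ξ : ℕ → Fin (2 * d)) : Prop := ∀ k, ξ k ≠ bar (ξ (k + 1))

theorem head_pre {α : Type*} {ξ : ℕ → α} {k : ℕ} : ∀ i ∈ (pre ξ k).head?, ∃ m, k = m + 1 ∧ i = ξ m := by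
  cases k with
  | zero => simp [pre]
  | succ k => simp [pre]

theorem ReducedSeq.head_ne {d : ℕ} {ξ : ℕ → Fin (2 * d)} (h : ReducedSeq ξ) (k : ℕ) :
    ∀ i ∈ (pre ξ k).head?, i ≠ bar (ξ k) := by
  intro i hi
  obtain ⟨m, rfl, rfl⟩ := head_pre i hi
  exact h m

theorem ReducedSeq.reduced {d : ℕ} {ξ : ℕ → Fin (2 * d)} (h : ReducedSeq ξ) (k : ℕ) :
    Reduced (pre ξ k) := by
  induction k with
  | zero => exact List.isChain_nil
  | succ k ih => exact reduced_cons ih (h.head_ne k)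

theorem exists_reducedSeq {d : ℕ} (hd : 0 < d) {u : List (Fin (2 * d))} (hu : Reduced u) :
    ∃ ξ : ℕ → Fin (2 * d), ReducedSeq ξ ∧ pre ξ u.length = u := by
  induction u with
  | nil =>
    exact ⟨fun _ => ⟨0, by omega⟩, fun k => (bar_ne _).symm, rfl⟩
  | cons i u ih =>
    obtain ⟨ξ, hξ, hξu⟩ := ih hu.tail
    refine ⟨fun m => if m < u.length then ξ m else i, fun k => ?_, ?_⟩
    · dsimp only
      rcases lt_trichotomy (k + 1) u.length with h | h | h
      · rw [if_pos (by omega), if_pos h]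
        exact hξ k
      · rw [if_pos (by omega), if_neg (by omega)]
        refine hu.head _ ?_
        rw [← hξu, ← h]
        simp [pre]
      · rw [if_neg (by omega), if_neg (by omega)]
        exact (bar_ne i).symm
    · rw [List.length_cons, pre, if_neg (lt_irrefl _)]
      congr 1
      conv_rhs => rw [← hξu]
      exact pre_congr fun m hm => if_pos hm

namespace SchottkyData

variable {d : ℕ} (S : SchottkyData d)

/-- The images of discs under reduced words have diameters comparable to the contraction rate. -/
theorem exists_orb_dist (hd : 2 ≤ d) : ∃ C : ℝ, 1 ≤ C ∧ ∀ u, Reduced u → ∀ x ∈ S.adm u,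
    ∀ y ∈ S.adm u, dist (S.orb u x) (S.orb u y) ≤ C * S.con u * dist x y ∧
      S.con u * dist x y ≤ C * dist (S.orb u x) (S.orb u y) := by
  obtain ⟨C, hC, h⟩ := S.exists_con_compare hd
  refine ⟨C, hC, fun u hu x hx y hy => ?_⟩
  have hx0 := norm_pos_iff.2 (den_ne_zero hu (adm_subset_dom _ hx))
  have hy0 := norm_pos_iff.2 (den_ne_zero hu (adm_subset_dom _ hy))
  have e : dist (S.orb u x) (S.orb u y) = dist x y * (‖S.den u x‖⁻¹ * ‖S.den u y‖⁻¹) := by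
    rw [dist_eq_norm, orb_sub_orb hu (adm_subset_dom _ hx) (adm_subset_dom _ hy), norm_div,
      norm_mul, dist_eq_norm, div_eq_mul_inv, mul_inv]
  have hc := con_nonneg (S := S) u
  have hCc : 0 ≤ C * S.con u := mul_nonneg (by linarith) hc
  obtain ⟨h1, h2⟩ := h u hu x hx
  obtain ⟨h3, h4⟩ := h u hu y hy
  rw [← inv_pow] at h1 h2 h3 h4
  set a := ‖S.den u x‖⁻¹
  set b := ‖S.den u y‖⁻¹
  have ha : 0 < a := by positivity
  have hb : 0 < b := by positivity
  constructor
  · rw [e, mul_comm]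
    refine mul_le_mul_of_nonneg_right ?_ dist_nonneg
    nlinarith [sq_nonneg (a - b)]
  · rw [e, mul_left_comm, mul_comm]
    refine mul_le_mul_of_nonneg_left ?_ dist_nonneg
    have h5 : S.con u ^ 2 ≤ (C * (a * b)) ^ 2 := by
      calc S.con u ^ 2 = S.con u * S.con u := by ring
        _ ≤ (C * a ^ 2) * (C * b ^ 2) := mul_le_mul h2 h4 hc (by positivity)
        _ = _ := by ring
    exact (pow_le_pow_iff_left₀ hc (by positivity) two_ne_zero).1 h5

variable {S}

theorem mv_ofReal (i : Fin (2 * d)) (t : ℝ) : ∃ t' : ℝ, S.mv i t = t' :=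
  ⟨(S.gen (bar i) 0 0 * t + S.gen (bar i) 0 1) / (S.gen (bar i) 1 0 * t + S.gen (bar i) 1 1), by
    simp [mv, mob]⟩

theorem orb_ofReal (u : List (Fin (2 * d))) (t : ℝ) : ∃ t' : ℝ, S.orb u t = t' := by
  induction u generalizing t with
  | nil => exact ⟨t, rfl⟩
  | cons i u ih =>
    obtain ⟨t', h⟩ := mv_ofReal (S := S) i t
    obtain ⟨t'', h'⟩ := ih t'
    exact ⟨t'', by rw [orb, h, h']⟩

/-- On the upper half plane, `orb u` is the action of an element of the Schottky group. -/
theorem exists_orb_eq_smul (u : List (Fin (2 * d))) :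
    ∃ g ∈ S.group, ∀ z : ℍ, S.orb u z = ((g • z : ℍ) : ℂ) := by
  induction u with
  | nil => exact ⟨1, S.group.one_mem, fun z => by simp [orb]⟩
  | cons i u ih =>
    obtain ⟨g, hg, h⟩ := ih
    refine ⟨g * S.gen (bar i), S.group.mul_mem hg (Subgroup.subset_closure ⟨_, rfl⟩), fun z => ?_⟩
    have h1 : S.mv i z = ((S.gen (bar i) • z : ℍ) : ℂ) := by
      rw [UpperHalfPlane.coe_specialLinearGroup_apply]
      rfl
    rw [orb, h1, h, mul_smul]

variable (S)

theorem exists_orbit_mem_cdisc (hd : 2 ≤ d) (i : Fin (2 * d)) :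
    ∃ g ∈ S.group, ((g • UpperHalfPlane.I : ℍ) : ℂ) ∈ S.cdisc (bar i) := by
  by_cases hi : (UpperHalfPlane.I : ℂ) ∈ S.disc i
  · obtain ⟨j, hji, hjb⟩ := exists_ne_ne hd i (bar i)
    obtain ⟨g, hg, h⟩ := exists_orb_eq_smul (S := S) [j, i]
    refine ⟨g, hg, ?_⟩
    rw [← h]
    refine mv_mem_cdisc fun h1 => ?_
    have h2 : (UpperHalfPlane.I : ℂ) ∉ S.disc j := fun h2 =>
      notMem_cdisc hji (disc_subset_cdisc j h2) (disc_subset_cdisc i hi)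
    refine notMem_cdisc (fun h3 => hjb ?_) (mv_mem_cdisc h2) (disc_subset_cdisc i h1)
    rw [← h3, bar_bar]
  · obtain ⟨g, hg, h⟩ := exists_orb_eq_smul (S := S) [i]
    refine ⟨g, hg, ?_⟩
    rw [← h]
    exact mv_mem_cdisc hi

/-- The disc of generation `k` around the limit point of an infinite word. -/
noncomputable def cyl (ξ : ℕ → Fin (2 * d)) (k : ℕ) : Set ℂ :=
  S.orb (pre ξ k) '' S.cdisc (bar (ξ k))

variable {S}

theorem cdisc_subset_adm {ξ : ℕ → Fin (2 * d)} (hξ : ReducedSeq ξ) (k : ℕ) :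
    S.cdisc (bar (ξ k)) ⊆ S.adm (pre ξ k) :=
  fun _ hx => mem_adm_of_mem_cdisc hx (hξ.head_ne k)

theorem cyl_succ_subset {ξ : ℕ → Fin (2 * d)} (hξ : ReducedSeq ξ) (k : ℕ) :
    S.cyl ξ (k + 1) ⊆ S.cyl ξ k := by
  rintro _ ⟨x, hx, rfl⟩
  refine ⟨S.mv (ξ k) x, mv_mem_cdisc fun h => ?_, rfl⟩
  exact notMem_cdisc (hξ k).symm hx (disc_subset_cdisc _ h)

theorem isCompact_cyl (hd : 2 ≤ d) {ξ : ℕ → Fin (2 * d)} (hξ : ReducedSeq ξ) (k : ℕ) :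
    IsCompact (S.cyl ξ k) := by
  obtain ⟨C, hC, h⟩ := S.exists_orb_dist hd
  refine (isCompact_closedBall _ _).image_of_continuousOn ?_
  refine (LipschitzOnWith.of_dist_le_mul (K := (C * S.con (pre ξ k)).toNNReal)
    fun x hx y hy => ?_).continuousOn
  rw [Real.coe_toNNReal _ (mul_nonneg (by linarith) (con_nonneg _))]
  exact (h _ (hξ.reduced k) x (cdisc_subset_adm hξ k hx) y (cdisc_subset_adm hξ k hy)).1

theorem con_le_pow {θ : ℝ} (hθ : 0 ≤ θ) (h : ∀ i, ∀ x ∈ S.discs, S.step i x ≤ θ)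
    (u : List (Fin (2 * d))) : S.con u ≤ θ ^ u.length :=
  con_le (by positivity) fun _ hx => wt_le_pow hθ h u hx

variable (S)

theorem exists_con_le_pow : ∃ θ : ℝ, 0 < θ ∧ θ < 1 ∧ ∀ u, S.con u ≤ θ ^ u.length := by
  obtain ⟨θ, h0, h1, h⟩ := S.exists_step_le
  exact ⟨θ, h0, h1, fun u => con_le_pow h0.le h u⟩

/-- Every reduced infinite word is the code of a limit point. -/
theorem exists_limit_point (hd : 2 ≤ d) {ξ : ℕ → Fin (2 * d)} (hξ : ReducedSeq ξ) :
    ∃ t ∈ S.limitSet, ∀ k, (t : ℂ) ∈ S.cyl ξ k := by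
  obtain ⟨t, ht⟩ : (⋂ k, {t : ℝ | (t : ℂ) ∈ S.cyl ξ k}).Nonempty := by
    have hcl : ∀ k, IsClosed {t : ℝ | (t : ℂ) ∈ S.cyl ξ k} := fun k =>
      (isCompact_cyl hd hξ k).isClosed.preimage Complex.continuous_ofReal
    refine IsCompact.nonempty_iInter_of_sequence_nonempty_isCompact_isClosed _
      (fun k t ht => cyl_succ_subset hξ k ht) (fun k => ?_) ?_ hcl
    · obtain ⟨t, h⟩ := orb_ofReal (S := S) (pre ξ k) (S.center (bar (ξ k)))
      exact ⟨t, _, disc_subset_cdisc _ (center_mem _), h⟩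
    · exact Complex.isometry_ofReal.isClosedEmbedding.isCompact_preimage (isCompact_cyl hd hξ 0)
  rw [Set.mem_iInter] at ht
  refine ⟨t, ?_, ht⟩
  obtain ⟨C, hC, h⟩ := S.exists_orb_dist hd
  obtain ⟨R, hR, -, -, hb, -⟩ := S.exists_bounds
  obtain ⟨θ, h0, h1, hθ⟩ := S.exists_con_le_pow
  have hlim : Tendsto (fun k => C * θ ^ k * (R + R)) atTop (𝓝 0) := by
    simpa using ((tendsto_pow_atTop_nhds_zero_of_lt_one h0.le h1).const_mul C).mul_const (R + R)
  refine accPt_iff_nhds.2 fun U hU => ?_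
  obtain ⟨ε, hε, hεU⟩ := Metric.mem_nhds_iff.1 hU
  obtain ⟨k, hk⟩ := (hlim.eventually (gt_mem_nhds hε)).exists
  obtain ⟨g, hg, hgd⟩ := S.exists_orbit_mem_cdisc hd (ξ k)
  obtain ⟨g', hg', horb⟩ := exists_orb_eq_smul (S := S) (pre ξ k)
  have hw := horb (g • UpperHalfPlane.I)
  rw [← mul_smul] at hw
  refine ⟨S.orb (pre ξ k) ((g • UpperHalfPlane.I : ℍ) : ℂ),
    ⟨hεU ?_, g' * g, S.group.mul_mem hg' hg, hw⟩, ?_⟩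
  · obtain ⟨x, hx, hxt⟩ := ht k
    rw [mem_ball, ← hxt]
    refine lt_of_le_of_lt ?_ hk
    refine (h _ (hξ.reduced k) _ (cdisc_subset_adm hξ k hgd) x (cdisc_subset_adm hξ k hx)).1.trans ?_
    have h2 : S.con (pre ξ k) ≤ θ ^ k := by simpa [length_pre] using hθ (pre ξ k)
    have h3 : dist ((g • UpperHalfPlane.I : ℍ) : ℂ) x ≤ R + R := by
      rw [dist_eq_norm]
      exact (norm_sub_le _ _).trans (add_le_add (hb _ _ hgd) (hb _ _ hx))
    have hC0 : 0 ≤ C := by linarith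
    gcongr
  · rw [hw]
    intro he
    have := congrArg Complex.im he
    rw [Complex.ofReal_im] at this
    exact (UpperHalfPlane.im_pos ((g' * g) • UpperHalfPlane.I)).ne' this

/-- Limit points whose codes first differ in a given position are far apart on the scale of the
common part of the codes. -/
theorem exists_separation (hd : 2 ≤ d) : ∃ c : ℝ, 0 < c ∧ ∀ ξ ξ' : ℕ → Fin (2 * d), ReducedSeq ξ →
    ReducedSeq ξ' → ∀ p, (∀ m < p, ξ m = ξ' m) → ξ p ≠ ξ' p → ∀ t ∈ S.cyl ξ p, ∀ t' ∈ S.cyl ξ' p,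
      c * S.con (pre ξ p) ≤ dist t t' := by
  obtain ⟨C, hC, h⟩ := S.exists_orb_dist hd
  obtain ⟨g, hg, hgap⟩ := S.exists_gap_dist
  refine ⟨g / C, by positivity, ?_⟩
  rintro ξ ξ' hξ hξ' p hp hne _ ⟨x, hx, rfl⟩ _ ⟨y, hy, rfl⟩
  have e := pre_congr hp
  have hy' := cdisc_subset_adm hξ' p hy
  rw [← e] at hy' ⊢
  have h1 := (h _ (hξ.reduced p) x (cdisc_subset_adm hξ p hx) y hy').2
  have h2 := hgap _ _ (fun h => hne (bar_injective h)) x hx y hy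
  have h3 : g * S.con (pre ξ p) ≤ C * dist (S.orb (pre ξ p) x) (S.orb (pre ξ p) y) := by
    refine le_trans ?_ h1
    rw [mul_comm]
    exact mul_le_mul_of_nonneg_left h2 (con_nonneg _)
  rw [div_mul_eq_mul_div, div_le_iff₀ (by linarith)]
  linarith

end SchottkyData

namespace SchottkyData

variable {d : ℕ} (S : SchottkyData d)

/-! ### Summation over words above the dimension of the limit set -/

theorem delta_nonneg : 0 ≤ S.delta := ENNReal.toReal_nonneg

theorem hausdorffMeasure_limitSet {σ : ℝ} (hσ : S.delta < σ) : μH[σ] S.limitSet = 0 := by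
  have hσ0 : 0 ≤ σ := S.delta_nonneg.trans hσ.le
  have h1 : dimH S.limitSet ≠ ∞ := by
    refine ne_top_of_le_ne_top ENNReal.one_ne_top ?_
    exact (dimH_mono (Set.subset_univ _)).trans Real.dimH_univ.le
  have h2 : dimH S.limitSet < (σ.toNNReal : ℝ≥0∞) := by
    rw [← ENNReal.ofReal_toReal h1]
    exact (ENNReal.ofReal_lt_ofReal_iff (lt_of_le_of_lt S.delta_nonneg hσ)).2 hσ
  have h3 := hausdorffMeasure_of_dimH_lt h2
  rwa [Real.coe_toNNReal _ hσ0] at h3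

/-- A cover of the limit set by sets that are small in the sense of the Hausdorff measure gives a
countable family of cylinders that is small in the same sense and through which each infinite
word passes. A set of the cover is replaced by the largest cylinder around one of its points whose
size is comparable to that of the set. -/
theorem exists_countable_cover (hd : 2 ≤ d) {σ : ℝ} (hσ : S.delta < σ) {η : ℝ≥0∞} (hη : η ≠ 0) :
    ∃ F : ℕ → List (Fin (2 * d)), (∀ n, F n ≠ []) ∧ ∑' n, ENNReal.ofReal (S.con (F n) ^ σ) ≤ η ∧
      ∀ ξ : ℕ → Fin (2 * d), ReducedSeq ξ → ∃ n k, pre ξ k = F n := by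
  have hσ0 : 0 < σ := lt_of_le_of_lt S.delta_nonneg hσ
  obtain ⟨c, hc, hsep⟩ := S.exists_separation hd
  obtain ⟨θ, hθ0, hθ1, hθ⟩ := S.exists_con_le_pow
  have hcσ : 0 < ENNReal.ofReal (c ^ σ) := ENNReal.ofReal_pos.2 (by positivity)
  obtain ⟨ε, hε0, hε1⟩ : ∃ ε : ℝ≥0∞, ε ≠ 0 ∧ ε + ε ≤ ENNReal.ofReal (c ^ σ) * min η 1 := by
    refine ⟨ENNReal.ofReal (c ^ σ) * min η 1 / 2, ?_, (ENNReal.add_halves _).le⟩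
    have : min η 1 ≠ 0 := by simp [hη]
    simp [this, hcσ.ne']
  obtain ⟨ε', hε'0, hε'⟩ := ENNReal.exists_pos_sum_of_countable' hε0 ℕ
  obtain ⟨t, htcov, htsum⟩ : ∃ t : ℕ → Set ℝ, S.limitSet ⊆ ⋃ n, t n ∧
      ∑' n, ⨆ _ : (t n).Nonempty, ediam (t n) ^ σ < ε := by
    have h := S.hausdorffMeasure_limitSet hσ
    rw [Measure.hausdorffMeasure_apply] at h
    have h1 := le_of_le_of_eq (le_iSup₂ (f := fun (r : ℝ≥0∞) (_ : 0 < r) =>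
      ⨅ (t : ℕ → Set ℝ) (_ : S.limitSet ⊆ ⋃ n, t n) (_ : ∀ n, ediam (t n) ≤ r),
          ∑' n, ⨆ _ : (t n).Nonempty, ediam (t n) ^ σ) 1 one_pos) h
    have h2 := lt_of_le_of_lt h1 (pos_iff_ne_zero.2 hε0)
    simp only [iInf_lt_iff] at h2
    obtain ⟨t, h3, -, h4⟩ := h2
    exact ⟨t, h3, h4⟩
  set D : ℕ → ℝ≥0∞ := fun n => ⨆ _ : (t n).Nonempty, ediam (t n) ^ σ with hD
  set a : (ℕ → Fin (2 * d)) → ℕ → ℝ≥0∞ := fun ξ k => ENNReal.ofReal ((c * S.con (pre ξ k)) ^ σ)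
    with ha
  have hDfin : ∀ n, D n ≠ ∞ := fun n => ne_top_of_le_ne_top (htsum.ne_top) (ENNReal.le_tsum n)
  have hkey : ∀ n, ∃ w : List (Fin (2 * d)), w ≠ [] ∧
      ENNReal.ofReal ((c * S.con w) ^ σ) ≤ D n + ε' n ∧
      ∀ ξ, ReducedSeq ξ → ∀ x ∈ t n, (∀ k, (x : ℂ) ∈ S.cyl ξ k) → ∃ k, pre ξ k = w := by
    intro n
    by_cases hex : ∃ ξ₀, ReducedSeq ξ₀ ∧ ∃ x₀ ∈ t n, ∀ k, (x₀ : ℂ) ∈ S.cyl ξ₀ k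
    · obtain ⟨ξ₀, hξ₀, x₀, hx₀, hcyl₀⟩ := hex
      have hDn : D n = ediam (t n) ^ σ := iSup_pos (⟨x₀, hx₀⟩ : (t n).Nonempty)
      have hlim : Tendsto (a ξ₀) atTop (𝓝 0) := by
        have h1 : Tendsto (fun k => ENNReal.ofReal ((c * θ ^ k) ^ σ)) atTop (𝓝 0) := by
          have h2 : Tendsto (fun k => (c * θ ^ k) ^ σ) atTop (𝓝 0) := by
            have h3 := (tendsto_pow_atTop_nhds_zero_of_lt_one hθ0.le hθ1).const_mul c
            have h4 := h3.rpow_const (p := σ) (Or.inr hσ0.le)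
            simpa [Real.zero_rpow hσ0.ne'] using h4
          simpa using ENNReal.tendsto_ofReal h2
        refine tendsto_of_tendsto_of_tendsto_of_le_of_le tendsto_const_nhds h1
          (fun k => zero_le) fun k => ENNReal.ofReal_le_ofReal ?_
        have h5 : S.con (pre ξ₀ k) ≤ θ ^ k := by simpa [length_pre] using hθ (pre ξ₀ k)
        have h6 := con_nonneg (S := S) (pre ξ₀ k)
        exact Real.rpow_le_rpow (by positivity) (by gcongr) hσ0.le
      have hex' : ∃ k, a ξ₀ k < D n + ε' n := by
        have hpos : 0 < D n + ε' n := lt_of_lt_of_le (hε'0 n) le_add_self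
        exact (hlim.eventually (gt_mem_nhds hpos)).exists
      classical
      obtain ⟨k, hk, hmin⟩ : ∃ k, a ξ₀ k < D n + ε' n ∧ ∀ p < k, D n + ε' n ≤ a ξ₀ p :=
        ⟨Nat.find hex', Nat.find_spec hex', fun p hp => not_lt.1 (Nat.find_min hex' hp)⟩
      -- a set of the cover is too small for the whole limit set to be its cylinder
      have hk0 : k ≠ 0 := by
        rintro rfl
        have h1 : S.con (pre ξ₀ 0) = 1 := by
          refine le_antisymm con_nil_le ?_
          exact wt_le_con (S := S) [] (disc_le_discs (center_mem (ξ₀ 0)))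
        have h2 : a ξ₀ 0 = ENNReal.ofReal (c ^ σ) := by simp only [ha, h1, mul_one]
        rw [h2] at hk
        have h3 : D n + ε' n ≤ ε + ε :=
          add_le_add ((ENNReal.le_tsum n).trans htsum.le) ((ENNReal.le_tsum n).trans hε'.le)
        have h4 : ENNReal.ofReal (c ^ σ) * min η 1 ≤ ENNReal.ofReal (c ^ σ) :=
          mul_le_of_le_one_right' (min_le_right _ _)
        exact absurd hk (not_lt.2 (h3.trans (hε1.trans h4)))
      refine ⟨pre ξ₀ k, ?_, hk.le, fun ξ hξ x hx hcyl => ⟨k, ?_⟩⟩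
      · intro h
        have := length_pre ξ₀ k
        rw [h] at this
        exact hk0 this.symm
      · by_contra hne
        have hdiff : ∃ p, p < k ∧ ξ p ≠ ξ₀ p := by
          by_contra! hall
          exact hne (pre_congr hall)
        obtain ⟨p, ⟨hpk, hp⟩, hpmin⟩ : ∃ p, (p < k ∧ ξ p ≠ ξ₀ p) ∧
            ∀ m < p, ¬ (m < k ∧ ξ m ≠ ξ₀ m) :=
          ⟨Nat.find hdiff, Nat.find_spec hdiff, fun m hm => Nat.find_min hdiff hm⟩
        have h1 := hsep ξ₀ ξ hξ₀ hξ p (fun m hm => by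
          by_contra h; exact hpmin m hm ⟨hm.trans hpk, fun h' => h h'.symm⟩) hp.symm
          x₀ (hcyl₀ p) x (hcyl p)
        have h2 : a ξ₀ p ≤ D n := by
          rw [hDn]
          calc a ξ₀ p ≤ ENNReal.ofReal (dist x₀ x ^ σ) := by
                refine ENNReal.ofReal_le_ofReal (Real.rpow_le_rpow
                  (mul_nonneg hc.le (con_nonneg _)) (h1.trans (le_of_eq ?_)) hσ0.le)
                exact Complex.isometry_ofReal.dist_eq _ _
            _ = edist x₀ x ^ σ := by
                rw [edist_dist, ENNReal.ofReal_rpow_of_nonneg dist_nonneg hσ0.le]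
            _ ≤ ediam (t n) ^ σ :=
                ENNReal.rpow_le_rpow (edist_le_ediam_of_mem hx₀ hx) hσ0.le
        have h3 := (hmin p hpk).trans h2
        exact absurd h3 (not_le.2 (ENNReal.lt_add_right (hDfin n) (hε'0 n).ne'))
    · -- a set of the cover without limit points is replaced by a word that is not reduced
      push Not at hex
      let i : Fin (2 * d) := ⟨0, by omega⟩
      refine ⟨[i, bar i], by simp, ?_, fun ξ hξ x hx hcyl => ?_⟩
      · rw [con_eq_zero (by simp [Reduced]), mul_zero, Real.zero_rpow hσ0.ne',
          ENNReal.ofReal_zero]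
        exact zero_le
      · obtain ⟨k, hk⟩ := hex ξ hξ x hx
        exact absurd (hcyl k) hk
  choose F hF0 hF1 hF2 using hkey
  refine ⟨F, hF0, ?_, fun ξ hξ => ?_⟩
  · have h1 : ENNReal.ofReal (c ^ σ) * ∑' n, ENNReal.ofReal (S.con (F n) ^ σ) ≤
        ENNReal.ofReal (c ^ σ) * η := by
      rw [← ENNReal.tsum_mul_left]
      calc ∑' n, ENNReal.ofReal (c ^ σ) * ENNReal.ofReal (S.con (F n) ^ σ)
          = ∑' n, ENNReal.ofReal ((c * S.con (F n)) ^ σ) := by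
            refine tsum_congr fun n => ?_
            rw [← ENNReal.ofReal_mul (by positivity), Real.mul_rpow hc.le (con_nonneg _)]
        _ ≤ ∑' n, (D n + ε' n) := ENNReal.tsum_le_tsum hF1
        _ = ∑' n, D n + ∑' n, ε' n := ENNReal.tsum_add
        _ ≤ ε + ε := add_le_add htsum.le hε'.le
        _ ≤ ENNReal.ofReal (c ^ σ) * min η 1 := hε1
        _ ≤ _ := by gcongr; exact min_le_left _ _
    exact (ENNReal.mul_le_mul_iff_right hcσ.ne' ENNReal.ofReal_ne_top).1 h1
  · obtain ⟨x, hx, hcyl⟩ := S.exists_limit_point hd hξ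
    obtain ⟨n, hn⟩ := Set.mem_iUnion.1 (htcov hx)
    obtain ⟨k, hk⟩ := hF2 n ξ hξ x hn hcyl
    exact ⟨n, k, hk⟩

end SchottkyData

theorem isOpen_pre_eq {α : Type*} [TopologicalSpace α] [DiscreteTopology α] (w : List α) (k : ℕ) :
    IsOpen {ξ : ℕ → α | pre ξ k = w} := by
  induction k generalizing w with
  | zero => simp only [pre]; exact isOpen_const
  | succ k ih =>
    cases w with
    | nil => simp [pre]
    | cons i w =>
      simp only [pre, List.cons.injEq]
      exact ((isOpen_discrete {i}).preimage (continuous_apply k)).inter (ih w)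

/-- By compactness of the space of infinite words, finitely many of the words of a family suffice
if each infinite word passes through the family. -/
theorem exists_finite_cover {d : ℕ} (hd : 0 < d) (F : ℕ → List (Fin (2 * d)))
    (hF : ∀ ξ : ℕ → Fin (2 * d), ReducedSeq ξ → ∃ n k, pre ξ k = F n) :
    ∃ (N : Finset ℕ) (M : ℕ), ∀ u, Reduced u → M ≤ u.length → ∃ n ∈ N, F n <:+ u := by
  classical
  let V : ℕ × ℕ → Set (ℕ → Fin (2 * d)) := fun p =>
    {ξ | ξ p.1 = bar (ξ (p.1 + 1))} ∪ {ξ | pre ξ p.1 = F p.2}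
  have hVo : ∀ p, IsOpen (V p) := fun p => by
    refine IsOpen.union ?_ (isOpen_pre_eq _ _)
    have hc : Continuous fun ξ : ℕ → Fin (2 * d) => (ξ p.1, ξ (p.1 + 1)) :=
      (continuous_apply p.1).prodMk (continuous_apply (p.1 + 1))
    exact (isOpen_discrete {q : Fin (2 * d) × Fin (2 * d) | q.1 = bar q.2}).preimage hc
  obtain ⟨T, hT⟩ := isCompact_univ.elim_finite_subcover V hVo fun ξ _ => by
    by_cases hξ : ReducedSeq ξ
    · obtain ⟨n, k, h⟩ := hF ξ hξ
      exact Set.mem_iUnion.2 ⟨(k, n), Or.inr h⟩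
    · simp only [ReducedSeq, not_forall, not_not] at hξ
      obtain ⟨k, hk⟩ := hξ
      exact Set.mem_iUnion.2 ⟨(k, 0), Or.inl hk⟩
  refine ⟨T.image Prod.snd, T.sup Prod.fst, fun u hu hlen => ?_⟩
  obtain ⟨ξ, hξ, hξu⟩ := exists_reducedSeq hd hu
  obtain ⟨p, hp, h⟩ := Set.mem_iUnion₂.1 (hT (Set.mem_univ ξ))
  refine ⟨p.2, Finset.mem_image_of_mem _ hp, ?_⟩
  rcases h with h | h
  · exact absurd h (hξ p.1)
  · rw [← hξu, ← show pre ξ p.1 = F p.2 from h]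
    exact pre_suffix ξ ((Finset.le_sup (f := Prod.fst) hp).trans hlen)

open Classical in
/-- The finite set of all words of length `L`. -/
noncomputable def words (d L : ℕ) : Finset (List (Fin (2 * d))) :=
  Finset.univ.image (List.ofFn : (Fin L → Fin (2 * d)) → List (Fin (2 * d)))

theorem mem_words {d L : ℕ} {u : List (Fin (2 * d))} : u ∈ words d L ↔ u.length = L := by
  simp only [words, Finset.mem_image, Finset.mem_univ, true_and]
  constructor
  · rintro ⟨f, rfl⟩; simp
  · rintro rfl; exact ⟨u.get, List.ofFn_get u⟩

theorem sum_words {d L : ℕ} (φ : List (Fin (2 * d)) → ℝ) :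
    ∑ u ∈ words d L, φ u = ∑ w : Fin L → Fin (2 * d), φ (List.ofFn w) := by
  classical
  rw [words, Finset.sum_image fun _ _ _ _ h => List.ofFn_injective h]

namespace SchottkyData

variable {d : ℕ} (S : SchottkyData d)

theorem sum_words_suffix_le {σ : ℝ} (hσ : 0 ≤ σ) (L : ℕ) (w : List (Fin (2 * d)))
    [DecidablePred fun u : List (Fin (2 * d)) => w <:+ u] :
    ∑ u ∈ (words d L).filter (fun u => w <:+ u), S.con u ^ σ ≤
      S.con w ^ σ * ∑ v ∈ words d (L - w.length), S.con v ^ σ := by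
  classical
  calc ∑ u ∈ (words d L).filter (fun u => w <:+ u), S.con u ^ σ
      ≤ ∑ u ∈ (words d (L - w.length)).image (· ++ w), S.con u ^ σ := by
        refine Finset.sum_le_sum_of_subset_of_nonneg (fun u hu => ?_)
          fun _ _ _ => Real.rpow_nonneg (con_nonneg _) _
        obtain ⟨hu, v, rfl⟩ := Finset.mem_filter.1 hu
        rw [mem_words, List.length_append] at hu
        exact Finset.mem_image_of_mem _ (mem_words.2 (by omega))
    _ = ∑ v ∈ words d (L - w.length), S.con (v ++ w) ^ σ :=
        Finset.sum_image fun _ _ _ _ h => List.append_cancel_right h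
    _ ≤ _ := by
        rw [Finset.mul_sum]
        refine Finset.sum_le_sum fun v _ => ?_
        rw [← Real.mul_rpow (con_nonneg _) (con_nonneg _)]
        exact Real.rpow_le_rpow (con_nonneg _)
          ((con_append_le v w).trans_eq (mul_comm _ _)) hσ

/-- Above the dimension of the limit set, the sums of the contraction rates over all words of a
given length decay exponentially. -/
theorem exists_sum_con_le (hd : 2 ≤ d) {σ : ℝ} (hσ : S.delta < σ) :
    ∃ ρ : ℝ, 0 < ρ ∧ ρ < 1 ∧ ∃ C : ℝ, 0 < C ∧ ∀ L, ∑ u ∈ words d L, S.con u ^ σ ≤ C * ρ ^ L := by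
  classical
  have hσ0 : 0 < σ := lt_of_le_of_lt S.delta_nonneg hσ
  obtain ⟨F, hF0, hFsum, hF⟩ := S.exists_countable_cover hd hσ (η := ENNReal.ofReal (1 / 2))
    (by simp)
  obtain ⟨N, M₀, hN⟩ := exists_finite_cover (by omega : 0 < d) F hF
  obtain ⟨M, hM1, hM0, hMF⟩ : ∃ M : ℕ, 1 ≤ M ∧ M₀ ≤ M ∧ ∀ n ∈ N, (F n).length ≤ M :=
    ⟨1 + M₀ + N.sup fun n => (F n).length, by omega, by omega, fun n hn => by
      have := Finset.le_sup (f := fun n => (F n).length) hn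
      omega⟩
  have hsum : ∑ n ∈ N, S.con (F n) ^ σ ≤ 1 / 2 := by
    have h1 : ∑ n ∈ N, ENNReal.ofReal (S.con (F n) ^ σ) ≤ ENNReal.ofReal (1 / 2) :=
      (ENNReal.sum_le_tsum N).trans hFsum
    rw [← ENNReal.ofReal_sum_of_nonneg fun n _ => Real.rpow_nonneg (con_nonneg _) _] at h1
    exact (ENNReal.ofReal_le_ofReal_iff (by norm_num)).1 h1
  set Z : ℕ → ℝ := fun L => ∑ u ∈ words d L, S.con u ^ σ with hZ
  have hZ0 : ∀ L, 0 ≤ Z L := fun L => Finset.sum_nonneg fun _ _ => Real.rpow_nonneg (con_nonneg _) _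
  have hrec : ∀ L, M ≤ L → Z L ≤ ∑ n ∈ N, S.con (F n) ^ σ * Z (L - (F n).length) := by
    intro L hL
    calc Z L ≤ ∑ u ∈ words d L, ∑ n ∈ N, if F n <:+ u then S.con u ^ σ else 0 := by
          refine Finset.sum_le_sum fun u hu => ?_
          have hnn : ∀ n ∈ N, 0 ≤ if F n <:+ u then S.con u ^ σ else 0 := fun n _ => by
            split_ifs
            · exact Real.rpow_nonneg (con_nonneg _) _
            · exact le_rfl
          by_cases hr : Reduced u
          · obtain ⟨n, hn, hs⟩ := hN u hr (by rw [mem_words.1 hu]; omega)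
            refine le_trans ?_ (Finset.single_le_sum hnn hn)
            rw [if_pos hs]
          · rw [con_eq_zero hr, Real.zero_rpow hσ0.ne']
            simp
      _ = ∑ n ∈ N, ∑ u ∈ (words d L).filter (fun u => F n <:+ u), S.con u ^ σ := by
          rw [Finset.sum_comm]
          exact Finset.sum_congr rfl fun n _ => (Finset.sum_filter _ _).symm
      _ ≤ _ := Finset.sum_le_sum fun n _ => S.sum_words_suffix_le hσ0.le L (F n)
  obtain ⟨ρ, hρ0, hρ1, hρM⟩ : ∃ ρ : ℝ, 0 < ρ ∧ ρ < 1 ∧ 1 / 2 ≤ ρ ^ M := by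
    have hMr : (1 : ℝ) ≤ M := by exact_mod_cast hM1
    have h1 : 1 / (2 * M : ℝ) ≤ 1 / 2 := by
      rw [div_le_div_iff₀ (by positivity) (by norm_num)]; linarith
    refine ⟨1 + -(1 / (2 * M : ℝ)), by linarith, by linarith [show 0 < 1 / (2 * M : ℝ) by positivity],
      ?_⟩
    refine le_trans (le_of_eq ?_) (one_add_mul_le_pow (by linarith) M)
    field_simp
    norm_num
  refine ⟨ρ, hρ0, hρ1, 1 + ∑ l ∈ Finset.range M, Z l * (ρ ^ l)⁻¹, ?_, ?_⟩
  · have := Finset.sum_nonneg fun l (_ : l ∈ Finset.range M) =>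
      mul_nonneg (hZ0 l) (inv_nonneg.2 (pow_nonneg hρ0.le l))
    linarith
  set C := 1 + ∑ l ∈ Finset.range M, Z l * (ρ ^ l)⁻¹ with hC
  have hC0 : 0 ≤ C := by
    have := Finset.sum_nonneg fun l (_ : l ∈ Finset.range M) =>
      mul_nonneg (hZ0 l) (inv_nonneg.2 (pow_nonneg hρ0.le l))
    linarith
  intro L
  induction L using Nat.strong_induction_on with
  | _ L ih =>
    rcases lt_or_ge L M with hL | hL
    · rw [← div_le_iff₀ (by positivity), div_eq_mul_inv]
      have := Finset.single_le_sum (f := fun l => Z l * (ρ ^ l)⁻¹)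
        (fun l _ => mul_nonneg (hZ0 l) (inv_nonneg.2 (pow_nonneg hρ0.le l)))
        (Finset.mem_range.2 hL)
      linarith
    · have hstep : ∀ n ∈ N, S.con (F n) ^ σ * Z (L - (F n).length) ≤
          S.con (F n) ^ σ * (C * ρ ^ L * 2) := by
        intro n hn
        refine mul_le_mul_of_nonneg_left ?_ (Real.rpow_nonneg (con_nonneg _) _)
        have hl := List.length_pos_iff.2 (hF0 n)
        refine (ih _ (by omega)).trans ?_
        have h1 : ρ ^ (L - (F n).length) * ρ ^ M ≤ ρ ^ L := by
          rw [← pow_add]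
          exact pow_le_pow_of_le_one hρ0.le hρ1.le (by have := hMF n hn; omega)
        have h2 : 0 ≤ ρ ^ (L - (F n).length) := by positivity
        have h3 : ρ ^ (L - (F n).length) ≤ ρ ^ L * 2 := by nlinarith
        calc C * ρ ^ (L - (F n).length) ≤ C * (ρ ^ L * 2) := mul_le_mul_of_nonneg_left h3 hC0
          _ = _ := by ring
      calc Z L ≤ _ := hrec L hL
        _ ≤ ∑ n ∈ N, S.con (F n) ^ σ * (C * ρ ^ L * 2) := Finset.sum_le_sum hstep
        _ = (∑ n ∈ N, S.con (F n) ^ σ) * (C * ρ ^ L * 2) := by rw [Finset.sum_mul]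
        _ ≤ 1 / 2 * (C * ρ ^ L * 2) := mul_le_mul_of_nonneg_right hsum (by positivity)
        _ = _ := by ring

end SchottkyData

/-! ### The symmetrized contraction rate -/

/-- The inverse word. -/
def inv {d : ℕ} (u : List (Fin (2 * d))) : List (Fin (2 * d)) := (u.map bar).reverse

theorem inv_inv_word {d : ℕ} (u : List (Fin (2 * d))) : inv (inv u) = u := by
  simp [inv, List.map_reverse, Function.comp_def, bar_bar]

theorem inv_append {d : ℕ} (u v : List (Fin (2 * d))) : inv (u ++ v) = inv v ++ inv u := by
  simp [inv]

namespace SchottkyData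
variable {d : ℕ} (S : SchottkyData d)

/-- The contraction rate of a word or its inverse, whichever is larger. -/
noncomputable def scon (u : List (Fin (2 * d))) : ℝ := max (S.con u) (S.con (inv u))

variable {S}

theorem scon_inv (u : List (Fin (2 * d))) : S.scon (inv u) = S.scon u := by
  rw [scon, scon, inv_inv_word, max_comm]

theorem scon_nonneg (u : List (Fin (2 * d))) : 0 ≤ S.scon u :=
  (con_nonneg u).trans (le_max_left _ _)

theorem scon_append_le (u v : List (Fin (2 * d))) : S.scon (u ++ v) ≤ S.scon u * S.scon v := by
  refine max_le ?_ ?_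
  · exact (con_append_le u v).trans (mul_le_mul (le_max_left _ _) (le_max_left _ _)
      (con_nonneg _) (scon_nonneg _))
  · rw [inv_append]
    refine ((con_append_le _ _).trans_eq (mul_comm _ _)).trans ?_
    exact mul_le_mul (le_max_right _ _) (le_max_right _ _) (con_nonneg _) (scon_nonneg _)

variable (S)

theorem exists_scon_le_pow : ∃ θ : ℝ, 0 < θ ∧ θ < 1 ∧ ∀ u, S.scon u ≤ θ ^ u.length := by
  obtain ⟨θ, h0, h1, h⟩ := S.exists_con_le_pow
  refine ⟨θ, h0, h1, fun u => max_le (h u) ?_⟩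
  simpa [inv] using h (inv u)

theorem exists_sum_scon_le (hd : 2 ≤ d) {σ : ℝ} (hσ : S.delta < σ) :
    ∃ ρ : ℝ, 0 < ρ ∧ ρ < 1 ∧ ∃ C : ℝ, 0 < C ∧ ∀ L, ∑ u ∈ words d L, S.scon u ^ σ ≤ C * ρ ^ L := by
  obtain ⟨ρ, h0, h1, C, hC, h⟩ := S.exists_sum_con_le hd hσ
  have hσ0 : 0 < σ := lt_of_le_of_lt S.delta_nonneg hσ
  refine ⟨ρ, h0, h1, 2 * C, by positivity, fun L => ?_⟩
  have hinv : ∑ u ∈ words d L, S.con (inv u) ^ σ = ∑ u ∈ words d L, S.con u ^ σ := by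
    refine Finset.sum_bij' (fun u _ => inv u) (fun u _ => inv u) ?_ ?_ ?_ ?_ ?_
    · intro u hu; rw [mem_words] at hu ⊢; simpa [inv] using hu
    · intro u hu; rw [mem_words] at hu ⊢; simpa [inv] using hu
    · intro u _; exact inv_inv_word u
    · intro u _; exact inv_inv_word u
    · intro u _; rfl
  calc ∑ u ∈ words d L, S.scon u ^ σ
      ≤ ∑ u ∈ words d L, (S.con u ^ σ + S.con (inv u) ^ σ) := by
        refine Finset.sum_le_sum fun u _ => ?_
        have h1 := Real.rpow_nonneg (con_nonneg (S := S) u) σ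
        have h2 := Real.rpow_nonneg (con_nonneg (S := S) (inv u)) σ
        rcases max_cases (S.con u) (S.con (inv u)) with h3 | h3 <;> rw [scon, h3.1] <;> linarith
    _ = 2 * ∑ u ∈ words d L, S.con u ^ σ := by rw [Finset.sum_add_distrib, hinv]; ring
    _ ≤ _ := by have := h L; linarith

end SchottkyData

/-! ### Nuclear bounds -/

section Nuclear

variable {H : Type*} [NormedAddCommGroup H] [InnerProductSpace ℂ H]

/-- `T` has a nuclear representation `T x = ∑ ⟨a k, x⟩ b k` with `∑ ‖a k‖ ‖b k‖ ≤ M`. -/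
def HasNuclearBound (T : H →L[ℂ] H) (M : ℝ) : Prop :=
  ∃ a b : ℕ → H, Summable (fun k => ‖a k‖ * ‖b k‖) ∧ ∑' k, ‖a k‖ * ‖b k‖ ≤ M ∧
    ∀ x : H, HasSum (fun k => ⟪a k, x⟫_ℂ • b k) (T x)

theorem HasNuclearBound.mono {T : H →L[ℂ] H} {M M' : ℝ} (h : HasNuclearBound T M) (hM : M ≤ M') :
    HasNuclearBound T M' := by
  obtain ⟨a, b, h1, h2, h3⟩ := h
  exact ⟨a, b, h1, h2.trans hM, h3⟩

theorem HasNuclearBound.nonneg {T : H →L[ℂ] H} {M : ℝ} (h : HasNuclearBound T M) : 0 ≤ M := by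
  obtain ⟨a, b, h1, h2, h3⟩ := h
  exact (tsum_nonneg fun k => by positivity).trans h2

theorem HasNuclearBound.norm_le {T : H →L[ℂ] H} {M : ℝ} (h : HasNuclearBound T M) : ‖T‖ ≤ M := by
  refine T.opNorm_le_bound h.nonneg fun x => ?_
  obtain ⟨a, b, h1, h2, h3⟩ := h
  have h4 : ∀ k, ‖⟪a k, x⟫_ℂ • b k‖ ≤ ‖a k‖ * ‖b k‖ * ‖x‖ := fun k => by
    rw [norm_smul, mul_right_comm]
    exact mul_le_mul_of_nonneg_right (norm_inner_le_norm _ _) (norm_nonneg _)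
  have h5 := tsum_of_norm_bounded (h1.mul_right ‖x‖).hasSum h4
  rw [(h3 x).tsum_eq, tsum_mul_right] at h5
  exact h5.trans (mul_le_mul_of_nonneg_right h2 (norm_nonneg _))

theorem HasNuclearBound.isTraceClass {T : H →L[ℂ] H} {M : ℝ} (h : HasNuclearBound T M) :
    IsTraceClass T := by
  obtain ⟨a, b, h1, h2, h3⟩ := h
  exact ⟨a, b, h1, h3⟩

variable [CompleteSpace H]

theorem HasNuclearBound.mul_right {T : H →L[ℂ] H} {M : ℝ} (h : HasNuclearBound T M)
    (S : H →L[ℂ] H) : HasNuclearBound (T * S) (M * ‖S‖) := by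
  obtain ⟨a, b, h1, h2, h3⟩ := h
  have h4 : ∀ k, ‖ContinuousLinearMap.adjoint S (a k)‖ * ‖b k‖ ≤ ‖S‖ * (‖a k‖ * ‖b k‖) :=
    fun k => by
      rw [← mul_assoc]
      refine mul_le_mul_of_nonneg_right ?_ (norm_nonneg _)
      refine (ContinuousLinearMap.le_opNorm _ _).trans (le_of_eq ?_)
      rw [LinearIsometryEquiv.norm_map]
  have h5 := Summable.of_nonneg_of_le (fun k => by positivity) h4 (h1.mul_left ‖S‖)
  refine ⟨fun k => ContinuousLinearMap.adjoint S (a k), b, h5, ?_, fun x => ?_⟩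
  · refine (h5.tsum_le_tsum h4 (h1.mul_left ‖S‖)).trans ?_
    rw [tsum_mul_left, mul_comm]
    exact mul_le_mul_of_nonneg_right h2 (norm_nonneg _)
  · simp only [ContinuousLinearMap.adjoint_inner_left]
    exact h3 (S x)

/-- The trace is bounded by the nuclear norm: interchange the two summations and apply Bessel's
inequality. -/
theorem HasNuclearBound.norm_opTrace_le {T : H →L[ℂ] H} {M : ℝ} (h : HasNuclearBound T M) :
    ‖opTrace T‖ ≤ M := by
  have hM := h.nonneg
  obtain ⟨a, b, h1, h2, h3⟩ := h
  unfold opTrace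
  set e := (exists_hilbertBasis ℂ H).choose_spec.choose with he
  have hbessel : ∀ x y : H, ∑' i, ‖⟪x, e i⟫_ℂ‖ₑ * ‖⟪e i, y⟫_ℂ‖ₑ ≤ ‖x‖ₑ * ‖y‖ₑ := by
    intro x y
    rw [ENNReal.tsum_eq_iSup_sum]
    refine iSup_le fun s => ?_
    have h4 := Real.sum_mul_le_sqrt_mul_sqrt s (fun i => ‖⟪x, e i⟫_ℂ‖) (fun i => ‖⟪e i, y⟫_ℂ‖)
    have h5 : ∑ i ∈ s, ‖⟪x, e i⟫_ℂ‖ ^ 2 ≤ ‖x‖ ^ 2 := by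
      simp_rw [norm_inner_symm x]
      exact e.orthonormal.sum_inner_products_le x
    have h6 : ∑ i ∈ s, ‖⟪e i, y⟫_ℂ‖ ^ 2 ≤ ‖y‖ ^ 2 :=
      e.orthonormal.sum_inner_products_le y
    have h7 : ∑ i ∈ s, ‖⟪x, e i⟫_ℂ‖ * ‖⟪e i, y⟫_ℂ‖ ≤ ‖x‖ * ‖y‖ :=
      h4.trans (mul_le_mul (Real.sqrt_le_iff.2 ⟨norm_nonneg _, h5⟩)
        (Real.sqrt_le_iff.2 ⟨norm_nonneg _, h6⟩) (Real.sqrt_nonneg _) (norm_nonneg _))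
    have h8 := ENNReal.ofReal_le_ofReal h7
    rw [ENNReal.ofReal_sum_of_nonneg fun _ _ => by positivity,
      ENNReal.ofReal_mul (norm_nonneg _), ofReal_norm, ofReal_norm] at h8
    refine le_trans (le_of_eq (Finset.sum_congr rfl fun i _ => ?_)) h8
    rw [ENNReal.ofReal_mul (norm_nonneg _), ofReal_norm, ofReal_norm]
  have h9 : ‖∑' i, ⟪e i, T (e i)⟫_ℂ‖ₑ ≤ ENNReal.ofReal M := by
    calc ‖∑' i, ⟪e i, T (e i)⟫_ℂ‖ₑ ≤ ∑' i, ‖⟪e i, T (e i)⟫_ℂ‖ₑ := enorm_tsum_le_tsum_enorm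
      _ ≤ ∑' i, ∑' k, ‖⟪a k, e i⟫_ℂ‖ₑ * ‖⟪e i, b k⟫_ℂ‖ₑ := by
          refine ENNReal.tsum_le_tsum fun i => ?_
          have h10 := (h3 (e i)).mapL (innerSL ℂ (e i))
          rw [innerSL_apply_apply] at h10
          rw [← h10.tsum_eq]
          refine enorm_tsum_le_tsum_enorm.trans (ENNReal.tsum_le_tsum fun k => le_of_eq ?_)
          rw [innerSL_apply_apply, inner_smul_right, enorm_mul]
      _ = ∑' k, ∑' i, ‖⟪a k, e i⟫_ℂ‖ₑ * ‖⟪e i, b k⟫_ℂ‖ₑ := ENNReal.tsum_comm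
      _ ≤ ∑' k, ‖a k‖ₑ * ‖b k‖ₑ := ENNReal.tsum_le_tsum fun k => hbessel _ _
      _ = ENNReal.ofReal (∑' k, ‖a k‖ * ‖b k‖) := by
          rw [ENNReal.ofReal_tsum_of_nonneg (fun k => by positivity) h1]
          refine tsum_congr fun k => ?_
          rw [ENNReal.ofReal_mul (norm_nonneg _), ofReal_norm, ofReal_norm]
      _ ≤ _ := ENNReal.ofReal_le_ofReal h2
  rw [← ofReal_norm] at h9
  exact (ENNReal.ofReal_le_ofReal_iff hM).1 h9

theorem norm_ofFn_prod_le {m : ℕ} (f : Fin m → H →L[ℂ] H) (c : Fin m → ℝ)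
    (h : ∀ k, ‖f k‖ ≤ c k) : ‖(List.ofFn f).prod‖ ≤ ∏ k, c k := by
  induction m with
  | zero =>
    rw [List.ofFn_zero, List.prod_nil, Finset.univ_eq_empty, Finset.prod_empty]
    exact ContinuousLinearMap.norm_id_le
  | succ m ih =>
    rw [List.ofFn_succ, List.prod_cons, Fin.prod_univ_succ]
    exact (norm_mul_le _ _).trans (mul_le_mul (h 0) (ih _ _ fun k => h k.succ) (norm_nonneg _)
      ((norm_nonneg _).trans (h 0)))

/-- A product of operators `T₁ U₁^* T₂ U₂^* ⋯` is nuclear, with the product of the bounds. -/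
theorem hasNuclearBound_ofFn_prod {m : ℕ} (hm : 1 ≤ m) (T U : Fin m → H →L[ℂ] H)
    (a b : Fin m → ℝ) (hT : ∀ k, HasNuclearBound (T k) (a k)) (hU : ∀ k, ‖U k‖ ≤ b k) :
    HasNuclearBound (List.ofFn fun k => T k * ContinuousLinearMap.adjoint (U k)).prod
      (∏ k, a k * b k) := by
  obtain ⟨m, rfl⟩ : ∃ m', m = m' + 1 := ⟨m - 1, by omega⟩
  have hU' : ∀ k, ‖ContinuousLinearMap.adjoint (U k)‖ ≤ b k := fun k => by
    rw [LinearIsometryEquiv.norm_map]; exact hU k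
  rw [List.ofFn_succ, List.prod_cons, Fin.prod_univ_succ, mul_assoc, mul_assoc]
  refine ((hT 0).mul_right _).mono (mul_le_mul_of_nonneg_left ?_ (hT 0).nonneg)
  refine (norm_mul_le _ _).trans (mul_le_mul (hU' 0) ?_ (norm_nonneg _)
    ((norm_nonneg _).trans (hU 0)))
  refine norm_ofFn_prod_le _ _ fun k => (norm_mul_le _ _).trans ?_
  exact mul_le_mul (hT _).norm_le (hU' _) (norm_nonneg _) (hT _).nonneg

end Nuclear

/-! ### Evaluations and Taylor coefficients on Bergman spaces -/

namespace BergmanSpace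

variable {U : Opens ℂ}

/-- The evaluation at a point as a continuous linear functional. -/
theorem exists_eval {x : ℂ} (hx : x ∈ U) :
    ∃ Λ : BergmanSpace U →L[ℂ] ℂ, ∀ f : BergmanSpace U, Λ f = f.toFun x := by
  obtain ⟨C, hC, h⟩ := norm_toFun_le (U := U) (isCompact_singleton (x := x)) (by simpa using hx)
  exact ⟨LinearMap.mkContinuous
    { toFun := fun f => f.toFun x
      map_add' := fun f g => toFun_add f g hx
      map_smul' := fun a f => toFun_smul a f hx } C fun f => h f x rfl, fun f => rfl⟩

theorem norm_le_of_forall_norm_le (hU : volume (U : Set ℂ) < ∞) : ∃ V : ℝ, 0 ≤ V ∧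
    ∀ (f : BergmanSpace U) (M : ℝ), 0 ≤ M → (∀ x ∈ U, ‖f.toFun x‖ ≤ M) → ‖f‖ ≤ V * M := by
  have : IsFiniteMeasure (volume.restrict (U : Set ℂ)) := ⟨by simpa using hU⟩
  refine ⟨(measureUnivNNReal (volume.restrict (U : Set ℂ)) : ℝ) ^ (2 : ℝ≥0∞).toReal⁻¹,
    by positivity, fun f M hM h => ?_⟩
  refine Lp.norm_le_of_ae_bound hM ?_
  filter_upwards [f.coe_ae_eq_toFun, ae_restrict_mem U.isOpen.measurableSet] with z h1 h2
  exact (congrArg norm h1).trans_le (h z h2)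

/-- The monomials, as elements of the Bergman space of a bounded domain. -/
theorem exists_monomial (hU : volume (U : Set ℂ) < ∞) (hb : Bornology.IsBounded (U : Set ℂ)) (c : ℂ)
    (n : ℕ) : ∃ p : BergmanSpace U, EqOn p.toFun (fun z => (z - c) ^ n) U := by
  have : IsFiniteMeasure (volume.restrict (U : Set ℂ)) := ⟨by simpa using hU⟩
  have hdiff : DifferentiableOn ℂ (fun z : ℂ => (z - c) ^ n) U := by fun_prop
  obtain ⟨R, hR⟩ := hb.subset_closedBall c
  have hmem : MemLp (fun z : ℂ => (z - c) ^ n) 2 (volume.restrict (U : Set ℂ)) := by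
    refine MemLp.of_bound (hdiff.continuousOn.aestronglyMeasurable U.isOpen.measurableSet)
      (R ^ n) ((ae_restrict_iff' U.isOpen.measurableSet).2 (Eventually.of_forall fun z hz => ?_))
    rw [norm_pow]
    refine pow_le_pow_left₀ (norm_nonneg _) ?_ n
    simpa [dist_eq_norm] using hR hz
  exact ⟨⟨hmem.toLp _, _, hdiff, hmem.coeFn_toLp⟩, toFun_eqOn _ hdiff hmem.coeFn_toLp⟩

theorem contDiffAt_toFun (f : BergmanSpace U) {c : ℂ} (hc : c ∈ U) {n : WithTop ℕ∞} :
    ContDiffAt ℂ n f.toFun c :=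
  (f.differentiableOn_toFun.analyticAt (U.isOpen.mem_nhds hc)).contDiffAt

/-- The Taylor coefficients are bounded functionals, by Cauchy's estimates. -/
theorem exists_taylor_coeff {K : ℝ} (hK₀ : 0 ≤ K) {c : ℂ} {r : ℝ} (hr : 0 < r) (hrU : closedBall c r ⊆ U)
    (hK : ∀ (f : BergmanSpace U), ∀ z ∈ closedBall c r, ‖f.toFun z‖ ≤ K * ‖f‖) (n : ℕ) :
    ∃ a : BergmanSpace U, ‖a‖ ≤ K / r ^ n ∧ ∀ f : BergmanSpace U,
      ⟪a, f⟫_ℂ = (n.factorial : ℂ)⁻¹ * iteratedDeriv n f.toFun c := by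
  have hc : c ∈ U := hrU (mem_closedBall_self hr.le)
  have hnhds : (U : Set ℂ) ∈ 𝓝 c := U.isOpen.mem_nhds hc
  have hbound : ∀ f : BergmanSpace U,
      ‖(n.factorial : ℂ)⁻¹ * iteratedDeriv n f.toFun c‖ ≤ K / r ^ n * ‖f‖ := by
    intro f
    have h1 := Complex.norm_iteratedDeriv_le_of_forall_mem_sphere_norm_le (f := f.toFun) n hr
      ((f.differentiableOn_toFun.mono (closure_ball_subset_closedBall.trans hrU)).diffContOnCl)
      (fun z hz => hK f z (sphere_subset_closedBall hz))
    rw [norm_mul, norm_inv, Complex.norm_natCast, inv_mul_le_iff₀ (by positivity)]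
    refine h1.trans (le_of_eq ?_)
    ring
  have hK0 : 0 ≤ K / r ^ n := by positivity
  let Λ : BergmanSpace U →L[ℂ] ℂ := LinearMap.mkContinuous
    { toFun := fun f => (n.factorial : ℂ)⁻¹ * iteratedDeriv n f.toFun c
      map_add' := fun f g => by
        have h1 : (f + g).toFun =ᶠ[𝓝 c] f.toFun + g.toFun :=
          Filter.eventuallyEq_of_mem hnhds (toFun_add f g)
        rw [h1.iteratedDeriv_eq n, iteratedDeriv_add (contDiffAt_toFun f hc)
          (contDiffAt_toFun g hc), mul_add]
      map_smul' := fun a f => by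
        have h1 : (a • f).toFun =ᶠ[𝓝 c] a • f.toFun :=
          Filter.eventuallyEq_of_mem hnhds (toFun_smul a f)
        rw [h1.iteratedDeriv_eq n, iteratedDeriv_const_smul (contDiffAt_toFun f hc)]
        simp only [RingHom.id_apply, smul_eq_mul]
        ring } (K / r ^ n) hbound
  refine ⟨(InnerProductSpace.toDual ℂ (BergmanSpace U)).symm Λ, ?_, fun f => ?_⟩
  · rw [LinearIsometryEquiv.norm_map]
    exact LinearMap.mkContinuous_norm_le _ hK0 _
  · rw [InnerProductSpace.toDual_symm_apply]
    rfl

end BergmanSpace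

namespace SchottkyData

variable {d : ℕ} (S : SchottkyData d)

/-! ### The operators along words -/

/-- The holomorphic weight of the operator along a word. -/
noncomputable def cwt (s : ℂ) : List (Fin (2 * d)) → ℂ → ℂ
  | [], _ => 1
  | i :: u, x => S.weight s i x * cwt s u (S.mv i x)

/-- The logarithm of `den u ^ 2` that is real on the real line, as a sum over the letters. -/
noncomputable def lden : List (Fin (2 * d)) → ℂ → ℂ
  | [], _ => 0
  | i :: u, x => Complex.log (S.dn i x ^ 2) + lden u (S.mv i x)

variable {S}

theorem Aword_cons (s : ℂ) (i : Fin (2 * d)) (u : List (Fin (2 * d))) (f : S.Bergman) :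
    S.Aword s (i :: u) f = S.A s i (S.Aword s u f) := by
  simp only [Aword, List.map_cons, List.prod_cons]
  rfl

theorem Aword_toFun_of_mem (s : ℂ) {i : Fin (2 * d)} (u : List (Fin (2 * d))) (f : S.Bergman)
    {x : ℂ} (hx : x ∈ S.disc i) : (S.Aword s (i :: u) f).toFun x = 0 := by
  rw [Aword_cons, A_apply _ _ _ _ (disc_le_discs hx), if_pos hx]

theorem Aword_toFun (s : ℂ) {u : List (Fin (2 * d))} (hu : Reduced u) (f : S.Bergman)
    {x : ℂ} (hx : x ∈ S.discs) (hx' : x ∈ S.dom u) :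
    (S.Aword s u f).toFun x = S.cwt s u x * f.toFun (S.orb u x) := by
  induction u generalizing x with
  | nil => simp [Aword, cwt, orb]
  | cons i u ih =>
    have hi := mem_dom_cons.1 hx'
    rw [Aword_cons, A_apply _ _ _ _ hx, if_neg hi]
    change S.weight s i x * (S.Aword s u f).toFun (S.mv i x) = _
    rw [ih hu.tail (mv_mem_discs hx hi) (adm_subset_dom _ (mv_mem_adm hu hx'))]
    simp only [cwt, orb, mul_assoc]

theorem cwt_eq (s : ℂ) {u : List (Fin (2 * d))} (hu : Reduced u) {x : ℂ} (hx : x ∈ S.dom u) :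
    S.cwt s u x = Complex.exp (-s * S.lden u x) := by
  induction u generalizing x with
  | nil => simp [cwt, lden]
  | cons i u ih =>
    rw [cwt, lden, ih hu.tail (adm_subset_dom _ (mv_mem_adm hu hx)),
      weight_eq s (mem_dom_cons.1 hx), mul_add, Complex.exp_add]
    rfl

theorem lden_re {u : List (Fin (2 * d))} (hu : Reduced u) {x : ℂ} (hx : x ∈ S.dom u) :
    (S.lden u x).re = Real.log (‖S.den u x‖ ^ 2) := by
  induction u generalizing x with
  | nil => simp [lden, den]
  | cons i u ih =>
    have hx1 := adm_subset_dom _ (mv_mem_adm hu hx)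
    have h1 := norm_ne_zero_iff.2 (dn_ne_zero (mem_dom_cons.1 hx))
    have h2 := norm_ne_zero_iff.2 (den_ne_zero hu.tail hx1)
    rw [lden, Complex.add_re, ih hu.tail hx1, Complex.log_re, norm_pow, den, norm_mul, mul_pow,
      Real.log_mul (pow_ne_zero _ h1) (pow_ne_zero _ h2)]

theorem re_mem_cdisc {j : Fin (2 * d)} {x : ℂ} (hx : x ∈ S.cdisc j) : (x.re : ℂ) ∈ S.cdisc j := by
  simp only [cdisc, mem_closedBall, dist_eq_norm] at hx ⊢
  refine le_trans ?_ hx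
  rw [← Complex.ofReal_sub, Complex.norm_real]
  simpa using Complex.abs_re_le_norm (x - S.center j)

theorem mv_im {i : Fin (2 * d)} {x : ℂ} (hx : x ∉ S.disc i) :
    (S.mv i x).im = x.im / ‖S.dn i x‖ ^ 2 := by
  have h0 := dn_ne_zero hx
  have h1 : ‖S.dn i x‖ ^ 2 ≠ 0 := pow_ne_zero _ (norm_ne_zero_iff.2 h0)
  have h2 := mv_mul_dn hx
  have h3 : S.mv i x * (‖S.dn i x‖ ^ 2 : ℝ) =
      ((S.gen (bar i) 0 0 : ℂ) * x + (S.gen (bar i) 0 1 : ℂ)) * star (S.dn i x) := by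
    rw [← h2, mul_assoc]
    congr 1
    simp [Complex.mul_conj, Complex.normSq_eq_norm_sq]
  have h4 := congrArg Complex.im h3
  have hdet := det_gen (S := S) (bar i)
  rw [Complex.im_mul_ofReal] at h4
  rw [eq_div_iff h1, h4]
  simp [dn]
  linear_combination x.im * hdet

variable (S)

/-- On the discs, the imaginary part of `log (dn i x ^ 2)` is at most proportional to that of `x`,
since the function is real on the real line and Lipschitz continuous. -/
theorem exists_log_im_le (hd : 2 ≤ d) : ∃ M : ℝ, 0 ≤ M ∧ ∀ i j, j ≠ i → ∀ x ∈ S.cdisc j,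
    |(Complex.log (S.dn i x ^ 2)).im| ≤ M * |x.im| := by
  obtain ⟨C, hC, hcmp⟩ := S.exists_con_compare hd
  obtain ⟨θ, hθ0, hθ1, hθ⟩ := S.exists_con_le_pow
  obtain ⟨M, hM, hM'⟩ := exists_ge_of_finite fun i => |S.gen i 1 0|
  refine ⟨2 * M * C, by positivity, fun i j hji x hx => ?_⟩
  have hmem : ∀ z ∈ S.cdisc j, z ∈ S.adm [i] := fun z hz =>
    mem_adm_of_mem_cdisc hz (by simpa using hji.symm)
  have hred : Reduced [i] := List.isChain_singleton _
  have hder : ∀ z ∈ S.cdisc j, HasDerivWithinAt (fun z => Complex.log (S.dn i z ^ 2))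
      (2 * S.gen (bar i) 1 0 * S.dn i z / S.dn i z ^ 2) (S.cdisc j) z := by
    intro z hz
    have h1 : HasDerivAt (fun z => S.dn i z ^ 2) (2 * S.gen (bar i) 1 0 * S.dn i z) z := by
      have h2 : HasDerivAt (fun z => S.dn i z) (S.gen (bar i) 1 0 : ℂ) z := by
        simpa [dn] using ((hasDerivAt_id z).const_mul (S.gen (bar i) 1 0 : ℂ)).add_const
          (S.gen (bar i) 1 1 : ℂ)
      refine (h2.pow 2).congr_deriv ?_
      simp
      ring
    exact (h1.clog (sq_mem_slitPlane hji hz)).hasDerivWithinAt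
  have hbd : ∀ z ∈ S.cdisc j,
      ‖2 * (S.gen (bar i) 1 0 : ℂ) * S.dn i z / S.dn i z ^ 2‖ ≤ 2 * M * C := by
    intro z hz
    have h0 := norm_pos_iff.2 (dn_ne_zero (mem_dom_cons.1 (adm_subset_dom _ (hmem z hz))))
    have h1 := (hcmp [i] hred z (hmem z hz)).1
    have h2 : S.con [i] ≤ 1 := (hθ [i]).trans (pow_le_one₀ hθ0.le hθ1.le)
    have h3 : (‖S.dn i z‖ ^ 2)⁻¹ ≤ C := by
      simp only [den, mul_one] at h1
      exact h1.trans (by nlinarith)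
    have h4 : ‖S.dn i z‖⁻¹ ≤ C := by
      rw [← inv_pow] at h3
      nlinarith [sq_nonneg (‖S.dn i z‖⁻¹ - 1), inv_pos.2 h0]
    have h5 : ‖2 * (S.gen (bar i) 1 0 : ℂ) * S.dn i z / S.dn i z ^ 2‖ =
        2 * |S.gen (bar i) 1 0| * ‖S.dn i z‖⁻¹ := by
      rw [norm_div, norm_mul, norm_mul, norm_pow, Complex.norm_real, Real.norm_eq_abs]
      simp
      field_simp
    rw [h5]
    have := hM' (bar i)
    gcongr
  have hconv : Convex ℝ (S.cdisc j) := convex_closedBall _ _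
  have hxr := re_mem_cdisc hx
  have key := hconv.norm_image_sub_le_of_norm_hasDerivWithin_le hder hbd hxr hx
  have him : (Complex.log (S.dn i x.re ^ 2)).im = 0 := by
    have h1 : S.dn i x.re ^ 2 =
        (((S.gen (bar i) 1 0 * x.re + S.gen (bar i) 1 1) ^ 2 : ℝ) : ℂ) := by
      simp [dn]
    rw [h1, Complex.log_im, Complex.arg_ofReal_of_nonneg (sq_nonneg _)]
  have hsub : x - (x.re : ℂ) = x.im * Complex.I := by
    apply Complex.ext <;> simp
  rw [hsub, norm_mul, Complex.norm_I, mul_one, Complex.norm_real, Real.norm_eq_abs] at key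
  refine le_trans ?_ key
  have := Complex.abs_im_le_norm (Complex.log (S.dn i x ^ 2) - Complex.log (S.dn i x.re ^ 2))
  rwa [Complex.sub_im, him, sub_zero] at this

/-- The imaginary part of `lden` is bounded uniformly in the word, because the imaginary parts along
an orbit decay exponentially. -/
theorem exists_lden_im_le (hd : 2 ≤ d) : ∃ B : ℝ, 0 ≤ B ∧ ∀ u, Reduced u → ∀ x ∈ S.discs,
    x ∈ S.dom u → |(S.lden u x).im| ≤ B := by
  obtain ⟨M, hM, hlog⟩ := S.exists_log_im_le hd
  obtain ⟨θ, hθ0, hθ1, hθ⟩ := S.exists_step_le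
  obtain ⟨R, hR, hrad, -, hb, -⟩ := S.exists_bounds
  obtain ⟨c, hc, hQ⟩ := S.exists_Q_orb_ge
  have hR0 : 0 < R := by linarith
  have h1θ : 0 < 1 - θ := by linarith
  have him : ∀ x ∈ S.discs, |x.im| ≤ R := fun x hx => by
    obtain ⟨j, hj⟩ := Set.mem_iUnion.1 hx
    exact (Complex.abs_im_le_norm x).trans (hb j x (disc_subset_cdisc j hj))
  have hloga : ∀ i, ∀ x ∈ S.discs, x ∉ S.disc i →
      |(Complex.log (S.dn i x ^ 2)).im| ≤ M * |x.im| := by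
    intro i x hx hi
    obtain ⟨j, hj⟩ := Set.mem_iUnion.1 hx
    exact hlog i j (by rintro rfl; exact hi hj) x (disc_subset_cdisc j hj)
  have key : ∀ u, Reduced u → ∀ x ∈ S.discs, x ∈ S.dom u →
      |(S.lden u x).im| ≤ M * R * (|x.im| / S.Q x) / (1 - θ) := by
    intro u
    induction u with
    | nil =>
      intro _ x _ _
      simp only [lden, Complex.zero_im, abs_zero]
      have := Q_nonneg (S := S) x
      positivity
    | cons i u ih =>
      intro hu x hx hx'
      have hi := mem_dom_cons.1 hx'
      have hx1 := mv_mem_discs hx hi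
      have h1 := ih hu.tail _ hx1 (adm_subset_dom _ (mv_mem_adm hu hx'))
      obtain ⟨j, hj⟩ := Set.mem_iUnion.1 hx
      obtain ⟨k, hk⟩ := Set.mem_iUnion.1 hx1
      have hQx := Q_pos hj
      have hQx1 := Q_pos hk
      have hQR : S.Q x ≤ R := Q_le hrad (disc_subset_cdisc j hj)
      have hdn := norm_pos_iff.2 (dn_ne_zero hi)
      have h2 : |(S.mv i x).im| / S.Q (S.mv i x) ≤ θ * (|x.im| / S.Q x) := by
        have h3 := hθ i x hx
        rw [step, if_neg hi] at h3
        have h4 : |(S.mv i x).im| / S.Q (S.mv i x) =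
            S.Q x / (S.Q (S.mv i x) * ‖S.dn i x‖ ^ 2) * (|x.im| / S.Q x) := by
          rw [mv_im hi, abs_div, abs_of_pos (show 0 < ‖S.dn i x‖ ^ 2 by positivity)]
          field_simp
        rw [h4]
        exact mul_le_mul_of_nonneg_right h3 (by positivity)
      have h5 : M * |x.im| ≤ M * R * (|x.im| / S.Q x) := by
        rw [mul_assoc]
        refine mul_le_mul_of_nonneg_left ?_ hM
        rw [mul_div_assoc', le_div_iff₀ hQx, mul_comm]
        exact mul_le_mul_of_nonneg_right hQR (abs_nonneg _)
      rw [lden, Complex.add_im]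
      refine (abs_add_le _ _).trans ?_
      rw [le_div_iff₀ h1θ] at h1 ⊢
      have h6 := hloga i x hx hi
      have h7 : M * R * (|(S.mv i x).im| / S.Q (S.mv i x)) ≤
          M * R * (θ * (|x.im| / S.Q x)) := mul_le_mul_of_nonneg_left h2 (by positivity)
      nlinarith
  refine ⟨M * R + M * R * (R / c) / (1 - θ), by positivity, fun u hu x hx hx' => ?_⟩
  cases u with
  | nil =>
    simp only [lden, Complex.zero_im, abs_zero]
    positivity
  | cons i u =>
    have hi := mem_dom_cons.1 hx'
    have hx1 := mv_mem_discs hx hi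
    rw [lden, Complex.add_im]
    refine (abs_add_le _ _).trans (add_le_add ?_ ?_)
    · exact (hloga i x hx hi).trans (mul_le_mul_of_nonneg_left (him x hx) hM)
    · refine (key u hu.tail _ hx1 (adm_subset_dom _ (mv_mem_adm hu hx'))).trans ?_
      have hQ1 : c ≤ S.Q (S.mv i x) := by
        obtain ⟨j, hj⟩ := Set.mem_iUnion.1 hx
        refine hQ i [] (List.isChain_singleton _) x (mem_adm_of_mem_cdisc
          (disc_subset_cdisc j hj) ?_)
        simp
        rintro rfl
        exact hi hj
      have := him _ hx1
      gcongr

/-- The weights along words are bounded by powers of the contraction rate, uniformly for bounded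
parameters. -/
theorem exists_cwt_le (hd : 2 ≤ d) (T : ℝ) : ∃ C : ℝ, 0 ≤ C ∧ ∀ s : ℂ, 0 ≤ s.re → ‖s‖ ≤ T →
    ∀ u, Reduced u → ∀ x ∈ S.discs, x ∈ S.dom u → ‖S.cwt s u x‖ ≤ C * S.con u ^ s.re := by
  obtain ⟨B, hB, him⟩ := S.exists_lden_im_le hd
  obtain ⟨C, hC, hcmp⟩ := S.exists_con_compare hd
  refine ⟨Real.exp (T * B) * C ^ T, by positivity, fun s hs hT u hu x hx hx' => ?_⟩
  have hsT : s.re ≤ T := (Complex.re_le_norm s).trans hT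
  have hadm : x ∈ S.adm u := by
    obtain ⟨j, hj⟩ := Set.mem_iUnion.1 hx
    refine mem_adm_of_mem_cdisc (disc_subset_cdisc j hj) fun i hi => ?_
    rintro rfl
    exact hx' i hi hj
  have hden := norm_pos_iff.2 (den_ne_zero hu hx')
  rw [cwt_eq s hu hx', Complex.norm_exp]
  have h1 : (-s * S.lden u x).re =
      -s.re * Real.log (‖S.den u x‖ ^ 2) + s.im * (S.lden u x).im := by
    rw [← lden_re hu hx', Complex.mul_re]
    simp
  have h2 : s.im * (S.lden u x).im ≤ T * B := by
    refine (le_abs_self _).trans ?_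
    rw [abs_mul]
    exact mul_le_mul ((Complex.abs_im_le_norm s).trans hT) (him u hu x hx hx') (abs_nonneg _)
      ((norm_nonneg s).trans hT)
  have h3 : Real.exp (-s.re * Real.log (‖S.den u x‖ ^ 2)) = (‖S.den u x‖ ^ 2)⁻¹ ^ s.re := by
    rw [Real.rpow_def_of_pos (by positivity), Real.log_inv]
    congr 1
    ring
  rw [h1, Real.exp_add, h3, mul_comm]
  have hc := con_nonneg (S := S) u
  calc Real.exp (s.im * (S.lden u x).im) * (‖S.den u x‖ ^ 2)⁻¹ ^ s.re
      ≤ Real.exp (T * B) * (C * S.con u) ^ s.re := by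
        refine mul_le_mul (Real.exp_le_exp.2 h2) ?_ (by positivity) (by positivity)
        exact Real.rpow_le_rpow (by positivity) (hcmp u hu x hadm).1 hs
    _ = Real.exp (T * B) * (C ^ s.re * S.con u ^ s.re) := by
        rw [Real.mul_rpow (by linarith) hc]
    _ ≤ Real.exp (T * B) * (C ^ T * S.con u ^ s.re) := by
        have := Real.rpow_le_rpow_of_exponent_le hC hsT
        have := Real.rpow_nonneg hc s.re
        gcongr
    _ = _ := by ring

theorem volume_discs_lt_top : volume (S.discs : Set ℂ) < ∞ := by
  refine lt_of_le_of_lt (measure_iUnion_le _) ?_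
  rw [tsum_fintype]
  exact ENNReal.sum_lt_top.2 fun j _ => measure_ball_lt_top

theorem isBounded_discs : Bornology.IsBounded (S.discs : Set ℂ) :=
  Bornology.isBounded_iUnion.2 fun _ => isBounded_ball

/-- The operators along nonempty reduced words are nuclear, with nuclear norm of the order of a
power of the contraction rate. In the representation, a function is expanded into its Taylor series
at the center of the disc that contains the image of the word. -/
theorem exists_hasNuclearBound_Aword (hd : 2 ≤ d) (T : ℝ) : ∃ C : ℝ, 0 ≤ C ∧ ∀ s : ℂ, 0 ≤ s.re →
    ‖s‖ ≤ T → ∀ u, u ≠ [] → Reduced u → HasNuclearBound (S.Aword s u) (C * S.con u ^ s.re) := by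
  obtain ⟨W, hW0, hW⟩ := S.exists_cwt_le hd T
  obtain ⟨R, hR, hrad, -, -, -⟩ := S.exists_bounds
  obtain ⟨c, hc, hQ⟩ := S.exists_Q_orb_ge
  obtain ⟨V, hV0, hV⟩ := BergmanSpace.norm_le_of_forall_norm_le S.volume_discs_lt_top
  have hR0 : 0 < R := by linarith
  obtain ⟨ε, hε0, hε1, hε⟩ : ∃ ε : ℝ, 0 < ε ∧ ε ≤ 1 ∧ ε ≤ c / R :=
    ⟨min 1 (c / R), lt_min one_pos (by positivity), min_le_left _ _, min_le_right _ _⟩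
  obtain ⟨η, hη⟩ : ∃ η : ℝ, η = 1 - ε / 2 := ⟨_, rfl⟩
  obtain ⟨η', hη'⟩ : ∃ η' : ℝ, η' = 1 - ε / 4 := ⟨_, rfl⟩
  have hη0 : 0 < η := by linarith
  have hηη' : η < η' := by linarith
  have hη'1 : η' < 1 := by linarith
  have hη'0 : 0 < η' := by linarith
  obtain ⟨K, hK0, hK⟩ := BergmanSpace.norm_toFun_le (U := S.discs)
    (K := ⋃ k, closedBall (S.center k : ℂ) (η' * S.radius k))
    (isCompact_iUnion fun _ => isCompact_closedBall _ _)
    (Set.iUnion_mono fun k => closedBall_subset_ball (by nlinarith [S.radius_pos k]))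
  have hq0 : 0 ≤ η / η' := by positivity
  have hq1 : η / η' < 1 := (div_lt_one hη'0).2 hηη'
  have h1q : 0 < 1 - η / η' := by linarith
  refine ⟨K * (V * W) * (1 - η / η')⁻¹, by positivity, ?_⟩
  intro s hs hsT u hu0 hu
  obtain ⟨i, u, rfl⟩ : ∃ i v, u = i :: v := List.exists_cons_of_ne_nil hu0
  obtain ⟨k, hk⟩ := exists_orb_mem_cdisc (S := S) hu
  have hrk := S.radius_pos k
  have hcon := Real.rpow_nonneg (con_nonneg (S := S) (i :: u)) s.re
  -- the image of the word lies in a smaller disc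
  have horb : ∀ x ∈ S.discs, x ∉ S.disc i →
      ‖S.orb (i :: u) x - S.center k‖ ≤ η * S.radius k := by
    intro x hx hi
    obtain ⟨j, hj⟩ := Set.mem_iUnion.1 hx
    have hadm : x ∈ S.adm (i :: u) := mem_adm_of_mem_cdisc (disc_subset_cdisc j hj) (by
      simp; rintro rfl; exact hi hj)
    have h1 := hQ i u hu x hadm
    rw [Q_eq (hk x (mem_dom_cons.2 hi)), le_div_iff₀ hrk] at h1
    have h2 : ε * S.radius k ≤ c := by
      rw [le_div_iff₀ hR0] at hε
      nlinarith [hrad k]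
    refine (pow_le_pow_iff_left₀ (norm_nonneg _) (by positivity) two_ne_zero).1 ?_
    rw [hη]
    nlinarith [sq_nonneg (ε * S.radius k)]
  have hr' : 0 < η' * S.radius k := by positivity
  have hball : closedBall (S.center k : ℂ) (η' * S.radius k) ⊆ S.discs :=
    (closedBall_subset_ball (by nlinarith)).trans (fun x hx => disc_le_discs (j := k) hx)
  choose a ha ha' using fun n => BergmanSpace.exists_taylor_coeff (U := S.discs) hK0 hr' hball
    (fun f z hz => hK f z (Set.mem_iUnion.2 ⟨k, hz⟩)) n
  choose p hp using fun n => BergmanSpace.exists_monomial (U := S.discs) S.volume_discs_lt_top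
    S.isBounded_discs (S.center k) n
  have hb : ∀ n, ‖S.Aword s (i :: u) (p n)‖ ≤
      V * (W * S.con (i :: u) ^ s.re * (η * S.radius k) ^ n) := by
    intro n
    refine hV _ _ (by positivity) fun x hx => ?_
    by_cases hi : x ∈ S.disc i
    · rw [Aword_toFun_of_mem s u _ hi, norm_zero]
      positivity
    · have hx' : x ∈ S.dom (i :: u) := mem_dom_cons.2 hi
      have hox : S.orb (i :: u) x ∈ S.discs := by
        have h1 := horb x hx hi
        refine disc_le_discs (j := k) ?_
        rw [disc, mem_ball, dist_eq_norm]
        nlinarith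
      rw [Aword_toFun s hu _ hx hx', norm_mul, hp n hox, norm_pow]
      exact mul_le_mul (hW s hs hsT _ hu x hx hx')
        (pow_le_pow_left₀ (norm_nonneg _) (horb x hx hi) n) (by positivity) (by positivity)
  have hab : ∀ n, ‖a n‖ * ‖S.Aword s (i :: u) (p n)‖ ≤
      K * (V * W) * S.con (i :: u) ^ s.re * (η / η') ^ n := by
    intro n
    refine (mul_le_mul (ha n) (hb n) (norm_nonneg _) (by positivity)).trans (le_of_eq ?_)
    rw [div_pow, mul_pow, mul_pow]
    have : S.radius k ^ n ≠ 0 := pow_ne_zero _ hrk.ne'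
    field_simp
  have hgeo := (summable_geometric_of_lt_one hq0 hq1).mul_left
    (K * (V * W) * S.con (i :: u) ^ s.re)
  have hsum := Summable.of_nonneg_of_le (fun n => by positivity) hab hgeo
  refine ⟨a, fun n => S.Aword s (i :: u) (p n), hsum, ?_, fun f => ?_⟩
  · refine (hsum.tsum_le_tsum hab hgeo).trans (le_of_eq ?_)
    rw [tsum_mul_left, tsum_geometric_of_lt_one hq0 hq1]
    ring
  · have hsf : Summable fun n => ⟪a n, f⟫_ℂ • S.Aword s (i :: u) (p n) := by
      refine Summable.of_norm_bounded (hsum.mul_right ‖f‖) fun n => ?_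
      rw [norm_smul, mul_right_comm]
      exact mul_le_mul_of_nonneg_right (norm_inner_le_norm (𝕜 := ℂ) (a n) f) (norm_nonneg _)
    obtain ⟨g, hg⟩ := hsf
    have hgf : g = S.Aword s (i :: u) f := by
      refine BergmanSpace.ext_toFun fun x hx => ?_
      obtain ⟨Λ, hΛ⟩ := BergmanSpace.exists_eval (U := S.discs) hx
      have h1 : HasSum (fun n => (n.factorial : ℂ)⁻¹ * iteratedDeriv n f.toFun (S.center k) *
          (S.Aword s (i :: u) (p n)).toFun x) (g.toFun x) := by
        rw [← hΛ g]
        refine (hg.mapL Λ).congr_fun fun n => ?_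
        rw [Λ.map_smul, hΛ, ha', smul_eq_mul]
      refine h1.unique ?_
      by_cases hi : x ∈ S.disc i
      · simp only [Aword_toFun_of_mem s u _ hi, mul_zero]
        exact hasSum_zero
      · have hx' : x ∈ S.dom (i :: u) := mem_dom_cons.2 hi
        have hox : S.orb (i :: u) x ∈ ball (S.center k : ℂ) (S.radius k) := by
          have h1 := horb x hx hi
          rw [mem_ball, dist_eq_norm]
          nlinarith
        have hox' : S.orb (i :: u) x ∈ S.discs := disc_le_discs (j := k) hox
        simp only [Aword_toFun s hu _ hx hx']
        have h2 := (Complex.hasSum_taylorSeries_on_ball (f.differentiableOn_toFun.mono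
          (fun z hz => disc_le_discs (j := k) hz)) hox).mul_left (S.cwt s (i :: u) x)
        refine h2.congr_fun fun n => ?_
        rw [hp n hox']
        simp only [smul_eq_mul]
        ring
    rw [← hgf]
    exact hg

end SchottkyData

/-! ### Cutting an interval -/

/-- The first element of `P` after `s`. -/
noncomputable def nextCut (P : ℕ → Prop) (s : ℕ) : ℕ := sInf {t | s < t ∧ P t}

section nextCut

variable {P : ℕ → Prop} {ℓ s : ℕ}

theorem nextCut_spec (hℓ : P ℓ) (hs : s < ℓ) :
    s < nextCut P s ∧ P (nextCut P s) ∧ nextCut P s ≤ ℓ :=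
  have h : nextCut P s ∈ {t | s < t ∧ P t} := Nat.sInf_mem ⟨ℓ, hs, hℓ⟩
  ⟨h.1, h.2, Nat.sInf_le ⟨hs, hℓ⟩⟩

theorem not_of_lt_nextCut {t : ℕ} (h1 : s < t) (h2 : t < nextCut P s) : ¬ P t :=
  fun h => Nat.notMem_of_lt_sInf h2 ⟨h1, h⟩

theorem nextCut_eq {e : ℕ} (he : s < e) (hP : P e) (h : ∀ t, s < t → t < e → ¬ P t) :
    nextCut P s = e := by
  refine le_antisymm (Nat.sInf_le ⟨he, hP⟩) (le_csInf ⟨e, he, hP⟩ ?_)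
  rintro t ⟨h1, h2⟩
  by_contra hlt
  exact h t h1 (not_le.1 hlt) h2

theorem exists_cut_le (h0 : P 0) (t : ℕ) : ∃ s ≤ t, P s ∧ ∀ u, s < u → u ≤ t → ¬ P u := by
  classical
  refine ⟨Nat.findGreatest P t, Nat.findGreatest_le t, Nat.findGreatest_spec (Nat.zero_le t) h0,
    fun u h1 h2 => Nat.findGreatest_is_greatest h1 h2⟩

theorem filter_Ico_eq_insert [DecidablePred P] (hℓ : P ℓ) (hs : s < ℓ) (hP : P s) :
    (Finset.Ico s ℓ).filter P = insert s ((Finset.Ico (nextCut P s) ℓ).filter P) := by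
  obtain ⟨h1, h2, h3⟩ := nextCut_spec hℓ hs
  ext t
  simp only [Finset.mem_filter, Finset.mem_Ico, Finset.mem_insert]
  constructor
  · rintro ⟨⟨h4, h5⟩, h6⟩
    rcases h4.eq_or_lt with h7 | h7
    · exact Or.inl h7.symm
    · refine Or.inr ⟨⟨?_, h5⟩, h6⟩
      by_contra h8
      exact not_of_lt_nextCut h7 (not_le.1 h8) h6
  · rintro (rfl | ⟨⟨h4, h5⟩, h6⟩)
    · exact ⟨⟨le_rfl, hs⟩, hP⟩
    · exact ⟨⟨by omega, h5⟩, h6⟩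

/-- A submultiplicative quantity is bounded by the product over the pieces of a subdivision. -/
theorem le_prod_cuts {α : Type*} (φ : List α → ℝ) (h0 : ∀ u, 0 ≤ φ u) (h1 : φ [] ≤ 1)
    (hφ : ∀ u v, φ (u ++ v) ≤ φ u * φ v) (c : ℕ → α) [DecidablePred P] (hℓ : P ℓ) (hsℓ : s ≤ ℓ)
    (hs : P s) : φ ((List.Ico s ℓ).map c) ≤
      ∏ t ∈ (Finset.Ico s ℓ).filter P, φ ((List.Ico t (nextCut P t)).map c) := by
  induction hk : ℓ - s using Nat.strong_induction_on generalizing s with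
  | _ k ih =>
    rcases hsℓ.eq_or_lt with rfl | hlt
    · simpa using h1
    · obtain ⟨h2, h3, h4⟩ := nextCut_spec hℓ hlt
      rw [filter_Ico_eq_insert hℓ hlt hs, Finset.prod_insert (by simp; intro h; omega),
        ← List.Ico.append_consecutive h2.le h4, List.map_append]
      exact (hφ _ _).trans (mul_le_mul_of_nonneg_left
        (ih (ℓ - nextCut P s) (by omega) h4 h3 rfl) (h0 _))

theorem sum_cuts [DecidablePred P] (hℓ : P ℓ) (hsℓ : s ≤ ℓ) (hs : P s) :
    ∑ t ∈ (Finset.Ico s ℓ).filter P, (nextCut P t - t) = ℓ - s := by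
  induction hk : ℓ - s using Nat.strong_induction_on generalizing s with
  | _ k ih =>
    rcases hsℓ.eq_or_lt with rfl | hlt
    · simp at hk
      simp [← hk]
    · obtain ⟨h2, h3, h4⟩ := nextCut_spec hℓ hlt
      rw [filter_Ico_eq_insert hℓ hlt hs, Finset.sum_insert (by simp; intro h; omega),
        ih (ℓ - nextCut P s) (by omega) h4 h3 rfl]
      omega

end nextCut

/-! ### Families of non-backtracking walks -/

theorem revEdge_injective {n d : ℕ} :
    Function.Injective (revEdge : Fin n × Fin (2 * d) × Fin n → _) :=
  Function.LeftInverse.injective revEdge_revEdge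

theorem coloredEdge_mk_eq_iff {n d : ℕ} {a b : Fin n × Fin (2 * d) × Fin n} :
    ColoredEdge.mk a.1 a.2.1 a.2.2 = ColoredEdge.mk b.1 b.2.1 b.2.2 ↔ a = b ∨ a = revEdge b := by
  constructor
  · intro h
    rcases Quotient.exact h with h | h
    · exact Or.inl h.symm
    · right
      change b = revEdge a at h
      rw [h, revEdge_revEdge]
  · rintro (h | h)
    · rw [h]
    · refine Quotient.sound ?_
      change b = a ∨ b = revEdge a
      right
      rw [h, revEdge_revEdge]

/-- A family of non-backtracking colored walks of length `ℓ`: `x j t` are the vertices and `c j t` the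
colors of the edges, with arbitrary values for `t` out of range. -/
structure Walks (n d ℓ : ℕ) (J : Type*) where
  x : J → ℕ → Fin n
  c : J → ℕ → Fin (2 * d)
  nb : ∀ j t, t + 1 < ℓ → c j t ≠ bar (c j (t + 1))

namespace Walks

variable {n d ℓ : ℕ} {J : Type*} (w : Walks n d ℓ J)

/-- The oriented edge traversed at time `t`. -/
def dart (j : J) (t : ℕ) : Fin n × Fin (2 * d) × Fin n := (w.x j t, w.c j t, w.x j (t + 1))

open Classical in
/-- All orientations of all traversed edges. -/
noncomputable def darts : Finset (Fin n × Fin (2 * d) × Fin n) :=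
  Finset.univ.filter fun a => ∃ j, ∃ t < ℓ, a = w.dart j t ∨ a = revEdge (w.dart j t)

open Classical in
/-- The oriented edges that start in `y`. -/
noncomputable def out (y : Fin n) : Finset (Fin n × Fin (2 * d) × Fin n) :=
  w.darts.filter fun a => a.1 = y

/-- The vertices where walks are cut: the endpoints of walks and the vertices of degree at least
three. -/
def IsBranch (y : Fin n) : Prop := (∃ j, y = w.x j 0 ∨ y = w.x j ℓ) ∨ 3 ≤ (w.out y).card

/-- The end of the segment that starts at time `s`. -/
noncomputable def nx (j : J) (s : ℕ) : ℕ := nextCut (fun t => w.IsBranch (w.x j t)) s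

variable {w}

theorem mem_darts {a : Fin n × Fin (2 * d) × Fin n} :
    a ∈ w.darts ↔ ∃ j, ∃ t < ℓ, a = w.dart j t ∨ a = revEdge (w.dart j t) := by
  simp [darts]

theorem mem_out {y : Fin n} {a : Fin n × Fin (2 * d) × Fin n} :
    a ∈ w.out y ↔ a ∈ w.darts ∧ a.1 = y := by
  simp [out]

theorem dart_mem {j : J} {t : ℕ} (ht : t < ℓ) : w.dart j t ∈ w.darts :=
  mem_darts.2 ⟨j, t, ht, Or.inl rfl⟩

theorem revEdge_dart_mem {j : J} {t : ℕ} (ht : t < ℓ) : revEdge (w.dart j t) ∈ w.darts :=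
  mem_darts.2 ⟨j, t, ht, Or.inr rfl⟩

theorem isBranch_zero (j : J) : w.IsBranch (w.x j 0) := Or.inl ⟨j, Or.inl rfl⟩

theorem isBranch_last (j : J) : w.IsBranch (w.x j ℓ) := Or.inl ⟨j, Or.inr rfl⟩

theorem ne_zero_of_not_isBranch {j : J} {t : ℕ} (h : ¬ w.IsBranch (w.x j t)) : t ≠ 0 := by
  rintro rfl; exact h (isBranch_zero j)

theorem ne_last_of_not_isBranch {j : J} {t : ℕ} (h : ¬ w.IsBranch (w.x j t)) : t ≠ ℓ := by
  rintro rfl; exact h (isBranch_last j)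

theorem dart_succ_ne_rev {j : J} {t : ℕ} (ht : t + 1 < ℓ) :
    revEdge (w.dart j t) ≠ w.dart j (t + 1) := by
  intro h
  refine w.nb j t ht ?_
  have := congrArg (fun a => a.2.1) h
  simp only [revEdge, dart] at this
  rw [← this, bar_bar]

/-- At a vertex that is not a branch vertex there is only one way to continue. -/
theorem eq_or_eq_of_not_isBranch {j : J} {t : ℕ} (ht : t + 1 < ℓ)
    (hB : ¬ w.IsBranch (w.x j (t + 1))) {a : Fin n × Fin (2 * d) × Fin n} (ha : a ∈ w.darts)
    (hay : a.1 = w.x j (t + 1)) : a = revEdge (w.dart j t) ∨ a = w.dart j (t + 1) := by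
  classical
  have hsub : {revEdge (w.dart j t), w.dart j (t + 1)} ⊆ w.out (w.x j (t + 1)) := by
    intro b hb
    rw [Finset.mem_insert, Finset.mem_singleton] at hb
    rcases hb with rfl | rfl
    · exact Finset.mem_filter.2 ⟨revEdge_dart_mem (by omega), rfl⟩
    · exact Finset.mem_filter.2 ⟨dart_mem ht, rfl⟩
  have hcard : (w.out (w.x j (t + 1))).card ≤
      ({revEdge (w.dart j t), w.dart j (t + 1)} : Finset _).card := by
    rw [Finset.card_pair (dart_succ_ne_rev ht)]
    have : ¬ 3 ≤ (w.out (w.x j (t + 1))).card := fun h => hB (Or.inr h)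
    omega
  have hmem : a ∈ w.out (w.x j (t + 1)) := Finset.mem_filter.2 ⟨ha, hay⟩
  rw [← Finset.eq_of_subset_of_card_le hsub hcard] at hmem
  simpa using hmem

theorem dart_succ_eq {j j' : J} {t t' : ℕ} (ht : t < ℓ) (ht' : t' < ℓ)
    (h : w.dart j t = w.dart j' t') (hB : ¬ w.IsBranch (w.x j (t + 1))) :
    t + 1 < ℓ ∧ t' + 1 < ℓ ∧ w.dart j (t + 1) = w.dart j' (t' + 1) := by
  have hx : w.x j (t + 1) = w.x j' (t' + 1) := congrArg (fun a => a.2.2) h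
  have h1 := ne_last_of_not_isBranch hB
  have h2 := ne_last_of_not_isBranch (hx ▸ hB)
  have ht1 : t + 1 < ℓ := by omega
  have ht2 : t' + 1 < ℓ := by omega
  refine ⟨ht1, ht2, ?_⟩
  rcases eq_or_eq_of_not_isBranch ht1 hB (dart_mem (j := j') ht2) hx.symm with h3 | h3
  · rw [h] at h3
    exact absurd h3.symm (dart_succ_ne_rev ht2)
  · exact h3.symm

theorem dart_succ_eq_rev {j j' : J} {t t' : ℕ} (ht : t < ℓ) (ht' : t' < ℓ)
    (h : w.dart j t = revEdge (w.dart j' t')) (hB : ¬ w.IsBranch (w.x j (t + 1))) :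
    t + 1 < ℓ ∧ 0 < t' ∧ w.dart j (t + 1) = revEdge (w.dart j' (t' - 1)) := by
  have hx : w.x j (t + 1) = w.x j' t' := congrArg (fun a => a.2.2) h
  have h1 := ne_last_of_not_isBranch hB
  have h2 := ne_zero_of_not_isBranch (hx ▸ hB)
  have ht1 : t + 1 < ℓ := by omega
  obtain ⟨t', rfl⟩ : ∃ u, t' = u + 1 := ⟨t' - 1, by omega⟩
  refine ⟨ht1, by omega, ?_⟩
  rw [Nat.add_sub_cancel]
  rcases eq_or_eq_of_not_isBranch ht1 hB (revEdge_dart_mem (j := j') (t := t') (by omega))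
    hx.symm with h3 | h3
  · rw [h, revEdge_revEdge] at h3
    exact absurd h3 (dart_succ_ne_rev ht')
  · exact h3.symm

theorem dart_pred_eq {j j' : J} {t t' : ℕ} (ht : t < ℓ) (ht' : t' < ℓ)
    (h : w.dart j t = w.dart j' t') (hB : ¬ w.IsBranch (w.x j t)) :
    0 < t ∧ 0 < t' ∧ w.dart j (t - 1) = w.dart j' (t' - 1) := by
  have hx : w.x j t = w.x j' t' := congrArg (fun a => a.1) h
  have h1 := ne_zero_of_not_isBranch hB
  have h2 := ne_zero_of_not_isBranch (hx ▸ hB)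
  obtain ⟨t, rfl⟩ : ∃ u, t = u + 1 := ⟨t - 1, by omega⟩
  obtain ⟨t', rfl⟩ : ∃ u, t' = u + 1 := ⟨t' - 1, by omega⟩
  refine ⟨by omega, by omega, ?_⟩
  rw [Nat.add_sub_cancel, Nat.add_sub_cancel]
  rcases eq_or_eq_of_not_isBranch ht hB (revEdge_dart_mem (j := j') (t := t') (by omega))
    hx.symm with h3 | h3
  · exact (revEdge_injective h3).symm
  · rw [h] at h3
    exact absurd h3 (dart_succ_ne_rev ht')

theorem nx_spec {j : J} {s : ℕ} (hs : s < ℓ) :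
    s < w.nx j s ∧ w.IsBranch (w.x j (w.nx j s)) ∧ w.nx j s ≤ ℓ :=
  nextCut_spec (isBranch_last j) hs

theorem not_isBranch_of_lt {j : J} {s t : ℕ} (h1 : s < t) (h2 : t < w.nx j s) :
    ¬ w.IsBranch (w.x j t) := not_of_lt_nextCut (P := fun t => w.IsBranch (w.x j t)) h1 h2

/-- Segments with the same first oriented edge coincide. -/
theorem segment_eq {j j' : J} {s s' : ℕ} (hs : s < ℓ) (hs' : s' < ℓ)
    (h : w.dart j s = w.dart j' s') : w.nx j s - s = w.nx j' s' - s' ∧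
      ∀ u < w.nx j s - s, w.dart j (s + u) = w.dart j' (s' + u) := by
  obtain ⟨h1, h2, h3⟩ := nx_spec (w := w) (j := j) hs
  have key : ∀ u < w.nx j s - s, s' + u < ℓ ∧ w.dart j (s + u) = w.dart j' (s' + u) := by
    intro u
    induction u with
    | zero => exact fun _ => ⟨hs', h⟩
    | succ u ih =>
      intro hu
      obtain ⟨h4, h5⟩ := ih (by omega)
      have h6 := dart_succ_eq (by omega) h4 h5 (not_isBranch_of_lt (s := s) (by omega) (by omega))
      exact ⟨h6.2.1, h6.2.2⟩
  refine ⟨?_, fun u hu => (key u hu).2⟩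
  have hnx : w.nx j' s' = s' + (w.nx j s - s) := by
    refine nextCut_eq (by omega) ?_ fun t ht1 ht2 => ?_
    · obtain ⟨-, h5⟩ := key (w.nx j s - s - 1) (by omega)
      have h6 : w.x j (s + (w.nx j s - s - 1) + 1) = w.x j' (s' + (w.nx j s - s - 1) + 1) :=
        congrArg (fun a => a.2.2) h5
      rw [show s + (w.nx j s - s - 1) + 1 = w.nx j s by omega,
        show s' + (w.nx j s - s - 1) + 1 = s' + (w.nx j s - s) by omega] at h6
      rwa [← h6]
    · obtain ⟨-, h5⟩ := key (t - s') (by omega)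
      have h6 : w.x j (s + (t - s')) = w.x j' (s' + (t - s')) := congrArg (fun a => a.1) h5
      rw [show s' + (t - s') = t by omega] at h6
      rw [← h6]
      exact not_isBranch_of_lt (s := s) (by omega) (by omega)
  omega

/-- A segment that starts with the reversal of the last oriented edge of another one is its
reversal. -/
theorem segment_eq_rev {j j' : J} {s s' : ℕ} (hs : s < ℓ) (hs' : s' < ℓ)
    (hBs' : w.IsBranch (w.x j' s')) (h : w.dart j s = revEdge (w.dart j' (w.nx j' s' - 1))) :
    w.nx j s - s = w.nx j' s' - s' ∧
      ∀ u < w.nx j s - s, w.dart j (s + u) = revEdge (w.dart j' (w.nx j' s' - 1 - u)) := by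
  obtain ⟨h1, h2, h3⟩ := nx_spec (w := w) (j := j) hs
  obtain ⟨h1', h2', h3'⟩ := nx_spec (w := w) (j := j') hs'
  have key : ∀ u < w.nx j s - s, u < w.nx j' s' - s' ∧
      w.dart j (s + u) = revEdge (w.dart j' (w.nx j' s' - 1 - u)) := by
    intro u
    induction u with
    | zero => exact fun _ => ⟨by omega, h⟩
    | succ u ih =>
      intro hu
      obtain ⟨h4, h5⟩ := ih (by omega)
      have hB : ¬ w.IsBranch (w.x j (s + u + 1)) :=
        not_isBranch_of_lt (s := s) (by omega) (by omega)
      have h6 := dart_succ_eq_rev (by omega) (by omega) h5 hB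
      have h7 : w.x j (s + u + 1) = w.x j' (w.nx j' s' - 1 - u) := congrArg (fun a => a.2.2) h5
      have h8 : w.nx j' s' - 1 - u ≠ s' := by
        intro h8
        rw [h7, h8] at hB
        exact hB hBs'
      refine ⟨by omega, ?_⟩
      rw [show w.nx j' s' - 1 - (u + 1) = w.nx j' s' - 1 - u - 1 by omega]
      exact h6.2.2
  refine ⟨?_, fun u hu => (key u hu).2⟩
  obtain ⟨h4, h5⟩ := key (w.nx j s - s - 1) (by omega)
  have h6 : w.x j (s + (w.nx j s - s - 1) + 1) = w.x j' (w.nx j' s' - 1 - (w.nx j s - s - 1)) :=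
    congrArg (fun a => a.2.2) h5
  rw [show s + (w.nx j s - s - 1) + 1 = w.nx j s by omega] at h6
  by_contra hne
  refine not_isBranch_of_lt (w := w) (j := j') (s := s')
    (t := w.nx j' s' - 1 - (w.nx j s - s - 1)) (by omega) (by omega) ?_
  rwa [← h6]

/-- No segment is its own reversal: otherwise an edge in the middle would be its own reversal, or
there would be a backtracking in the middle. -/
theorem segment_ne_rev_self {j : J} {s : ℕ} (hs : s < ℓ) (hB : w.IsBranch (w.x j s)) :
    w.dart j s ≠ revEdge (w.dart j (w.nx j s - 1)) := by
  intro h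
  obtain ⟨h1, -, h3⟩ := nx_spec (w := w) (j := j) hs
  obtain ⟨-, h4⟩ := segment_eq_rev hs hs hB h
  have h5 := h4 ((w.nx j s - s - 1) / 2) (by omega)
  have h6 := congrArg (fun a => a.2.1) h5
  simp only [dart, revEdge] at h6
  rcases Nat.even_or_odd' (w.nx j s - s - 1) with ⟨k, hk | hk⟩
  · rw [hk, show w.nx j s - 1 - 2 * k / 2 = s + 2 * k / 2 by omega] at h6
    exact bar_ne _ h6.symm
  · rw [hk, show w.nx j s - 1 - (2 * k + 1) / 2 = s + (2 * k + 1) / 2 + 1 by omega] at h6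
    exact w.nb j _ (by omega) h6

/-- The unoriented segment that starts at time `s` of a walk. -/
noncomputable def key (w : Walks n d ℓ J) (b : J × ℕ) : Sym2 (Fin n × Fin (2 * d) × Fin n) :=
  s(w.dart b.1 b.2, revEdge (w.dart b.1 (w.nx b.1 b.2 - 1)))

theorem key_eq_iff {b b' : J × ℕ} (hb : b.2 < ℓ) (hb' : b'.2 < ℓ)
    (hB' : w.IsBranch (w.x b'.1 b'.2)) : w.key b = w.key b' ↔ w.dart b.1 b.2 = w.dart b'.1 b'.2 ∨
      w.dart b.1 b.2 = revEdge (w.dart b'.1 (w.nx b'.1 b'.2 - 1)) := by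
  obtain ⟨h1, -, -⟩ := nx_spec (w := w) (j := b.1) hb
  obtain ⟨h1', -, -⟩ := nx_spec (w := w) (j := b'.1) hb'
  constructor
  · intro h
    rcases Sym2.eq_iff.1 h with h | h
    · exact Or.inl h.1
    · exact Or.inr h.1
  · rintro (h | h)
    · obtain ⟨h2, h3⟩ := segment_eq hb hb' h
      have h4 := h3 (w.nx b.1 b.2 - b.2 - 1) (by omega)
      rw [show b.2 + (w.nx b.1 b.2 - b.2 - 1) = w.nx b.1 b.2 - 1 by omega,
        show b'.2 + (w.nx b.1 b.2 - b.2 - 1) = w.nx b'.1 b'.2 - 1 by omega] at h4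
      rw [key, key, h, h4]
    · obtain ⟨h2, h3⟩ := segment_eq_rev hb hb' hB' h
      have h4 := h3 (w.nx b.1 b.2 - b.2 - 1) (by omega)
      rw [show b.2 + (w.nx b.1 b.2 - b.2 - 1) = w.nx b.1 b.2 - 1 by omega,
        show w.nx b'.1 b'.2 - 1 - (w.nx b.1 b.2 - b.2 - 1) = b'.2 by omega] at h4
      rw [key, key, h, h4, revEdge_revEdge, Sym2.eq_swap]

variable [Fintype J]

open Classical in
/-- The walks and times at which a segment starts. -/
noncomputable def starts (w : Walks n d ℓ J) : Finset (J × ℕ) :=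
  (Finset.univ ×ˢ Finset.range ℓ).filter fun b => w.IsBranch (w.x b.1 b.2)

theorem mem_starts {b : J × ℕ} : b ∈ w.starts ↔ b.2 < ℓ ∧ w.IsBranch (w.x b.1 b.2) := by
  simp [starts]

/-- If an edge of a segment is traversed at another time, then the segment is traversed at another
time. -/
theorem exists_ne_start {b : J × ℕ} (hb : b ∈ w.starts) {t : ℕ} (hbt : b.2 ≤ t)
    (ht : t < w.nx b.1 b.2) {j' : J} {t' : ℕ} (ht' : t' < ℓ) (hne : (j', t') ≠ (b.1, t))
    (h : w.dart b.1 t = w.dart j' t' ∨ w.dart b.1 t = revEdge (w.dart j' t')) :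
    ∃ b' ∈ w.starts, b' ≠ b ∧ w.key b' = w.key b := by
  obtain ⟨j, s⟩ := b
  obtain ⟨hs, hB⟩ := mem_starts.1 hb
  dsimp only at hs hB hbt ht hne h
  obtain ⟨h1, -, h3⟩ := nx_spec (w := w) (j := j) hs
  rcases h with h | h
  · have key : ∀ u ≤ t - s, u ≤ t' ∧ w.dart j (t - u) = w.dart j' (t' - u) := by
      intro u
      induction u with
      | zero => exact fun _ => ⟨Nat.zero_le _, h⟩
      | succ u ih =>
        intro hu
        obtain ⟨h4, h5⟩ := ih (by omega)
        have h6 := dart_pred_eq (by omega) (by omega) h5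
          (not_isBranch_of_lt (s := s) (by omega) (by omega))
        refine ⟨by omega, ?_⟩
        rw [← Nat.sub_sub, ← Nat.sub_sub]
        exact h6.2.2
    obtain ⟨h4, h5⟩ := key (t - s) le_rfl
    rw [show t - (t - s) = s by omega] at h5
    have hx : w.x j s = w.x j' (t' - (t - s)) := congrArg (fun a => a.1) h5
    refine ⟨(j', t' - (t - s)), mem_starts.2 ⟨by dsimp only; omega, ?_⟩, ?_, ?_⟩
    · dsimp only
      rwa [← hx]
    · intro he
      obtain ⟨rfl, he⟩ := Prod.mk.inj he
      exact hne (Prod.ext rfl (by dsimp only; omega))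
    · exact (key_eq_iff (by dsimp only; omega) hs hB).2 (Or.inl h5.symm)
  · have key : ∀ u ≤ t - s, t' + u < ℓ ∧ w.dart j (t - u) = revEdge (w.dart j' (t' + u)) := by
      intro u
      induction u with
      | zero => exact fun _ => ⟨ht', h⟩
      | succ u ih =>
        intro hu
        obtain ⟨h4, h5⟩ := ih (by omega)
        have h5' : w.dart j' (t' + u) = revEdge (w.dart j (t - u)) := by
          rw [h5, revEdge_revEdge]
        have hx : w.x j' (t' + u + 1) = w.x j (t - u) := congrArg (fun a => a.2.2) h5'
        have h6 := dart_succ_eq_rev h4 (by omega) h5' (by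
          rw [hx]
          exact not_isBranch_of_lt (s := s) (by omega) (by omega))
        refine ⟨by omega, ?_⟩
        rw [← Nat.sub_sub, ← Nat.add_assoc, h6.2.2, revEdge_revEdge]
    obtain ⟨h4, h5⟩ := key (t - s) le_rfl
    rw [show t - (t - s) = s by omega] at h5
    have hx : w.x j s = w.x j' (t' + (t - s) + 1) := congrArg (fun a => a.1) h5
    obtain ⟨s', hs', hBs', hmax⟩ := exists_cut_le
      (P := fun t => w.IsBranch (w.x j' t)) (isBranch_zero j') (t' + (t - s))
    have hnx : w.nx j' s' = t' + (t - s) + 1 := by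
      refine nextCut_eq (by omega) (by rwa [← hx]) fun u hu1 hu2 => hmax u hu1 (by omega)
    refine ⟨(j', s'), mem_starts.2 ⟨by dsimp only; omega, hBs'⟩, ?_, ?_⟩
    · intro he
      obtain ⟨rfl, rfl⟩ := Prod.mk.inj he
      refine segment_ne_rev_self hs hB ?_
      rw [hnx, Nat.add_sub_cancel]
      exact h5
    · refine ((key_eq_iff hs (by dsimp only; omega) hBs').2 (Or.inr ?_)).symm
      dsimp only
      rw [hnx, Nat.add_sub_cancel]
      exact h5

end Walks

namespace Walks

variable {n d ℓ : ℕ} {J : Type*} {w : Walks n d ℓ J}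

/-! ### Counting the segments -/

theorem exists_eq_of_mem_darts {a : Fin n × Fin (2 * d) × Fin n} (ha : a ∈ w.darts) :
    ∃ j, ∃ t ≤ ℓ, a.1 = w.x j t := by
  obtain ⟨j, t, ht, rfl | rfl⟩ := mem_darts.1 ha
  · exact ⟨j, t, ht.le, rfl⟩
  · exact ⟨j, t + 1, ht, rfl⟩

theorem two_le_card_out {j : J} {t : ℕ} (ht : t + 1 < ℓ) : 2 ≤ (w.out (w.x j (t + 1))).card := by
  classical
  refine (Finset.card_pair (dart_succ_ne_rev (w := w) (j := j) ht)).ge.trans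
    (Finset.card_le_card fun b hb => ?_)
  rw [Finset.mem_insert, Finset.mem_singleton] at hb
  rcases hb with rfl | rfl
  · exact mem_out.2 ⟨revEdge_dart_mem (by omega), rfl⟩
  · exact mem_out.2 ⟨dart_mem ht, rfl⟩

/-- The colored edge traversed at time `t`. -/
def edge (w : Walks n d ℓ J) (j : J) (t : ℕ) : ColoredEdge n d :=
  ColoredEdge.mk (w.x j t) (w.c j t) (w.x j (t + 1))

theorem edge_eq_iff {j j' : J} {t t' : ℕ} : w.edge j t = w.edge j' t' ↔
    w.dart j t = w.dart j' t' ∨ w.dart j t = revEdge (w.dart j' t') :=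
  coloredEdge_mk_eq_iff (a := w.dart j t) (b := w.dart j' t')

instance (n d : ℕ) : Finite (ColoredEdge n d) := Quotient.finite _

theorem card_darts_le : w.darts.card ≤ 2 * {a | ∃ j, ∃ t < ℓ, w.edge j t = a}.ncard := by
  classical
  have := Fintype.ofFinite (ColoredEdge n d)
  let f : Fin n × Fin (2 * d) × Fin n → ColoredEdge n d := fun a => ColoredEdge.mk a.1 a.2.1 a.2.2
  have h1 : (w.darts.image f : Set (ColoredEdge n d)) ⊆ {a | ∃ j, ∃ t < ℓ, w.edge j t = a} := by
    intro a ha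
    obtain ⟨b, hb, rfl⟩ := Finset.mem_image.1 (Finset.mem_coe.1 ha)
    obtain ⟨j, t, ht, h⟩ := mem_darts.1 hb
    exact ⟨j, t, ht, (coloredEdge_mk_eq_iff.2 h).symm⟩
  have h2 := Set.ncard_le_ncard h1 (Set.toFinite _)
  rw [Set.ncard_coe_finset] at h2
  refine (Finset.card_le_mul_card_image w.darts 2 fun a ha => ?_).trans
    (Nat.mul_le_mul_left 2 h2)
  obtain ⟨b, hb, rfl⟩ := Finset.mem_image.1 ha
  refine (Finset.card_le_card (t := {b, revEdge b}) fun x hx => ?_).trans Finset.card_le_two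
  have := (Finset.mem_filter.1 hx).2
  rw [Finset.mem_insert, Finset.mem_singleton]
  exact coloredEdge_mk_eq_iff.1 this

variable [Fintype J]

open Classical in
/-- The number of oriented edges that leave a branch vertex is bounded by the Euler characteristic
and the number of walks. At each vertex `y` that is no endpoint, this follows from
`k ≤ 3 * (k - 2)` for the degree `k ≥ 3` of a branch vertex. -/
theorem card_branch_darts_add_le (hℓ : 1 ≤ ℓ) :
    (w.darts.filter fun a => w.IsBranch a.1).card + 6 * {y | ∃ j, ∃ t ≤ ℓ, w.x j t = y}.ncard ≤
      6 * {a | ∃ j, ∃ t < ℓ, w.edge j t = a}.ncard + 8 * Fintype.card J := by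
  set V := w.darts.image Prod.fst with hV
  have hVeq : {y | ∃ j, ∃ t ≤ ℓ, w.x j t = y} = (V : Set (Fin n)) := by
    ext y
    simp only [Set.mem_ofPred_eq, hV, Finset.mem_coe, Finset.mem_image]
    constructor
    · rintro ⟨j, t, ht, rfl⟩
      rcases ht.lt_or_eq with ht | rfl
      · exact ⟨_, dart_mem ht, rfl⟩
      · obtain ⟨u, rfl⟩ : ∃ u, t = u + 1 := ⟨t - 1, by omega⟩
        exact ⟨_, revEdge_dart_mem (j := j) (t := u) (by omega), rfl⟩
    · rintro ⟨a, ha, rfl⟩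
      obtain ⟨j, t, ht, h⟩ := exists_eq_of_mem_darts ha
      exact ⟨j, t, ht, h.symm⟩
  rw [hVeq, Set.ncard_coe_finset]
  have hmaps : ∀ a ∈ w.darts, a.1 ∈ V := fun a ha => Finset.mem_image_of_mem _ ha
  have hout : ∀ y, w.darts.filter (fun a => a.1 = y) = w.out y := fun y => by
    ext a; simp [mem_out]
  let End : Finset (Fin n) := Finset.univ.filter fun y => ∃ j, y = w.x j 0 ∨ y = w.x j ℓ
  have hEnd : End.card ≤ 2 * Fintype.card J := by
    have : End ⊆ (Finset.univ.image fun j => w.x j 0) ∪ Finset.univ.image fun j => w.x j ℓ := by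
      intro y hy
      obtain ⟨j, h | h⟩ := (Finset.mem_filter.1 hy).2
      · exact Finset.mem_union_left _ (Finset.mem_image.2 ⟨j, Finset.mem_univ _, h.symm⟩)
      · exact Finset.mem_union_right _ (Finset.mem_image.2 ⟨j, Finset.mem_univ _, h.symm⟩)
    refine (Finset.card_le_card this).trans ((Finset.card_union_le _ _).trans ?_)
    rw [two_mul]
    exact Nat.add_le_add Finset.card_image_le Finset.card_image_le
  have hT : (w.darts.filter fun a => w.IsBranch a.1).card =
      ∑ y ∈ V, if w.IsBranch y then (w.out y).card else 0 := by
    rw [Finset.card_eq_sum_card_fiberwise (f := Prod.fst) (t := V)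
      (fun a ha => hmaps a (Finset.mem_filter.1 ha).1)]
    refine Finset.sum_congr rfl fun y _ => ?_
    split_ifs with hy
    · congr 1
      ext a
      simp only [Finset.mem_filter, mem_out]
      exact ⟨fun h => ⟨h.1.1, h.2⟩, fun h => ⟨⟨h.1, h.2 ▸ hy⟩, h.2⟩⟩
    · rw [Finset.card_eq_zero, Finset.filter_eq_empty_iff]
      intro a ha h
      exact hy (h ▸ (Finset.mem_filter.1 ha).2)
  have hD : w.darts.card = ∑ y ∈ V, (w.out y).card := by
    rw [Finset.card_eq_sum_card_fiberwise (f := Prod.fst) (t := V) hmaps]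
    exact Finset.sum_congr rfl fun y _ => by rw [hout]
  have hpt : ∀ y ∈ V, (if w.IsBranch y then (w.out y).card else 0) + 6 ≤
      3 * (w.out y).card + 4 * if y ∈ End then 1 else 0 := by
    intro y hy
    obtain ⟨a, ha, rfl⟩ := Finset.mem_image.1 hy
    have h1 : 1 ≤ (w.out a.1).card := Finset.card_pos.2 ⟨a, mem_out.2 ⟨ha, rfl⟩⟩
    by_cases hE : a.1 ∈ End
    · rw [if_pos hE]
      split_ifs <;> omega
    · have hE' : ¬ ∃ j, a.1 = w.x j 0 ∨ a.1 = w.x j ℓ := fun h =>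
        hE (Finset.mem_filter.2 ⟨Finset.mem_univ _, h⟩)
      obtain ⟨j, t, ht, h⟩ := exists_eq_of_mem_darts ha
      have ht0 : t ≠ 0 := by rintro rfl; exact hE' ⟨j, Or.inl h⟩
      have ht1 : t ≠ ℓ := by rintro rfl; exact hE' ⟨j, Or.inr h⟩
      obtain ⟨u, rfl⟩ : ∃ u, t = u + 1 := ⟨t - 1, by omega⟩
      have h2 := two_le_card_out (w := w) (j := j) (t := u) (by omega)
      rw [← h] at h2
      split_ifs with hB
      · have := hB.resolve_left hE'
        omega
      · omega
  have hsum := Finset.sum_le_sum hpt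
  rw [Finset.sum_add_distrib, Finset.sum_add_distrib, ← hT, ← Finset.mul_sum, ← Finset.mul_sum,
    ← hD, Finset.sum_const, smul_eq_mul] at hsum
  have h3 : (∑ y ∈ V, if y ∈ End then 1 else 0) ≤ End.card := by
    rw [← Finset.sum_filter, Finset.sum_const, smul_eq_mul, mul_one]
    exact Finset.card_le_card fun y hy => (Finset.mem_filter.1 hy).2
  have h4 := w.card_darts_le
  omega

open Classical in
/-- The unoriented segments. -/
noncomputable def segs (w : Walks n d ℓ J) : Finset (Sym2 (Fin n × Fin (2 * d) × Fin n)) :=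
  w.starts.image w.key

/-- The type of unoriented segments. -/
abbrev Seg (w : Walks n d ℓ J) : Type := {κ // κ ∈ w.segs}

theorem exists_rep (κ : w.Seg) : ∃ b ∈ w.starts, w.key b = κ := by
  classical
  exact Finset.mem_image.1 κ.2

/-- A walk and a time at which the segment `κ` starts. -/
noncomputable def rep (κ : w.Seg) : J × ℕ := (exists_rep κ).choose

theorem rep_mem (κ : w.Seg) : rep κ ∈ w.starts := (exists_rep κ).choose_spec.1

theorem key_rep (κ : w.Seg) : w.key (rep κ) = κ := (exists_rep κ).choose_spec.2

theorem rep_lt (κ : w.Seg) : (rep κ).2 < ℓ := (mem_starts.1 (rep_mem κ)).1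

/-- The length of a segment. -/
noncomputable def len (κ : w.Seg) : ℕ := w.nx (rep κ).1 (rep κ).2 - (rep κ).2

open Classical in
/-- The number of times that a segment is traversed. -/
noncomputable def mult (κ : w.Seg) : ℕ := (w.starts.filter fun b => w.key b = κ).card

theorem mult_pos (κ : w.Seg) : 1 ≤ mult κ := by
  classical
  exact Finset.card_pos.2 ⟨rep κ, Finset.mem_filter.2 ⟨rep_mem κ, key_rep κ⟩⟩

theorem eq_rep_of_mult_eq_one {κ : w.Seg} (h : mult κ = 1) {b : J × ℕ} (hb : b ∈ w.starts)
    (hbκ : w.key b = κ) : b = rep κ := by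
  classical
  obtain ⟨a, ha⟩ := Finset.card_eq_one.1 h
  have h1 : b ∈ ({a} : Finset _) := ha ▸ Finset.mem_filter.2 ⟨hb, hbκ⟩
  have h2 : rep κ ∈ ({a} : Finset _) := ha ▸ Finset.mem_filter.2 ⟨rep_mem κ, key_rep κ⟩
  rw [Finset.mem_singleton.1 h1, Finset.mem_singleton.1 h2]

open Classical in
/-- A segment is determined by the first oriented edge of any of its traversals. -/
theorem card_seg_le : Fintype.card w.Seg ≤ (w.darts.filter fun a => w.IsBranch a.1).card := by
  rw [← Finset.card_univ]
  refine Finset.card_le_card_of_injOn (fun κ => w.dart (rep κ).1 (rep κ).2) (fun κ _ => ?_)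
    fun κ _ κ' _ h => ?_
  · obtain ⟨h1, h2⟩ := mem_starts.1 (rep_mem κ)
    exact Finset.mem_coe.2 (Finset.mem_filter.2 ⟨dart_mem h1, h2⟩)
  · refine Subtype.ext ?_
    rw [← key_rep κ, ← key_rep κ']
    exact (key_eq_iff (rep_lt κ) (rep_lt κ') (mem_starts.1 (rep_mem κ')).2).2 (Or.inl h)

open Classical in
@[to_additive]
theorem prod_starts_eq {M : Type*} [CommMonoid M] (F : J × ℕ → M) :
    ∏ b ∈ w.starts, F b = ∏ κ : w.Seg, ∏ b ∈ w.starts.filter fun b => w.key b = κ, F b := by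
  rw [← Finset.prod_fiberwise_of_maps_to (g := w.key) (t := w.segs)
    fun b hb => Finset.mem_image_of_mem _ hb]
  exact (Finset.prod_coe_sort w.segs
    (fun κ => ∏ b ∈ w.starts.filter fun b => w.key b = κ, F b)).symm

open Classical in
@[to_additive]
theorem prod_starts_eq_prod_prod {M : Type*} [CommMonoid M] (F : J × ℕ → M) :
    ∏ b ∈ w.starts, F b =
      ∏ j, ∏ t ∈ (Finset.Ico 0 ℓ).filter fun t => w.IsBranch (w.x j t), F (j, t) := by
  rw [starts, Finset.prod_filter, Finset.prod_product]
  refine Finset.prod_congr rfl fun j _ => ?_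
  rw [Finset.prod_filter, Finset.range_eq_Ico]

theorem len_eq {κ : w.Seg} {b : J × ℕ} (hb : b ∈ w.starts) (hbκ : w.key b = κ) :
    w.nx b.1 b.2 - b.2 = len κ := by
  have hB := (mem_starts.1 (rep_mem κ)).2
  have h := (key_eq_iff (mem_starts.1 hb).1 (rep_lt κ) hB).1 (hbκ.trans (key_rep κ).symm)
  rcases h with h | h
  · exact (segment_eq (mem_starts.1 hb).1 (rep_lt κ) h).1
  · exact (segment_eq_rev (mem_starts.1 hb).1 (rep_lt κ) hB h).1

theorem sum_mult_mul_len : ∑ κ : w.Seg, mult κ * len κ = Fintype.card J * ℓ := by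
  classical
  have h1 := sum_starts_eq (w := w) fun b => w.nx b.1 b.2 - b.2
  have h2 := sum_starts_eq_sum_sum (w := w) fun b => w.nx b.1 b.2 - b.2
  have h3 : ∀ κ : w.Seg, ∑ b ∈ w.starts.filter (fun b => w.key b = κ), (w.nx b.1 b.2 - b.2) =
      mult κ * len κ := by
    intro κ
    refine (Finset.sum_congr rfl fun b hb => ?_).trans (Finset.sum_const (len κ))
    exact len_eq (Finset.mem_filter.1 hb).1 (Finset.mem_filter.1 hb).2
  rw [← Finset.sum_congr rfl fun κ _ => h3 κ, ← h1, h2]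
  have h4 : ∀ j : J, ∑ t ∈ (Finset.Ico 0 ℓ).filter (fun t => w.IsBranch (w.x j t)),
      (w.nx j t - t) = ℓ := fun j =>
    sum_cuts (P := fun t => w.IsBranch (w.x j t)) (isBranch_last j) (Nat.zero_le ℓ)
      (isBranch_zero j)
  rw [Finset.sum_congr rfl fun j _ => h4 j, Finset.sum_const, smul_eq_mul, Finset.card_univ]

/-- The edges of a segment that is traversed only once are traversed only once. -/
theorem sum_len_le : ∑ κ : w.Seg, (if mult κ = 1 then len κ else 0) ≤
    {a : ColoredEdge n d | {p : J × Fin ℓ | w.edge p.1 p.2 = a}.ncard = 1}.ncard := by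
  classical
  set M := {a : ColoredEdge n d | {p : J × Fin ℓ | w.edge p.1 p.2 = a}.ncard = 1}
  have hM : M.Finite := Set.toFinite _
  have hlt : ∀ κ : w.Seg, ∀ u < len κ, (rep κ).2 + u < ℓ ∧
      (rep κ).2 + u < w.nx (rep κ).1 (rep κ).2 := by
    intro κ u hu
    obtain ⟨h1, -, h3⟩ := nx_spec (w := w) (j := (rep κ).1) (rep_lt κ)
    unfold len at hu
    omega
  have huniq : ∀ κ : w.Seg, mult κ = 1 → ∀ u < len κ, ∀ j' : J, ∀ t' < ℓ,
      w.edge (rep κ).1 ((rep κ).2 + u) = w.edge j' t' → (j', t') = ((rep κ).1, (rep κ).2 + u) := by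
    intro κ hκ u hu j' t' ht' h
    by_contra hne
    obtain ⟨b', hb', hne', hkey⟩ := exists_ne_start (rep_mem κ) (Nat.le_add_right _ u)
      (hlt κ u hu).2 ht' hne (edge_eq_iff.1 h)
    exact hne' (eq_rep_of_mult_eq_one hκ hb' (hkey.trans (key_rep κ)))
  have hcard : ∑ κ : w.Seg, (if mult κ = 1 then len κ else 0) =
      ((Finset.univ.filter fun κ : w.Seg => mult κ = 1).sigma
        fun κ => Finset.range (len κ)).card := by
    rw [Finset.card_sigma, Finset.sum_filter]
    simp
  rw [hcard, ← Set.ncard_coe_finset]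
  refine Set.ncard_le_ncard_of_injOn
    (fun p => w.edge (rep p.1).1 ((rep p.1).2 + p.2)) ?_ ?_ hM
  · rintro ⟨κ, u⟩ hp
    obtain ⟨h1, h2⟩ := Finset.mem_sigma.1 (Finset.mem_coe.1 hp)
    have h1 := (Finset.mem_filter.1 h1).2
    have h2 := Finset.mem_range.1 h2
    dsimp only at h1 h2 ⊢
    refine Set.ncard_eq_one.2 ⟨((rep κ).1, ⟨(rep κ).2 + u, (hlt κ u h2).1⟩), ?_⟩
    ext ⟨j', t'⟩
    simp only [Set.mem_ofPred_eq, Set.mem_singleton_iff]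
    constructor
    · intro h
      obtain ⟨h3, h4⟩ := Prod.mk.inj (huniq κ h1 u h2 j' t' t'.2 h.symm)
      exact Prod.ext h3 (Fin.ext h4)
    · intro h
      obtain ⟨rfl, rfl⟩ := Prod.mk.inj h
      rfl
  · rintro ⟨κ, u⟩ hp ⟨κ', u'⟩ hp' h
    obtain ⟨h1, h2⟩ := Finset.mem_sigma.1 (Finset.mem_coe.1 hp)
    obtain ⟨-, h2'⟩ := Finset.mem_sigma.1 (Finset.mem_coe.1 hp')
    have h1 := (Finset.mem_filter.1 h1).2
    have h2 := Finset.mem_range.1 h2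
    have h2' := Finset.mem_range.1 h2'
    dsimp only at h1 h2 h2' h
    obtain ⟨h3, h4⟩ := Prod.mk.inj (huniq κ h1 u h2 _ _ (hlt κ' u' h2').1 h)
    have h5 := (hlt κ u h2).2
    have h5' := (hlt κ' u' h2').2
    have hB := (mem_starts.1 (rep_mem κ)).2
    have hB' := (mem_starts.1 (rep_mem κ')).2
    have h6 : (rep κ').2 = (rep κ).2 := by
      rcases lt_trichotomy (rep κ').2 (rep κ).2 with h6 | h6 | h6
      · rw [← h3] at hB
        exact absurd hB (not_isBranch_of_lt h6 (by omega))
      · exact h6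
      · rw [h3] at hB'
        exact absurd hB' (not_isBranch_of_lt h6 (by omega))
    have h7 : κ' = κ := by
      refine Subtype.ext ?_
      rw [← key_rep κ, ← key_rep κ', Prod.ext h3 h6]
    subst h7
    have h8 : u' = u := by omega
    rw [h8]

/-- The colors along the segment `κ` for a coloring `c'` of the steps. -/
noncomputable def word (c' : J → ℕ → Fin (2 * d)) (κ : w.Seg) : Fin (len κ) → Fin (2 * d) :=
  fun u => c' (rep κ).1 ((rep κ).2 + u)

/-- A coloring of the steps of the walks that is induced by a coloring of the traversed edges. -/
def IsRecoloring (w : Walks n d ℓ J) (c' : J → ℕ → Fin (2 * d)) : Prop :=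
  ∀ j j' t t', t < ℓ → t' < ℓ → (w.dart j t = w.dart j' t' → c' j t = c' j' t') ∧
    (w.dart j t = revEdge (w.dart j' t') → c' j t = bar (c' j' t'))

theorem _root_.SchottkyTrace.map_Ico_eq_ofFn {α : Type*} (c : ℕ → α) {s e L : ℕ} (h : e - s = L) :
    (List.Ico s e).map c = List.ofFn fun u : Fin L => c (s + u) := by
  subst h
  refine List.ext_getElem (by simp) fun i h1 h2 => ?_
  simp [List.Ico]

/-- Each traversal of a segment goes along its representative, or against it. -/
theorem map_eq_or_inv {κ : w.Seg} {b : J × ℕ} (hb : b ∈ w.starts) (hbκ : w.key b = κ) :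
    (∀ c', w.IsRecoloring c' →
      (List.Ico b.2 (w.nx b.1 b.2)).map (c' b.1) = List.ofFn (word c' κ)) ∨
    (∀ c', w.IsRecoloring c' →
      (List.Ico b.2 (w.nx b.1 b.2)).map (c' b.1) = inv (List.ofFn (word c' κ))) := by
  have hB := (mem_starts.1 (rep_mem κ)).2
  have hL := len_eq hb hbκ
  obtain ⟨h1, -, h3⟩ := nx_spec (w := w) (j := b.1) (mem_starts.1 hb).1
  obtain ⟨h1', -, h3'⟩ := nx_spec (w := w) (j := (rep κ).1) (rep_lt κ)
  have hlen : w.nx (rep κ).1 (rep κ).2 - (rep κ).2 = len κ := rfl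
  rcases (key_eq_iff (mem_starts.1 hb).1 (rep_lt κ) hB).1 (hbκ.trans (key_rep κ).symm) with h | h
  · left
    intro c' hc
    obtain ⟨-, h4⟩ := segment_eq (mem_starts.1 hb).1 (rep_lt κ) h
    rw [map_Ico_eq_ofFn _ hL]
    congr 1
    funext u
    exact (hc _ _ _ _ (by omega) (by omega)).1 (h4 u (by omega))
  · right
    intro c' hc
    obtain ⟨-, h4⟩ := segment_eq_rev (mem_starts.1 hb).1 (rep_lt κ) hB h
    rw [map_Ico_eq_ofFn _ hL]
    refine List.ext_getElem (by simp [inv]) fun i h5 h6 => ?_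
    have hi : i < len κ := by simpa using h5
    simp only [inv, List.getElem_ofFn, List.getElem_reverse, List.getElem_map, word,
      List.length_map, List.length_ofFn]
    rw [show (rep κ).2 + (len κ - 1 - i) = w.nx (rep κ).1 (rep κ).2 - 1 - i by omega]
    exact (hc _ _ _ _ (by omega) (by omega)).2 (h4 i (by omega))

/-- A recoloring is determined by its words along the segments. -/
theorem IsRecoloring.eq_of_word_eq {c' c'' : J → ℕ → Fin (2 * d)} (hc' : w.IsRecoloring c')
    (hc'' : w.IsRecoloring c'') (h : ∀ κ : w.Seg, word c' κ = word c'' κ) (j : J) {t : ℕ}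
    (ht : t < ℓ) : c' j t = c'' j t := by
  classical
  obtain ⟨s, hs, hB, hmax⟩ := exists_cut_le (P := fun t => w.IsBranch (w.x j t)) (isBranch_zero j) t
  have hb : (j, s) ∈ w.starts := mem_starts.2 ⟨by dsimp only; omega, hB⟩
  let κ : w.Seg := ⟨w.key (j, s), Finset.mem_image_of_mem _ hb⟩
  have htn : t < w.nx j s := by
    by_contra hlt
    obtain ⟨h1, h2, -⟩ := nx_spec (w := w) (j := j) (s := s) (by omega)
    exact hmax _ h1 (not_lt.1 hlt) h2
  have hmap : (List.Ico s (w.nx j s)).map (c' j) = (List.Ico s (w.nx j s)).map (c'' j) := by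
    rcases map_eq_or_inv (κ := κ) hb rfl with h1 | h1
    · exact (h1 c' hc').trans ((congrArg List.ofFn (h κ)).trans (h1 c'' hc'').symm)
    · exact (h1 c' hc').trans ((congrArg (inv ∘ List.ofFn) (h κ)).trans (h1 c'' hc'').symm)
  exact List.map_inj_left.1 hmap t (List.Ico.mem.2 ⟨hs, htn⟩)

theorem prod_le_prod_seg (φ : List (Fin (2 * d)) → ℝ) (h0 : ∀ u, 0 ≤ φ u) (h1 : φ [] ≤ 1)
    (hφ : ∀ u v, φ (u ++ v) ≤ φ u * φ v) (hinv : ∀ u, φ (inv u) = φ u)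
    {c' : J → ℕ → Fin (2 * d)} (hc : w.IsRecoloring c') :
    ∏ j, φ ((List.Ico 0 ℓ).map (c' j)) ≤
      ∏ κ : w.Seg, φ (List.ofFn (word c' κ)) ^ mult κ := by
  classical
  have h2 : ∀ κ : w.Seg, φ (List.ofFn (word c' κ)) ^ mult κ =
      ∏ b ∈ w.starts.filter (fun b => w.key b = κ),
        φ ((List.Ico b.2 (w.nx b.1 b.2)).map (c' b.1)) := by
    intro κ
    rw [mult, ← Finset.prod_const]
    refine Finset.prod_congr rfl fun b hb => ?_
    rcases map_eq_or_inv (Finset.mem_filter.1 hb).1 (Finset.mem_filter.1 hb).2 with h | h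
    · rw [h c' hc]
    · rw [h c' hc, hinv]
  rw [Finset.prod_congr rfl fun κ _ => h2 κ,
    ← prod_starts_eq (w := w) fun b => φ ((List.Ico b.2 (w.nx b.1 b.2)).map (c' b.1)),
    prod_starts_eq_prod_prod]
  exact Finset.prod_le_prod (fun j _ => h0 _) fun j _ =>
    le_prod_cuts (P := fun t => w.IsBranch (w.x j t)) φ h0 h1 hφ (c' j) (isBranch_last j)
      (Nat.zero_le ℓ) (isBranch_zero j)

end Walks

/-! ### Summation over an isomorphism class -/

namespace PathTuple

variable {n d ℓ m : ℕ}

/-- The family of walks of a tuple of non-backtracking paths. -/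
def toWalks (γ : PathTuple n d ℓ m) (h : ∀ j, (γ j).NonBacktracking) :
    Walks n d ℓ (Fin (2 * m)) where
  x j t := (γ j ⟨min t ℓ, by omega⟩).1
  c j t := (γ j ⟨min t ℓ, by omega⟩).2
  nb j t ht := by
    have := h j ⟨t, by omega⟩
    have h1 : min t ℓ = t := by omega
    have h2 : min (t + 1) ℓ = t + 1 := by omega
    simpa only [Fin.castSucc_mk, Fin.succ_mk, h1, h2] using this

variable {γ : PathTuple n d ℓ m} {h : ∀ j, (γ j).NonBacktracking}

theorem toWalks_x (j : Fin (2 * m)) (t : Fin (ℓ + 1)) : (γ.toWalks h).x j t = (γ j t).1 := by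
  have h1 : (⟨min t.1 ℓ, by omega⟩ : Fin (ℓ + 1)) = t := Fin.ext (by dsimp only; omega)
  simp only [toWalks, h1]

theorem toWalks_c (j : Fin (2 * m)) (t : Fin (ℓ + 1)) : (γ.toWalks h).c j t = (γ j t).2 := by
  have h1 : (⟨min t.1 ℓ, by omega⟩ : Fin (ℓ + 1)) = t := Fin.ext (by dsimp only; omega)
  simp only [toWalks, h1]

theorem toWalks_edge (j : Fin (2 * m)) (t : Fin ℓ) : (γ.toWalks h).edge j t = (γ j).edge t := by
  have h1 := toWalks_x (h := h) j t.castSucc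
  have h2 := toWalks_x (h := h) j t.succ
  have h3 := toWalks_c (h := h) j t.castSucc
  rw [Fin.val_castSucc] at h1 h3
  rw [Fin.val_succ] at h2
  rw [Walks.edge, HPath.edge, h1, h2, h3]

theorem verts_eq : γ.graph.verts = {y | ∃ j, ∃ t ≤ ℓ, (γ.toWalks h).x j t = y} := by
  ext y
  simp only [graph, HPath.graph, Set.mem_iUnion, Set.mem_range, Set.mem_ofPred_eq]
  constructor
  · rintro ⟨j, t, rfl⟩
    exact ⟨j, t, by omega, toWalks_x j t⟩
  · rintro ⟨j, t, ht, rfl⟩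
    exact ⟨j, ⟨t, by omega⟩, (toWalks_x (h := h) j ⟨t, by omega⟩).symm⟩

theorem edges_eq : γ.graph.edges = {a | ∃ j, ∃ t < ℓ, (γ.toWalks h).edge j t = a} := by
  ext y
  simp only [graph, HPath.graph, Set.mem_iUnion, Set.mem_range, Set.mem_ofPred_eq]
  constructor
  · rintro ⟨j, t, rfl⟩
    exact ⟨j, t, by omega, toWalks_edge j t⟩
  · rintro ⟨j, t, ht, rfl⟩
    exact ⟨j, ⟨t, by omega⟩, (toWalks_edge (h := h) j ⟨t, by omega⟩).symm⟩

theorem ncard_multiplicity_one_le :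
    {a : ColoredEdge n d | {p : Fin (2 * m) × Fin ℓ |
      (γ.toWalks h).edge p.1 p.2 = a}.ncard = 1}.ncard ≤ γ.multOne := by
  refine Set.ncard_le_ncard (fun a ha => ?_) (Set.toFinite _)
  simp only [Set.mem_ofPred_eq, toWalks_edge] at ha
  refine ⟨?_, ha⟩
  obtain ⟨p, hp⟩ := Set.ncard_eq_one.1 ha
  have : p ∈ {p : Fin (2 * m) × Fin ℓ | (γ p.1).edge p.2 = a} := hp ▸ Set.mem_singleton p
  exact Set.mem_iUnion.2 ⟨p.1, p.2, this⟩

/-- The endpoints of a colored edge. -/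
def _root_.SchottkyTrace.ColoredEdge.ends : ColoredEdge n d → Sym2 (Fin n) :=
  Quotient.lift (fun a => s(a.1, a.2.2)) (by
    rintro a b (rfl | rfl)
    · rfl
    · exact Sym2.eq_swap)

/-- The graph of an element of `W` is connected, as consecutive paths share an endpoint. Hence
its rank is nonnegative. -/
theorem ncard_verts_le (hm : 1 ≤ m) (hγ : γ ∈ W n d ℓ m) :
    γ.graph.verts.ncard ≤ γ.graph.edges.ncard + 1 := by
  let G : SimpleGraph γ.graph.verts :=
    { Adj := fun a b => a ≠ b ∧ ∃ i, ColoredEdge.mk a.1 i b.1 ∈ γ.graph.edges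
      symm := ⟨by
        rintro a b ⟨hab, i, hi⟩
        refine ⟨hab.symm, bar i, ?_⟩
        rwa [show ColoredEdge.mk b.1 (bar i) a.1 = ColoredEdge.mk a.1 i b.1 from
          coloredEdge_mk_eq_iff (a := (b.1, bar i, a.1)) (b := (a.1, i, b.1)) |>.2 (Or.inr rfl)]⟩
      loopless := ⟨fun a h => h.1 rfl⟩ }
  let V : ∀ (_ : Fin (2 * m)) (_ : Fin (ℓ + 1)), γ.graph.verts := fun j t =>
    ⟨(γ j t).1, Set.mem_iUnion.2 ⟨j, t, rfl⟩⟩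
  have hpath : ∀ j t, G.Reachable (V j 0) (V j t) := by
    intro j t
    induction t using Fin.induction with
    | zero => exact SimpleGraph.Reachable.refl _
    | succ t ih =>
      refine ih.trans ?_
      by_cases heq : V j t.castSucc = V j t.succ
      · rw [heq]
      · exact SimpleGraph.Adj.reachable
          ⟨heq, (γ j t.castSucc).2, Set.mem_iUnion.2 ⟨j, t, rfl⟩⟩
  have hall : ∀ (i : ℕ) (hi : i < 2 * m), G.Reachable (V ⟨0, by omega⟩ 0) (V ⟨i, hi⟩ 0) := by
    intro i
    induction i with
    | zero => exact fun _ => SimpleGraph.Reachable.refl _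
    | succ i ih =>
      intro hi
      refine (ih (by omega)).trans ?_
      rcases Nat.even_or_odd' i with ⟨k, rfl | rfl⟩
      · have h1 := hγ.2.2 ⟨k, by omega⟩
        have h2 : V ⟨2 * k, by omega⟩ (Fin.last ℓ) = V ⟨2 * k + 1, hi⟩ (Fin.last ℓ) :=
          Subtype.ext (congrArg Prod.fst h1)
        exact (hpath _ (Fin.last ℓ)).trans (h2 ▸ (hpath _ (Fin.last ℓ)).symm)
      · have h1 := hγ.2.1 ⟨k, by omega⟩
        have h3 : nextIdx (⟨k, by omega⟩ : Fin m) = ⟨2 * k + 1 + 1, hi⟩ :=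
          Fin.ext (Nat.mod_eq_of_lt hi)
        rw [h3] at h1
        have h2 : V ⟨2 * k + 1, by omega⟩ 0 = V ⟨2 * k + 1 + 1, hi⟩ 0 :=
          Subtype.ext (congrArg Prod.fst h1)
        rw [h2]
  have hroot : ∀ y : γ.graph.verts, G.Reachable (V ⟨0, by omega⟩ 0) y := by
    rintro ⟨y, hy⟩
    obtain ⟨j, t, rfl⟩ := Set.mem_iUnion.1 hy
    exact (hall j.1 j.2).trans (hpath j t)
  have hconn : G.Connected :=
    { preconnected := fun a b => (hroot a).symm.trans (hroot b)
      nonempty := ⟨V ⟨0, by omega⟩ 0⟩ }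
  have h1 := hconn.card_vert_le_card_edgeSet_add_one
  rw [Nat.card_coe_set_eq] at h1
  refine h1.trans (Nat.add_le_add_right ?_ 1)
  rw [Nat.card_coe_set_eq]
  refine (Set.ncard_le_ncard_of_injOn (t := ColoredEdge.ends '' γ.graph.edges)
    (Sym2.map Subtype.val) ?_ (Sym2.map.injective Subtype.val_injective).injOn
    (Set.toFinite _)).trans (Set.ncard_image_le (Set.toFinite _))
  intro z
  induction z using Sym2.ind with
  | _ a b =>
    rintro ⟨-, i, hi⟩
    exact ⟨_, hi, rfl⟩

/-- An isomorphism recolors the walks. -/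
theorem isRecoloring_of_iso {γ' : PathTuple n d ℓ m} (h' : ∀ j, (γ' j).NonBacktracking)
    (hiso : γ.Iso γ') : (γ.toWalks h).IsRecoloring (γ'.toWalks h').c := by
  obtain ⟨σ, κ, hκ, -, hc⟩ := hiso
  have hcol : ∀ j, ∀ t < ℓ, (γ'.toWalks h').c j t =
      κ ((γ.toWalks h).x j t) ((γ.toWalks h).x j (t + 1)) ((γ.toWalks h).c j t) := by
    intro j t ht
    have h1 := toWalks_c (h := h') j (⟨t, ht⟩ : Fin ℓ).castSucc
    have h2 := toWalks_c (h := h) j (⟨t, ht⟩ : Fin ℓ).castSucc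
    have h3 := toWalks_x (h := h) j (⟨t, ht⟩ : Fin ℓ).castSucc
    have h4 := toWalks_x (h := h) j (⟨t, ht⟩ : Fin ℓ).succ
    rw [Fin.val_castSucc] at h1 h2 h3
    rw [Fin.val_succ] at h4
    dsimp only at h1 h2 h3 h4
    rw [h1, h2, h3, h4]
    exact hc j ⟨t, ht⟩
  intro j j' t t' ht ht'
  rw [hcol j t ht, hcol j' t' ht']
  constructor
  · intro heq
    obtain ⟨h1, h2⟩ := Prod.mk.inj heq
    obtain ⟨h2, h3⟩ := Prod.mk.inj h2
    rw [h1, h2, h3]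
  · intro heq
    obtain ⟨h1, h2⟩ := Prod.mk.inj heq
    obtain ⟨h2, h3⟩ := Prod.mk.inj h2
    dsimp only [Walks.dart] at h1 h2 h3
    rw [h1, h2, h3, hκ]

theorem mem_isoClass {γ' : PathTuple n d ℓ m} :
    γ' ∈ isoClass γ ↔ γ' ∈ W n d ℓ m ∧ γ.Iso γ' := by
  simp [isoClass]

theorem map_Ico_toWalks_c (j : Fin (2 * m)) : (List.Ico 0 ℓ).map ((γ.toWalks h).c j) =
    List.ofFn fun t : Fin ℓ => (γ j t.castSucc).2 := by
  rw [map_Ico_eq_ofFn _ (Nat.sub_zero ℓ)]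
  congr 1
  funext t
  rw [Nat.zero_add, ← toWalks_c (h := h), Fin.val_castSucc]

/-- A tuple isomorphic to `γ` is determined by the labels of its vertices, the last colors of its
paths and the words along the segments. -/
theorem sum_isoClass_le (φ : List (Fin (2 * d)) → ℝ) (h0 : ∀ u, 0 ≤ φ u) (h1 : φ [] ≤ 1)
    (hφ : ∀ u v, φ (u ++ v) ≤ φ u * φ v) (hinv : ∀ u, φ (inv u) = φ u) :
    ∑ γ' ∈ isoClass γ, ∏ j, φ (List.ofFn fun t : Fin ℓ => (γ' j t.castSucc).2) ≤
      (n : ℝ) ^ γ.graph.verts.ncard * (2 * d : ℝ) ^ (2 * m) *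
        ∏ κ : (γ.toWalks h).Seg, ∑ ω : Fin (Walks.len κ) → Fin (2 * d),
          φ (List.ofFn ω) ^ Walks.mult κ := by
  classical
  set w := γ.toWalks h with hw
  have hpos : ∀ y : γ.graph.verts, ∃ p : Fin (2 * m) × Fin (ℓ + 1), (γ p.1 p.2).1 = y := by
    rintro ⟨y, hy⟩
    obtain ⟨j, t, rfl⟩ := Set.mem_iUnion.1 hy
    exact ⟨(j, t), rfl⟩
  choose pos hpos using hpos
  let Φ : PathTuple n d ℓ m → (γ.graph.verts → Fin n) × (Fin (2 * m) → Fin (2 * d)) ×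
      ((κ : w.Seg) → Fin (Walks.len κ) → Fin (2 * d)) := fun γ' =>
    (fun y => (γ' (pos y).1 (pos y).2).1, fun j => (γ' j (Fin.last ℓ)).2,
      Walks.word fun j t => (γ' j ⟨min t ℓ, by omega⟩).2)
  have hnb : ∀ γ' ∈ isoClass γ, ∀ j, (γ' j).NonBacktracking := fun γ' hγ' j =>
    ((mem_isoClass.1 hγ').1.1 j).1
  have hinj : Set.InjOn Φ (isoClass γ) := by
    intro γ₁ hγ₁ γ₂ hγ₂ heq
    obtain ⟨e1, e2⟩ := Prod.mk.inj heq
    obtain ⟨e2, e3⟩ := Prod.mk.inj e2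
    have hx : ∀ j t, (γ₁ j t).1 = (γ₂ j t).1 := by
      intro j t
      obtain ⟨σ₁, -, -, hσ₁, -⟩ := (mem_isoClass.1 hγ₁).2
      obtain ⟨σ₂, -, -, hσ₂, -⟩ := (mem_isoClass.1 hγ₂).2
      have := congrFun e1 ⟨(γ j t).1, Set.mem_iUnion.2 ⟨j, t, rfl⟩⟩
      rw [hσ₁, hσ₂, hpos] at this
      rw [hσ₁, hσ₂, this]
    have hc : ∀ j t, (γ₁ j t).2 = (γ₂ j t).2 := by
      intro j t
      rcases Fin.eq_castSucc_or_eq_last t with ⟨u, rfl⟩ | rfl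
      · have := (isRecoloring_of_iso (h := h) (hnb γ₁ hγ₁)
          (mem_isoClass.1 hγ₁).2).eq_of_word_eq (isRecoloring_of_iso (hnb γ₂ hγ₂)
            (mem_isoClass.1 hγ₂).2) (fun κ => congrFun e3 κ) j u.2
        have h2 := toWalks_c (h := hnb γ₁ hγ₁) j u.castSucc
        have h3 := toWalks_c (h := hnb γ₂ hγ₂) j u.castSucc
        rw [Fin.val_castSucc] at h2 h3
        rw [← h2, ← h3, this]
      · exact congrFun e2 j
    funext j t
    exact Prod.ext (hx j t) (hc j t)
  have hle : ∀ γ' ∈ isoClass γ, ∏ j, φ (List.ofFn fun t : Fin ℓ => (γ' j t.castSucc).2) ≤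
      ∏ κ : w.Seg, φ (List.ofFn ((Φ γ').2.2 κ)) ^ Walks.mult κ := by
    intro γ' hγ'
    have := Walks.prod_le_prod_seg φ h0 h1 hφ hinv
      (isRecoloring_of_iso (h := h) (hnb γ' hγ') (mem_isoClass.1 hγ').2)
    simp only [map_Ico_toWalks_c] at this
    exact this
  refine (Finset.sum_le_sum hle).trans ?_
  rw [← Finset.sum_image (f := fun q : (γ.graph.verts → Fin n) × (Fin (2 * m) → Fin (2 * d)) ×
      ((κ : w.Seg) → Fin (Walks.len κ) → Fin (2 * d)) =>
      ∏ κ : w.Seg, φ (List.ofFn (q.2.2 κ)) ^ Walks.mult κ) hinj]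
  refine (Finset.sum_le_univ_sum_of_nonneg fun q =>
    Finset.prod_nonneg fun κ _ => pow_nonneg (h0 _) _).trans (le_of_eq ?_)
  simp only [Fintype.sum_prod_type, Finset.sum_const]
  rw [Finset.card_univ, Finset.card_univ, Fintype.card_fun, Fintype.card_fun, Fintype.card_fin,
    Fintype.card_fin, Fintype.card_fin, ← Nat.card_eq_fintype_card, Nat.card_coe_set_eq,
    Finset.prod_univ_sum, Fintype.piFinset_univ, nsmul_eq_mul, nsmul_eq_mul]
  push_cast
  ring

/-- The sum over the words along a segment that is traversed `k` times. If `k ≥ 2` then it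
converges; if `k = 1` then the number of words has to be paid for. -/
theorem sum_pow_le {φ : List (Fin (2 * d)) → ℝ} (hd : 1 ≤ d) (h0 : ∀ u, 0 ≤ φ u) {ρ B : ℝ}
    (hρ : 0 < ρ) (hB : 1 ≤ B) (hφρ : ∀ u, φ u ≤ ρ ^ u.length)
    (hsum : ∀ L, ∑ ω : Fin L → Fin (2 * d), φ (List.ofFn ω) ^ 2 ≤ B * (ρ ^ 2) ^ L) {k : ℕ}
    (hk : 1 ≤ k) (L : ℕ) : ∑ ω : Fin L → Fin (2 * d), φ (List.ofFn ω) ^ k ≤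
      B * (2 * d : ℝ) ^ (if k = 1 then L else 0) * ρ ^ (k * L) := by
  have hφρ' : ∀ ω : Fin L → Fin (2 * d), φ (List.ofFn ω) ≤ ρ ^ L := fun ω => by
    simpa using hφρ (List.ofFn ω)
  rcases hk.eq_or_lt with rfl | hk
  · rw [if_pos rfl, one_mul]
    refine (Finset.sum_le_sum fun ω _ => (pow_one (φ (List.ofFn ω))).trans_le (hφρ' ω)).trans ?_
    rw [Finset.sum_const, Finset.card_univ, Fintype.card_fun, Fintype.card_fin, Fintype.card_fin,
      nsmul_eq_mul]
    push_cast
    rw [mul_assoc]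
    exact le_mul_of_one_le_left (by positivity) hB
  · rw [if_neg (by omega), pow_zero, mul_one]
    obtain ⟨q, rfl⟩ : ∃ q, k = q + 2 := ⟨k - 2, by omega⟩
    calc ∑ ω : Fin L → Fin (2 * d), φ (List.ofFn ω) ^ (q + 2)
        ≤ ∑ ω : Fin L → Fin (2 * d), (ρ ^ L) ^ q * φ (List.ofFn ω) ^ 2 := by
          refine Finset.sum_le_sum fun ω _ => ?_
          rw [pow_add]
          exact mul_le_mul_of_nonneg_right (pow_le_pow_left₀ (h0 _) (hφρ' ω) q)
            (pow_nonneg (h0 _) 2)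
      _ ≤ (ρ ^ L) ^ q * (B * (ρ ^ 2) ^ L) := by
          rw [← Finset.mul_sum]
          exact mul_le_mul_of_nonneg_left (hsum L) (by positivity)
      _ = B * ρ ^ ((q + 2) * L) := by
          rw [← pow_mul, ← pow_mul]
          ring

/-- The combinatorial heart: for a submultiplicative, reversal-invariant quantity that is square
summable with rate `ρ ^ 2`, the sum over an isomorphism class decays with rate `ρ` for each step,
up to constants for segments, paths, and edges of multiplicity one. -/
theorem sum_isoClass_le_pow (hd : 1 ≤ d) {φ : List (Fin (2 * d)) → ℝ} (h0 : ∀ u, 0 ≤ φ u)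
    (h1 : φ [] ≤ 1) (hφ : ∀ u v, φ (u ++ v) ≤ φ u * φ v) (hinv : ∀ u, φ (inv u) = φ u) {ρ B : ℝ}
    (hρ : 0 < ρ) (hB : 1 ≤ B) (hdB : 2 * d ≤ B) (hφρ : ∀ u, φ u ≤ ρ ^ u.length)
    (hsum : ∀ L, ∑ ω : Fin L → Fin (2 * d), φ (List.ofFn ω) ^ 2 ≤ B * (ρ ^ 2) ^ L) (hℓ : 1 ≤ ℓ)
    (hγ : γ ∈ W n d ℓ m) :
    ∑ γ' ∈ isoClass γ, ∏ j, φ (List.ofFn fun t : Fin ℓ => (γ' j t.castSucc).2) ≤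
      B ^ (18 * (m + (γ.graph.edges.ncard + 1 - γ.graph.verts.ncard) + γ.multOne)) *
        (n : ℝ) ^ γ.graph.verts.ncard * ρ ^ (2 * ℓ * m) := by
  classical
  have hnb : ∀ j, (γ j).NonBacktracking := fun j => (hγ.1 j).1
  refine (sum_isoClass_le (h := hnb) φ h0 h1 hφ hinv).trans ?_
  have hB0 : (0 : ℝ) ≤ B := zero_le_one.trans hB
  have h2 : ∏ κ : (γ.toWalks hnb).Seg, ∑ ω : Fin (Walks.len κ) → Fin (2 * d),
      φ (List.ofFn ω) ^ Walks.mult κ ≤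
      B ^ (Fintype.card (γ.toWalks hnb).Seg) * (2 * d : ℝ) ^ γ.multOne * ρ ^ (2 * ℓ * m) := by
    refine (Finset.prod_le_prod (fun κ _ => Finset.sum_nonneg fun ω _ => pow_nonneg (h0 _) _)
      fun κ _ => sum_pow_le hd h0 hρ hB hφρ hsum (Walks.mult_pos κ) (Walks.len κ)).trans ?_
    rw [Finset.prod_mul_distrib, Finset.prod_mul_distrib, Finset.prod_const, Finset.card_univ,
      Finset.prod_pow_eq_pow_sum, Finset.prod_pow_eq_pow_sum, Walks.sum_mult_mul_len,
      Fintype.card_fin, show 2 * m * ℓ = 2 * ℓ * m by ring]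
    have h3 : (1 : ℝ) ≤ 2 * d := by
      have : (1 : ℝ) ≤ d := by exact_mod_cast hd
      linarith
    gcongr
    exact Walks.sum_len_le.trans ncard_multiplicity_one_le
  have h3 : Fintype.card (γ.toWalks hnb).Seg ≤
      6 * (γ.graph.edges.ncard + 1 - γ.graph.verts.ncard) + 16 * m := by
    have h4 := Walks.card_seg_le (w := γ.toWalks hnb)
    have h5 := Walks.card_branch_darts_add_le (w := γ.toWalks hnb) hℓ
    rw [← verts_eq, ← edges_eq, Fintype.card_fin] at h5
    omega
  calc _ ≤ (n : ℝ) ^ γ.graph.verts.ncard * B ^ (2 * m) *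
        (B ^ (6 * (γ.graph.edges.ncard + 1 - γ.graph.verts.ncard) + 16 * m) * B ^ γ.multOne *
          ρ ^ (2 * ℓ * m)) := by
        refine mul_le_mul ?_ (h2.trans ?_) (Finset.prod_nonneg fun κ _ =>
          Finset.sum_nonneg fun ω _ => pow_nonneg (h0 _) _) (by positivity)
        · gcongr
        · gcongr
    _ = B ^ (2 * m + (6 * (γ.graph.edges.ncard + 1 - γ.graph.verts.ncard) + 16 * m) +
          γ.multOne) * (n : ℝ) ^ γ.graph.verts.ncard * ρ ^ (2 * ℓ * m) := by
        rw [pow_add, pow_add]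
        ring
    _ ≤ _ := by
        gcongr
        omega

end PathTuple

/-! ### The trace of the operator of a tuple of paths -/

theorem HPath.NonBacktracking.reduced {n d ℓ : ℕ} {p : HPath n d (ℓ + 1)}
    (h : p.NonBacktracking) : Reduced (List.ofFn fun t => (p t).2) := by
  refine List.isChain_ofFn.2 fun i hi h1 => h ⟨i, by omega⟩ ?_
  rw [Fin.castSucc_mk, Fin.succ_mk, h1, bar_bar]

theorem HPath.NonBacktracking.reduced_tailWord {n d ℓ : ℕ} {p : HPath n d (ℓ + 1)}
    (h : p.NonBacktracking) : Reduced p.tailWord := by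
  have := h.reduced
  rw [List.ofFn_succ] at this
  exact this.tail

theorem HPath.NonBacktracking.reduced_initWord {n d ℓ : ℕ} {p : HPath n d (ℓ + 1)}
    (h : p.NonBacktracking) : Reduced (List.ofFn fun t : Fin ℓ => (p t.castSucc).2) := by
  have := h.reduced
  rw [List.ofFn_succ', List.concat_eq_append] at this
  exact List.IsChain.left_of_append this

theorem prod_odd_mul_even {m : ℕ} (a : Fin (2 * m) → ℝ) :
    ∏ k : Fin m, a (PathTuple.oddIdx k) * a (PathTuple.evenIdx k) = ∏ j, a j := by
  rw [← Fintype.prod_equiv (finProdFinEquiv.trans (finCongr (mul_comm m 2)))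
    (fun q => a ((finProdFinEquiv.trans (finCongr (mul_comm m 2))) q)) a fun _ => rfl,
    Fintype.prod_prod_type]
  refine Finset.prod_congr rfl fun k _ => ?_
  rw [Fin.prod_univ_two]
  congr 2
  · ext
    simp [PathTuple.oddIdx]
  · ext
    simp [PathTuple.evenIdx]
    omega

namespace SchottkyData

variable {d : ℕ} (S : SchottkyData d)

theorem scon_le_one (u : List (Fin (2 * d))) : S.scon u ≤ 1 := by
  obtain ⟨θ, h0, h1, h⟩ := S.exists_scon_le_pow
  exact (h u).trans (pow_le_one₀ h0.le h1.le)

/-- The color sequences of a path without the first color and without the last color have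
comparable contractions. -/
theorem exists_con_tailWord_le (hd : 2 ≤ d) : ∃ C : ℝ, 1 ≤ C ∧ ∀ {n ℓ : ℕ}, 1 ≤ ℓ →
    ∀ p : HPath n d (ℓ + 1), p.NonBacktracking →
      S.con p.tailWord ≤ C * S.scon (List.ofFn fun t : Fin ℓ => (p t.castSucc).2) := by
  obtain ⟨C, hC, h⟩ := S.exists_con_le_con_cons hd
  refine ⟨C, hC, fun {n ℓ} hℓ p hp => ?_⟩
  obtain ⟨k, rfl⟩ : ∃ k, ℓ = k + 1 := ⟨ℓ - 1, by omega⟩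
  have h1 := hp.reduced_initWord
  rw [List.ofFn_succ] at h1 ⊢
  rw [HPath.tailWord, List.ofFn_succ', List.concat_eq_append]
  calc _ ≤ S.con (List.ofFn fun i : Fin k => (p i.castSucc.succ).2) *
        S.con [(p (Fin.last k).succ).2] := S.con_append_le _ _
    _ ≤ S.con (List.ofFn fun i : Fin k => (p i.castSucc.succ).2) * 1 :=
        mul_le_mul_of_nonneg_left ((le_max_left _ _).trans (S.scon_le_one _)) (S.con_nonneg _)
    _ ≤ _ := by
        rw [mul_one]
        exact (h _ _ h1).trans (mul_le_mul_of_nonneg_left (le_max_left _ _) (by linarith))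

/-- The operator of a tuple of paths is trace class, with a bound in terms of the contractions of
the words of the paths. -/
theorem exists_hasNuclearBound_tupleOp (hd : 2 ≤ d) {σ : ℝ} (hσ : 0 ≤ σ) (T : ℝ) :
    ∃ D : ℝ, 1 ≤ D ∧ ∀ s : ℂ, σ ≤ s.re → ‖s‖ ≤ T → ∀ {n ℓ m : ℕ}, 1 ≤ ℓ → 1 ≤ m →
      ∀ γ ∈ W n d ℓ m, HasNuclearBound (S.tupleOp s γ)
        (D ^ (2 * m) * ∏ j, S.scon (List.ofFn fun t : Fin ℓ => (γ j t.castSucc).2) ^ σ) := by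
  obtain ⟨C₁, hC₁, h1⟩ := S.exists_hasNuclearBound_Aword hd T
  obtain ⟨C₂, hC₂, h2⟩ := S.exists_con_tailWord_le hd
  have hC₂0 : 0 ≤ C₂ := by linarith
  refine ⟨1 + C₁ * C₂ ^ T, le_add_of_nonneg_right (by positivity),
    fun s hs hsT {n ℓ m} hℓ hm γ hγ => ?_⟩
  have hre : s.re ≤ T := (Complex.re_le_norm s).trans hsT
  have hre0 : 0 ≤ s.re := hσ.trans hs
  set D := 1 + C₁ * C₂ ^ T
  have hj : ∀ j, HasNuclearBound (S.Aword s (γ j).tailWord)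
      (D * S.scon (List.ofFn fun t : Fin ℓ => (γ j t.castSucc).2) ^ σ) := by
    intro j
    have hnb := (hγ.1 j).1
    refine (h1 s hre0 hsT _ ?_ hnb.reduced_tailWord).mono ?_
    · rw [← List.length_pos_iff_ne_nil, HPath.tailWord, List.length_ofFn]
      omega
    · set q := S.scon (List.ofFn fun t : Fin ℓ => (γ j t.castSucc).2)
      have hq0 : 0 ≤ q := S.scon_nonneg _
      calc C₁ * S.con (γ j).tailWord ^ s.re ≤ C₁ * (C₂ * q) ^ s.re :=
            mul_le_mul_of_nonneg_left (Real.rpow_le_rpow (S.con_nonneg _) (h2 hℓ _ hnb) hre0) hC₁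
        _ = C₁ * (C₂ ^ s.re * q ^ s.re) := by rw [Real.mul_rpow hC₂0 hq0]
        _ ≤ C₁ * (C₂ ^ T * q ^ σ) := by
            refine mul_le_mul_of_nonneg_left (mul_le_mul (Real.rpow_le_rpow_of_exponent_le hC₂ hre)
              (Real.rpow_le_rpow_of_exponent_ge' hq0 (S.scon_le_one _) hσ hs)
              (by positivity) (by positivity)) hC₁
        _ ≤ D * q ^ σ := by
            rw [← mul_assoc]
            exact mul_le_mul_of_nonneg_right (le_add_of_nonneg_left zero_le_one) (by positivity)
  have h3 := hasNuclearBound_ofFn_prod hm (fun k => S.Aword s (γ (PathTuple.oddIdx k)).tailWord)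
    (fun k => S.Aword s (γ (PathTuple.evenIdx k)).tailWord) _ _ (fun k => hj _)
    (fun k => (hj _).norm_le)
  rw [prod_odd_mul_even fun j =>
    D * S.scon (List.ofFn fun t : Fin ℓ => (γ j t.castSucc).2) ^ σ, Finset.prod_mul_distrib,
    Finset.prod_const, Finset.card_univ, Fintype.card_fin] at h3
  exact h3

/-- The power `σ` of the contraction has a uniform exponential decay of its squares when
`δ / 2 < σ`. -/
theorem exists_sum_scon_rpow_sq_le (hd : 2 ≤ d) {σ : ℝ} (hσ : S.delta / 2 < σ) :
    ∃ ρ : ℝ, 0 < ρ ∧ ρ < 1 ∧ (∀ u, S.scon u ^ σ ≤ ρ ^ u.length) ∧ ∃ C : ℝ, 0 < C ∧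
      ∀ L, ∑ ω : Fin L → Fin (2 * d), (S.scon (List.ofFn ω) ^ σ) ^ 2 ≤ C * (ρ ^ 2) ^ L := by
  have hσ0 : 0 < σ := lt_of_le_of_lt (by linarith [S.delta_nonneg]) hσ
  obtain ⟨ρ₁, hρ0, hρ1, C, hC, h⟩ := S.exists_sum_scon_le hd (σ := σ * 2) (by linarith)
  obtain ⟨θ, hθ0, hθ1, hθ⟩ := S.exists_scon_le_pow
  have hsq : ρ₁ ≤ max (Real.sqrt ρ₁) (θ ^ σ) ^ 2 :=
    (Real.sq_sqrt hρ0.le).ge.trans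
      (pow_le_pow_left₀ (Real.sqrt_nonneg _) (le_max_left _ _) 2)
  refine ⟨max (Real.sqrt ρ₁) (θ ^ σ), lt_max_of_lt_left (Real.sqrt_pos.2 hρ0),
    max_lt ((Real.sqrt_lt' one_pos).2 (by simpa using hρ1)) (Real.rpow_lt_one hθ0.le hθ1 hσ0),
    fun u => ?_, C, hC, fun L => ?_⟩
  · refine (Real.rpow_le_rpow (S.scon_nonneg u) (hθ u) hσ0.le).trans ?_
    rw [← Real.rpow_natCast, ← Real.rpow_mul hθ0.le, mul_comm, Real.rpow_mul hθ0.le,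
      Real.rpow_natCast]
    exact pow_le_pow_left₀ (by positivity) (le_max_right _ _) _
  · have h1 := h L
    rw [sum_words] at h1
    refine le_trans (le_of_eq ?_) (h1.trans (mul_le_mul_of_nonneg_left
      (pow_le_pow_left₀ hρ0.le hsq L) hC.le))
    refine Finset.sum_congr rfl fun ω _ => ?_
    rw [← Real.rpow_natCast, ← Real.rpow_mul (S.scon_nonneg _), Nat.cast_ofNat]

end SchottkyData

end SchottkyTrace

theorem mainTheorem4 (d : ℕ) (hd : 2 ≤ d) (S : SchottkyTrace.SchottkyData d) (K : Set ℂ)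
    (hK : IsCompact K) (hKδ : ∀ s ∈ K, S.delta / 2 < s.re) :
    ∃ ρ : ℝ, 0 < ρ ∧ ρ < 1 ∧ ∃ C : ℝ, 0 < C ∧
      ∀ s ∈ K, ∀ n ℓ m v e : ℕ, 1 ≤ ℓ → 1 ≤ m →
        ∀ γ₀ ∈ SchottkyTrace.Wve n d ℓ m v e,
          (∀ γ ∈ SchottkyTrace.isoClass γ₀, SchottkyTrace.IsTraceClass (S.tupleOp s γ)) ∧
          ∑ γ ∈ SchottkyTrace.isoClass γ₀, ‖SchottkyTrace.opTrace (S.tupleOp s γ)‖ ≤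
            C ^ ((m : ℤ) + ((e : ℤ) - (v : ℤ) + 1) + (γ₀.multOne : ℤ)) * (n : ℝ) ^ v *
              ρ ^ (2 * ℓ * m) := by
  rcases K.eq_empty_or_nonempty with rfl | hKne
  · exact ⟨1 / 2, by norm_num, by norm_num, 1, one_pos, fun s hs => absurd hs (Set.notMem_empty s)⟩
  obtain ⟨s₀, hs₀, hmin⟩ := hK.exists_isMinOn hKne Complex.continuous_re.continuousOn
  obtain ⟨T, hT⟩ := hK.isBounded.exists_norm_le
  have hσ := hKδ s₀ hs₀
  have hσ0 : 0 ≤ s₀.re := le_of_lt (lt_of_le_of_lt (by linarith [S.delta_nonneg]) hσ)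
  obtain ⟨ρ, hρ0, hρ1, hρ, B, hB, hsum⟩ := S.exists_sum_scon_rpow_sq_le hd hσ
  obtain ⟨D, hD, hnuc⟩ := S.exists_hasNuclearBound_tupleOp hd hσ0 T
  -- a common upper bound for all constants
  set P : ℝ := 2 * d + B + D with hP
  have hd0 : (0 : ℝ) ≤ d := Nat.cast_nonneg d
  have hDP : D ≤ P := by linarith
  have hP1 : 1 ≤ P := hD.trans hDP
  refine ⟨ρ, hρ0, hρ1, P ^ 20, by positivity, ?_⟩
  rintro s hs n ℓ m v e hℓ hm γ₀ ⟨hγ₀, rfl, rfl⟩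
  have hclass : ∀ γ ∈ SchottkyTrace.isoClass γ₀, SchottkyTrace.HasNuclearBound (S.tupleOp s γ)
      (D ^ (2 * m) * ∏ j, S.scon (List.ofFn fun t : Fin ℓ => (γ j t.castSucc).2) ^ s₀.re) :=
    fun γ hγ => hnuc s (hmin hs) (hT s hs) hℓ hm γ (SchottkyTrace.PathTuple.mem_isoClass.1 hγ).1
  refine ⟨fun γ hγ => (hclass γ hγ).isTraceClass, ?_⟩
  have hrank := SchottkyTrace.PathTuple.ncard_verts_le hm hγ₀
  set v := γ₀.graph.verts.ncard
  set e := γ₀.graph.edges.ncard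
  have hexp : (m : ℤ) + ((e : ℤ) - (v : ℤ) + 1) + (γ₀.multOne : ℤ) =
      ((m + (e + 1 - v) + γ₀.multOne : ℕ) : ℤ) := by
    push_cast [Nat.cast_sub hrank]
    ring
  have hiso := SchottkyTrace.PathTuple.sum_isoClass_le_pow (γ := γ₀) (by omega)
    (φ := fun u => S.scon u ^ s₀.re) (fun u => Real.rpow_nonneg (S.scon_nonneg u) _)
    (Real.rpow_le_one (S.scon_nonneg _) (S.scon_le_one _) hσ0)
    (fun u v => (Real.rpow_le_rpow (S.scon_nonneg _) (S.scon_append_le u v) hσ0).trans_eq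
      (Real.mul_rpow (S.scon_nonneg _) (S.scon_nonneg _)))
    (fun u => by rw [S.scon_inv]) hρ0 hP1 (by linarith) hρ
    (fun L => (hsum L).trans (mul_le_mul_of_nonneg_right (by linarith) (by positivity))) hℓ hγ₀
  rw [hexp, zpow_natCast, ← pow_mul]
  calc ∑ γ ∈ SchottkyTrace.isoClass γ₀, ‖SchottkyTrace.opTrace (S.tupleOp s γ)‖
      ≤ D ^ (2 * m) * ∑ γ ∈ SchottkyTrace.isoClass γ₀,
          ∏ j, S.scon (List.ofFn fun t : Fin ℓ => (γ j t.castSucc).2) ^ s₀.re := by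
        rw [Finset.mul_sum]
        exact Finset.sum_le_sum fun γ hγ => (hclass γ hγ).norm_opTrace_le
    _ ≤ P ^ (2 * m) * (P ^ (18 * (m + (e + 1 - v) + γ₀.multOne)) * (n : ℝ) ^ v *
          ρ ^ (2 * ℓ * m)) := by
        refine mul_le_mul (pow_le_pow_left₀ (by linarith) hDP _) hiso
          (Finset.sum_nonneg fun γ _ => Finset.prod_nonneg fun j _ =>
            Real.rpow_nonneg (S.scon_nonneg _) _) (by positivity)
    _ = P ^ (2 * m + 18 * (m + (e + 1 - v) + γ₀.multOne)) * (n : ℝ) ^ v * ρ ^ (2 * ℓ * m) := by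
        rw [pow_add]
        ring
    _ ≤ _ := by
        gcongr
        omega
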